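/- **Setting.** Let $\mathrm{UC}$ be the set of upper semicontinuous $\mathfrak h:\mathbb R\to[-\infty,\infty)$, $\mathfrak h\not\equiv-\infty$, with $\limsup_{x\to\pm\infty}\mathfrak h(x)/x^2\le 0$, with the topology of local Hausdorff convergence of hypographs, and let $\mathrm{supp}(\mathfrak h)=\overline{\{x:\mathfrak h(x)\ne-\infty\}}$. Let $\mathbf B$ be a two-sided Brownian motion with diffusivity constant $2$. For compactly supported $\mathfrak h\in\mathrm{UC}$ put $\tau_+=\inf\{a\ge0:\mathbf B(a)\le\mathfrak h(a)\}$, $\tau_-=\sup\{a\le0:\mathbf B(a)\le\mathfrak h(a)\}$ and, for $\mathrm{Re}\,\eta>0$, $\mathrm{Re}\,\xi<0$, $$\chi_{\mathfrak h}(\eta,\xi)=\int_{\mathbb R}e^{s\eta}E^+_s\,ds+\int_{\mathbb R}e^{-s\xi}E^-_s\,ds-\int_{\mathbb R}E^+_sE^-_s\,ds,$$ $$E_s^+=\mathbb E_{\mathbf B(0)=s}\big[e^{-\tau_+\xi^2-\mathbf B(\tau_+)\xi}\mathbf 1_{\tau_+<\infty}\big],\qquad E_s^-=\mathbb E_{\mathbf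 B(0)=s}\big[e^{\tau_-\eta^2+\mathbf B(\tau_-)\eta}\mathbf 1_{\tau_->-\infty}\big].$$ Let $m\ge1$, and let $(\alpha_i,\tau_i,\beta_i)\in\mathbb R\times(0,\infty)\times\mathbb R$, $1\le i\le m$, be such that for $i<j$ either $\tau_i<\tau_j$, or $\tau_i=\tau_j$ and $\alpha_i<\alpha_j$; put $\alpha_0=\tau_0=\beta_0=0$. Let $$\mathrm f_i(\zeta)=\exp\!\big(-\tfrac13(\tau_i-\tau_{i-1})\zeta^3+(\alpha_i-\alpha_{i-1})\zeta^2+(\beta_i-\beta_{i-1})\zeta\big),$$ and $\hat{\mathrm f}_i=\mathrm f_i$ for $\mathrm{Re}\,\zeta<0$, $\hat{\mathrm f}_i=1/\mathrm f_i$ for $\mathrm{Re}\,\zeta>0$. Let $\Gamma^{\rm out}_{m,\rm L},\dots,\Gamma^{\rm out}_{2,\rm L},\Gamma_{1,\rm L},\Gamma^{\rm in}_{2,\rm L},\dots,\Gamma^{\rm in}_{m,\rm L}$ be simple contours in $\{\mathrm{Re}\,\zeta<0\}$ from $\infty e^{-2\pi i/3}$ to $\infty e^{2\pi i/3}$, nested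 from right to left, and let $\Gamma^{\rm out}_{m,\rm R},\dots,\Gamma^{\rm out}_{2,\rm R},\Gamma_{1,\rm R},\Gamma^{\rm in}_{2,\rm R},\dots,\Gamma^{\rm in}_{m,\rm R}$ be simple contours in $\{\mathrm{Re}\,\zeta>0\}$ from $\infty e^{-\pi i/5}$ to $\infty e^{\pi i/5}$, nested from left to right. Distinct contours are at positive distance, and every contour has a Lipschitz parametrization $\gamma$ with $\gamma(t)/|t|\to e^{\pm i\theta}$ as $t\to\pm\infty$, where $\theta=2\pi/3$ (left) or $\theta=\pi/5$ (right). For $\ell\ge2$ put $\Gamma_{\ell,\bullet}=\Gamma_{\ell,\bullet}^{\rm out}\cup\Gamma_{\ell,\bullet}^{\rm in}$, and let $\mathrm S_1=\Gamma_{1,\rm L}\cup\Gamma_{2,\rm R}\cup\Gamma_{3,\rm L}\cup\cdots$ and $\mathrm S_2=\Gamma_{1,\rm R}\cup\Gamma_{2,\rm L}\cup\Gamma_{3,\rm R}\cup\cdots$ (up to index $m$). For $z=(z_1,\dots,z_{m-1})$ with $0<|z_\ell|<1$ let $d\mu_z$ be $\frac{d\zeta}{2\pi i}$ on $\Gamma_{1,\bullet}$,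 $\frac{-z_{\ell-1}}{1-z_{\ell-1}}\frac{d\zeta}{2\pi i}$ on $\Gamma^{\rm out}_{\ell,\bullet}$ and $\frac{1}{1-z_{\ell-1}}\frac{d\zeta}{2\pi i}$ on $\Gamma^{\rm in}_{\ell,\bullet}$. Let $Q_1(j)=1-z_j$ for $j$ odd, $j<m$; $Q_1(j)=1-1/z_{j-1}$ for $j$ even; $Q_1(m)=1$ for $m$ odd. Let $Q_2(j)=1-z_j$ for $j$ even, $j<m$; $Q_2(j)=1-1/z_{j-1}$ for $j$ odd, $j>1$; $Q_2(1)=1$; $Q_2(m)=1$ for $m$ even. For $\zeta\in\mathrm S_1$ of level $i$ (that is, on $\Gamma_{i,\bullet}$) and $\zeta'\in\mathrm S_2$ of level $j$ let $$\mathrm K_1(\zeta,\zeta')=\big(\mathbf 1_{i=j}+\mathbf 1_{i=j+(-1)^i}\big)\frac{\hat{\mathrm f}_i(\zeta)}{\zeta-\zeta'}Q_1(j),$$ $$\mathrm K_{\mathfrak h}(\zeta',\zeta)=\begin{cases}\big(\mathbf 1_{j=i}+\mathbf 1_{j=i-(-1)^j}\big)\dfrac{\hat{\mathrm f}_j(\zeta')}{\zeta-\zeta'}Q_2(i),&i\ge2,\\[1ex]-\mathbf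 1_{j=1}\,\hat{\mathrm f}_1(\zeta')\,\chi_{\mathfrak h}(\zeta',\zeta),&i=1,\end{cases}$$ and let $\mathrm D_{\mathfrak h}(z)=\det(\mathrm I-\mathrm K_1\mathrm K_{\mathfrak h})_{L^2(\mathrm S_1,d\mu_z)}$ be the Fredholm determinant, that is, with $\mathrm K(x,y)=\int_{\mathrm S_2}\mathrm K_1(x,\zeta')\mathrm K_{\mathfrak h}(\zeta',y)\,d\mu_z(\zeta')$, $$\mathrm D_{\mathfrak h}(z)=\sum_{n\ge0}\frac{(-1)^n}{n!}\int_{\mathrm S_1^n}\det[\mathrm K(x_i,x_j)]_{i,j=1}^n\,d\mu_z(x_1)\cdots d\mu_z(x_n).$$ **Proposition.** Let $L,\beta\in\mathbb R$ and let $\mathfrak h$ and $\mathfrak h^n$ ($n\ge1$) be in $\mathrm{UC}$, all with support in $[-L,L]$ and all bounded above by $\beta$. Suppose that $\mathfrak h^n\to\mathfrak h$ in $\mathrm{UC}$. Then $$\lim_{n\to\infty}\chi_{\mathfrak h^n}(\eta,\xi)=\chi_{\mathfrak h}(\eta,\xi)\qquad\text{for all }\eta,\xi\text{ with }\mathrm{Re}\,\eta>0,\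 \mathrm{Re}\,\xi<0.$$ Consequently, for all $m$, $(\alpha_i,\tau_i,\beta_i)$ and contours as above and all radii $r_1,\dots,r_{m-1}\in(0,1)$, $$\lim_{n\to\infty}\prod_{\ell=1}^{m-1}\oint_{|z_\ell|=r_\ell}\frac{dz_\ell}{2\pi i z_\ell(1-z_\ell)}\,\mathrm D_{\mathfrak h^n}(z_1,\dots,z_{m-1})=\prod_{\ell=1}^{m-1}\oint_{|z_\ell|=r_\ell}\frac{dz_\ell}{2\pi i z_\ell(1-z_\ell)}\,\mathrm D_{\mathfrak h}(z_1,\dots,z_{m-1}),$$ the circles being oriented counterclockwise. -/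

import Mathlib

open MeasureTheory ProbabilityTheory Filter Topology
open scoped NNReal

noncomputable section

/-! ### Initial conditions -/

/-- The space `UC`: upper semicontinuous `h : ℝ → [-∞, ∞)`, not identically `-∞`, with
`limsup_{x → ±∞} h(x) / x² ≤ 0`. -/
structure IsUC (h : ℝ → EReal) : Prop where
  usc : UpperSemicontinuous h
  ne_top : ∀ x, h x ≠ ⊤
  exists_ne_bot : ∃ x, h x ≠ ⊥
  limsup_atTop : limsup (fun x : ℝ => h x / ((x ^ 2 : ℝ) : EReal)) atTop ≤ 0
  limsup_atBot : limsup (fun x : ℝ => h x / ((x ^ 2 : ℝ) : EReal)) atBot ≤ 0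

/-- The support of `h`: the closure of `{x | h x ≠ -∞}`. -/
def ucSupport (h : ℝ → EReal) : Set ℝ := closure {x | h x ≠ ⊥}

/-- The hypograph of `h`, as a subset of the plane. -/
def hypograph (h : ℝ → EReal) : Set (ℝ × ℝ) := {p | (p.2 : EReal) ≤ h p.1}

/-- Local Hausdorff convergence of hypographs: inside every ball, each of the two hypographs is
eventually contained in the `δ`-neighbourhood of the other, for every `δ > 0`. -/
def TendstoUC (hs : ℕ → ℝ → EReal) (h : ℝ → EReal) : Prop :=
  ∀ R > (0 : ℝ), ∀ δ > (0 : ℝ), ∀ᶠ n in atTop,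
    hypograph (hs n) ∩ Metric.closedBall 0 R ⊆ Metric.thickening δ (hypograph h) ∧
    hypograph h ∩ Metric.closedBall 0 R ⊆ Metric.thickening δ (hypograph (hs n))

/-! ### Two-sided Brownian motion and the characteristic function -/

/-- `B` is a two-sided Brownian motion with diffusivity constant `2` (so `B t - B s` has variance
`2 |t - s|`) and `B 0 = 0`: its two halves, divided by `√2`, are independent standard
Brownian motions. The motion started from `B(0) = s` is `s + B`. -/
structure IsTwoSidedBrownian {Ω : Type*} [MeasurableSpace Ω] (P : Measure Ω)
    (B : ℝ → Ω → ℝ) : Prop where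
  right : IsBrownianReal (fun (t : ℝ≥0) ω => (√2)⁻¹ * B t ω) P
  left : IsBrownianReal (fun (t : ℝ≥0) ω => (√2)⁻¹ * B (-t) ω) P
  indep : IndepFun (fun ω (t : ℝ≥0) => B t ω) (fun ω (t : ℝ≥0) => B (-t) ω) P

/-- The times `a ≥ 0` at which the path `b` is in the hypograph of `h`. -/
def hitSetPos (h : ℝ → EReal) (b : ℝ → ℝ) : Set ℝ := {a | 0 ≤ a ∧ (b a : EReal) ≤ h a}

/-- The times `a ≤ 0` at which the path `b` is in the hypograph of `h`. -/
def hitSetNeg (h : ℝ → EReal) (b : ℝ → ℝ) : Set ℝ := {a | a ≤ 0 ∧ (b a : EReal) ≤ h a}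

open Classical in
/-- `exp(-τ₊ ξ² - b(τ₊) ξ) 1_{τ₊ < ∞}` with `τ₊ = inf {a ≥ 0 | b(a) ≤ h(a)}`; the event
`τ₊ < ∞` is that the set of hitting times is non-empty. -/
def hitPosWeight (h : ℝ → EReal) (ξ : ℂ) (b : ℝ → ℝ) : ℂ :=
  if (hitSetPos h b).Nonempty then
    Complex.exp (-((sInf (hitSetPos h b) : ℝ) : ℂ) * ξ ^ 2 - (b (sInf (hitSetPos h b)) : ℂ) * ξ)
  else 0

open Classical in
/-- `exp(τ₋ η² + b(τ₋) η) 1_{τ₋ > -∞}` with `τ₋ = sup {a ≤ 0 | b(a) ≤ h(a)}`. -/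
def hitNegWeight (h : ℝ → EReal) (η : ℂ) (b : ℝ → ℝ) : ℂ :=
  if (hitSetNeg h b).Nonempty then
    Complex.exp (((sSup (hitSetNeg h b) : ℝ) : ℂ) * η ^ 2 + (b (sSup (hitSetNeg h b)) : ℂ) * η)
  else 0

/-- `E_{B(0) = s}[exp(-τ₊ ξ² - B(τ₊) ξ) 1_{τ₊ < ∞}]`. -/
def expectPos {Ω : Type*} [MeasurableSpace Ω] (P : Measure Ω) (B : ℝ → Ω → ℝ)
    (h : ℝ → EReal) (ξ : ℂ) (s : ℝ) : ℂ :=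
  ∫ ω, hitPosWeight h ξ (fun a => s + B a ω) ∂P

/-- `E_{B(0) = s}[exp(τ₋ η² + B(τ₋) η) 1_{τ₋ > -∞}]`. -/
def expectNeg {Ω : Type*} [MeasurableSpace Ω] (P : Measure Ω) (B : ℝ → Ω → ℝ)
    (h : ℝ → EReal) (η : ℂ) (s : ℝ) : ℂ :=
  ∫ ω, hitNegWeight h η (fun a => s + B a ω) ∂P

/-- The characteristic function `χ_h(η, ξ)` of the initial condition `h`. -/
def chi {Ω : Type*} [MeasurableSpace Ω] (P : Measure Ω) (B : ℝ → Ω → ℝ)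
    (h : ℝ → EReal) (η ξ : ℂ) : ℂ :=
  (∫ s : ℝ, Complex.exp (s * η) * expectPos P B h ξ s)
    + (∫ s : ℝ, Complex.exp (-s * ξ) * expectNeg P B h η s)
    - ∫ s : ℝ, expectPos P B h ξ s * expectNeg P B h η s

/-! ### The contours

The `2m - 1` nested contours `Γ_m^out, …, Γ_2^out, Γ_1, Γ_2^in, …, Γ_m^in` of either half plane are
indexed, in this order, by the integers `-(m-1), …, m-1`: the index `0` stands for `Γ_1`, and the
index `k < 0` (resp. `k > 0`) for `Γ_{|k|+1}^out` (resp. `Γ_{|k|+1}^in`). -/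

/-- `γ` parametrizes an unbounded simple contour from `∞ e^{-iθ}` to `∞ e^{iθ}`. -/
structure IsAiryContour (θ : ℝ) (γ : ℝ → ℂ) : Prop where
  lipschitz : ∃ C : ℝ≥0, LipschitzWith C γ
  injective : Function.Injective γ
  atTop : Tendsto (fun t : ℝ => γ t / t) atTop (𝓝 (Complex.exp (θ * Complex.I)))
  atBot : Tendsto (fun t : ℝ => γ t / (-t)) atBot (𝓝 (Complex.exp (-θ * Complex.I)))

/-- The nested families of left contours (angle `2π/3`, nested from the right to the left) and of
right contours (angle `π/5`, nested from the left to the right). The contour with the larger index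
lies on the side of `-∞` (resp. `+∞`) of the contour with the smaller index, and distinct contours
are at a positive distance. -/
structure IsNestedContours (m : ℕ) (γL γR : ℤ → ℝ → ℂ) : Prop where
  contour_left : ∀ k : ℤ, |k| < m → IsAiryContour (2 * Real.pi / 3) (γL k)
  contour_right : ∀ k : ℤ, |k| < m → IsAiryContour (Real.pi / 5) (γR k)
  re_left : ∀ k : ℤ, |k| < m → ∀ t, (γL k t).re < 0
  re_right : ∀ k : ℤ, |k| < m → ∀ t, 0 < (γR k t).re
  nested_left : ∀ k k' : ℤ, |k| < m → |k'| < m → k < k' → ∀ t,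
    ∀ᶠ r : ℝ in atBot, JoinedIn (Set.range (γL k))ᶜ (γL k' t) (r : ℂ)
  nested_right : ∀ k k' : ℤ, |k| < m → |k'| < m → k < k' → ∀ t,
    ∀ᶠ r : ℝ in atTop, JoinedIn (Set.range (γR k))ᶜ (γR k' t) (r : ℂ)
  separated : ∃ δ > (0 : ℝ), ∀ k k' : ℤ, |k| < m → |k'| < m → k ≠ k' → ∀ s t,
    δ ≤ dist (γL k s) (γL k' t) ∧ δ ≤ dist (γR k s) (γR k' t)

/-- The set of indices of the contours. -/
abbrev ContourIdx (m : ℕ) : Type := ↥(Finset.Ioo (-(m : ℤ)) (m : ℤ))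

/-- The level `ℓ` of a contour `Γ_ℓ`, `Γ_ℓ^out` or `Γ_ℓ^in`. -/
def level (k : ℤ) : ℕ := k.natAbs + 1

/-- The contours that make up `S₁ = Γ_{1,L} ∪ Γ_{2,R} ∪ Γ_{3,L} ∪ ⋯`. -/
def contourS₁ (γL γR : ℤ → ℝ → ℂ) (k : ℤ) : ℝ → ℂ := if Odd (level k) then γL k else γR k

/-- The contours that make up `S₂ = Γ_{1,R} ∪ Γ_{2,L} ∪ Γ_{3,R} ∪ ⋯`. -/
def contourS₂ (γL γR : ℤ → ℝ → ℂ) (k : ℤ) : ℝ → ℂ := if Odd (level k) then γR k else γL k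

/-- The coefficient of `dζ / (2πi)` in `dμ_z` on the contour with index `k`. -/
def muCoeff (z : ℕ → ℂ) (k : ℤ) : ℂ :=
  if k = 0 then 1
  else if k < 0 then -z (level k - 1) / (1 - z (level k - 1))
  else 1 / (1 - z (level k - 1))

/-- The density of `dμ_z` with respect to `dt` on the contour with index `k`, parametrized by
`γ`. -/
def muDensity (z : ℕ → ℂ) (k : ℤ) (γ : ℝ → ℂ) (t : ℝ) : ℂ :=
  muCoeff z k * (deriv γ t / (2 * Real.pi * Complex.I))

/-! ### The kernels -/

/-- `Q₁(j)`. -/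
def Q₁ (m : ℕ) (z : ℕ → ℂ) (j : ℕ) : ℂ :=
  if Odd j then (if j < m then 1 - z j else 1) else 1 - 1 / z (j - 1)

/-- `Q₂(j)`. -/
def Q₂ (m : ℕ) (z : ℕ → ℂ) (j : ℕ) : ℂ :=
  if Even j then (if j < m then 1 - z j else 1) else if j = 1 then 1 else 1 - 1 / z (j - 1)

/-- The increment `a_i - a_{i-1}`, with the convention `a_0 = 0`. -/
def increment (a : ℕ → ℝ) (i : ℕ) : ℝ := if i = 1 then a 1 else a i - a (i - 1)

/-- `f_i(ζ) = exp(-(τ_i - τ_{i-1}) ζ³ / 3 + (α_i - α_{i-1}) ζ² + (β_i - β_{i-1}) ζ)`. -/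
def fFun (α τ β : ℕ → ℝ) (i : ℕ) (ζ : ℂ) : ℂ :=
  Complex.exp (-(1 / 3 : ℂ) * (increment τ i : ℂ) * ζ ^ 3 + (increment α i : ℂ) * ζ ^ 2
    + (increment β i : ℂ) * ζ)

/-- `f_i` in the left half plane and `1 / f_i` in the right half plane. -/
def fHat (α τ β : ℕ → ℝ) (i : ℕ) (ζ : ℂ) : ℂ :=
  if ζ.re < 0 then fFun α τ β i ζ else 1 / fFun α τ β i ζ

/-- The kernel `K₁(ζ, ζ')`, for `ζ ∈ S₁` of level `i` and `ζ' ∈ S₂` of level `j`. -/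
def kernel₁ (m : ℕ) (α τ β : ℕ → ℝ) (z : ℕ → ℂ) (i : ℕ) (ζ : ℂ) (j : ℕ) (ζ' : ℂ) : ℂ :=
  ((if i = j then 1 else 0) + (if (i : ℤ) = (j : ℤ) + (-1) ^ i then 1 else 0))
    * (fHat α τ β i ζ / (ζ - ζ')) * Q₁ m z j

/-- The kernel `K_h(ζ', ζ)`, for `ζ' ∈ S₂` of level `j` and `ζ ∈ S₁` of level `i`, where `χ` is the
characteristic function of the initial condition. All contours being oriented upwards, the entry
with `i = j = 1` is `-f̂₁(ζ') χ(ζ', ζ)`; for the narrow wedge, where `χ(ζ', ζ) = 1 / (ζ' - ζ)`, it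
has the same form `f̂₁(ζ') / (ζ - ζ')` as the other entries. -/
def kernelInit (m : ℕ) (α τ β : ℕ → ℝ) (z : ℕ → ℂ) (χ : ℂ → ℂ → ℂ)
    (j : ℕ) (ζ' : ℂ) (i : ℕ) (ζ : ℂ) : ℂ :=
  if i = 1 then (if j = 1 then -(fHat α τ β 1 ζ' * χ ζ' ζ) else 0)
  else ((if j = i then 1 else 0) + (if (j : ℤ) = (i : ℤ) - (-1) ^ j then 1 else 0))
    * (fHat α τ β j ζ' / (ζ - ζ')) * Q₂ m z i

/-- The kernel `(K₁ K_h)(x, y) = ∫_{S₂} K₁(x, ζ') K_h(ζ', y) dμ(ζ')` on `S₁ × S₁`; a point of `S₁` is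
given by the index of its contour and its parameter. -/
def kernelProd (m : ℕ) (α τ β : ℕ → ℝ) (γL γR : ℤ → ℝ → ℂ) (χ : ℂ → ℂ → ℂ) (z : ℕ → ℂ)
    (x y : ContourIdx m × ℝ) : ℂ :=
  ∑ c : ContourIdx m, ∫ t : ℝ,
    kernel₁ m α τ β z (level x.1) (contourS₁ γL γR x.1 x.2) (level c) (contourS₂ γL γR c t)
      * kernelInit m α τ β z χ (level c) (contourS₂ γL γR c t)
          (level y.1) (contourS₁ γL γR y.1 y.2)
      * muDensity z c (contourS₂ γL γR c) t

/-- The Fredholm determinant `det(I - K)` of the integral operator with kernel `K` on the space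
`ι × ℝ` with the complex measure `w dt`:
`∑_n (-1)^n / n! ∫ det[K(x_i, x_j)]_{i,j ≤ n} w(x_1) ⋯ w(x_n) dx_1 ⋯ dx_n`. -/
def fredholmDet {ι : Type*} [Fintype ι] (K : ι × ℝ → ι × ℝ → ℂ) (w : ι × ℝ → ℂ) : ℂ :=
  ∑' n : ℕ, (-1) ^ n / (n.factorial : ℂ) * ∑ c : Fin n → ι, ∫ t : Fin n → ℝ,
    (Matrix.of fun i j : Fin n => K (c i, t i) (c j, t j)).det * ∏ i, w (c i, t i)

/-- `D_h(z_1, …, z_{m-1}) = det(I - K₁ K_h)` on `L²(S₁, dμ_z)`, where `χ = χ_h`. -/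
def multipointD (m : ℕ) (α τ β : ℕ → ℝ) (γL γR : ℤ → ℝ → ℂ) (χ : ℂ → ℂ → ℂ) (z : ℕ → ℂ) : ℂ :=
  fredholmDet (kernelProd m α τ β γL γR χ z)
    (fun x : ContourIdx m × ℝ => muDensity z x.1 (contourS₁ γL γR x.1) x.2)

/-- The numbers `z_1, …, z_{m-1}` with their usual indices (`0` for all other indices). -/
def zSeq {m : ℕ} (z : Fin (m - 1) → ℂ) (j : ℕ) : ℂ :=
  if hj : 1 ≤ j ∧ j - 1 < m - 1 then z ⟨j - 1, hj.2⟩ else 0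

/-- `∮ dz_1 / (2πi z_1 (1 - z_1)) ⋯ ∮ dz_{m-1} / (2πi z_{m-1} (1 - z_{m-1})) D_h(z_1, …, z_{m-1})` over
the counterclockwise circles `|z_ℓ| = r_ℓ`, where `χ = χ_h`. -/
def multipointFormula (m : ℕ) (α τ β : ℕ → ℝ) (γL γR : ℤ → ℝ → ℂ) (r : Fin (m - 1) → ℝ)
    (χ : ℂ → ℂ → ℂ) : ℂ :=
  torusIntegral (fun z : Fin (m - 1) → ℂ =>
    (∏ l, 1 / (2 * Real.pi * Complex.I * z l * (1 - z l)))
      * multipointD m α τ β γL γR χ (zSeq z)) 0 r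

end

/-!
The convergence of the characteristic functions and of the contour integrals.

Reflection at `0` turns `E⁻` into an expectation of the form `E⁺` (`hitNegWeight_eq`), so that only
hitting times to the right of `0` have to be studied. The motion may be replaced by its law on the
space of continuous paths (`exists_pathLaw`), where the hitting time is a measurable function of the
path and the starting point `s`. For a fixed path, local Hausdorff convergence of the hypographs gives
`liminf τ₊(h^n) ≥ τ₊(h)`. For the reverse inequality it suffices that, right after `τ₊(h)`, the path is
strictly below `h`. This holds whenever the hitting time is right continuous in `s`; as it is monotone
in `s`, each path has only countably many exceptional `s`, and by Fubini's theorem almost every `s` is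
good for almost every path (`ae_hitTime_eq_iInf`). No fine property of Brownian motion is needed.

The argument breaks down at the time `0`, since `h^n` may approach `h` at `0` from one side only. If
`s > h(0)`, then the path does not meet `h` at time `0` and both expectations converge
(`ae_tendsto_pathExpect`). If `s < h(0)`, then the integrand of `χ` is
`e^{s(η-ξ)} - (e^{-sξ} - E⁺) (e^{sη} - E⁻)`. The hypograph of `h^n` contains points above `s` with first
coordinates tending to `0`; when they are nonnegative the first factor tends to `0`, and when they are
negative the second does (`tendsto_chiIntegrand_of_lt`).

Domination in `s` rests on the Gaussian exponential moments of the maximum of the motion on `[0, L]`,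
from Lévy's inequality, and also yields the bound `norm_integral_chiIntegrand_le` for `χ`, uniform in
`h` and of Gaussian growth on the contours of level `1`.

On these contours `f̂₁` decays like the exponential of a cubic function, because `τ₁ > 0`; this
compensates for any Gaussian growth. The other `f̂_i` have at least Gaussian decay, as
`τ_i > τ_{i-1}`, or `τ_i = τ_{i-1}` and `α_i > α_{i-1}`. With Hadamard's inequality the Fredholm series
has a majorant that depends neither on `n` nor on `z` (`FredholmDominated`,
`ContourBounds.fredholmDominated`), and dominated convergence carries the limit through the product
kernel, the Fredholm series and the integrals over the circles (`tendsto_multipointFormula`).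
-/

/-! ### Hitting times of a fixed path -/

lemma isClosed_hypograph {h : ℝ → EReal} (hu : UpperSemicontinuous h) :
    IsClosed (hypograph h) := by
  have h1 : IsClosed {p : ℝ × EReal | p.2 ≤ h p.1} := UpperSemicontinuous.IsClosed_hypograph hu
  exact h1.preimage (f := fun p : ℝ × ℝ => (p.1, (p.2 : EReal)))
    (continuous_fst.prodMk (continuous_coe_real_ereal.comp continuous_snd))

lemma isClosed_hitSetPos {h : ℝ → EReal} (hu : UpperSemicontinuous h) {b : ℝ → ℝ}
    (hb : Continuous b) : IsClosed (hitSetPos h b) := by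
  have : hitSetPos h b = Set.Ici 0 ∩ (fun a => (a, b a)) ⁻¹' hypograph h := rfl
  rw [this]
  exact isClosed_Ici.inter ((isClosed_hypograph hu).preimage (by fun_prop))

lemma bddBelow_hitSetPos (h : ℝ → EReal) (b : ℝ → ℝ) : BddBelow (hitSetPos h b) :=
  ⟨0, fun _ ha => ha.1⟩

lemma sInf_mem_hitSetPos {h : ℝ → EReal} (hu : UpperSemicontinuous h) {b : ℝ → ℝ}
    (hb : Continuous b) (hne : (hitSetPos h b).Nonempty) :
    sInf (hitSetPos h b) ∈ hitSetPos h b :=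
  (isClosed_hitSetPos hu hb).csInf_mem hne (bddBelow_hitSetPos h b)

lemma mem_Icc_of_ucSupport_subset {h : ℝ → EReal} {L : ℝ} (hS : ucSupport h ⊆ Set.Icc (-L) L)
    {x : ℝ} (hx : h x ≠ ⊥) : x ∈ Set.Icc (-L) L :=
  hS (subset_closure hx)

lemma le_of_mem_hitSetPos {h : ℝ → EReal} {L : ℝ} (hS : ucSupport h ⊆ Set.Icc (-L) L)
    {b : ℝ → ℝ} {a : ℝ} (ha : a ∈ hitSetPos h b) : a ≤ L := by
  refine (mem_Icc_of_ucSupport_subset hS (x := a) ?_).2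
  intro h0
  have := ha.2
  rw [h0] at this
  exact absurd this (by simp)

lemma TendstoUC.eventually_near {hs : ℕ → ℝ → EReal} {h : ℝ → EReal} (hc : TendstoUC hs h)
    {x y : ℝ} (hxy : (y : EReal) ≤ h x) {δ : ℝ} (hδ : 0 < δ) :
    ∀ᶠ n in atTop, ∃ x' y' : ℝ, |x' - x| < δ ∧ |y' - y| < δ ∧ (y' : EReal) ≤ hs n x' := by
  have hR : (0 : ℝ) < ‖((x, y) : ℝ × ℝ)‖ + 1 := by positivity
  filter_upwards [hc _ hR δ hδ] with n hn
  have hmem : ((x, y) : ℝ × ℝ) ∈ hypograph h ∩ Metric.closedBall 0 (‖((x, y) : ℝ × ℝ)‖ + 1) :=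
    ⟨hxy, by simp [Metric.mem_closedBall, dist_zero_right]⟩
  obtain ⟨p, hp, hd⟩ := Metric.mem_thickening_iff.1 (hn.2 hmem)
  rw [Prod.dist_eq, max_lt_iff, Real.dist_eq, Real.dist_eq] at hd
  exact ⟨p.1, p.2, by rw [abs_sub_comm]; exact hd.1, by rw [abs_sub_comm]; exact hd.2, hp⟩

/-- Limits of points of the hypographs of `hs n` lie in the hypograph of the limit. -/
lemma TendstoUC.le_of_tendsto {hs : ℕ → ℝ → EReal} {h : ℝ → EReal} (hc : TendstoUC hs h)
    (hu : UpperSemicontinuous h) {ι : Type*} {l : Filter ι} [l.NeBot] {φ : ι → ℕ}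
    (hφ : Tendsto φ l atTop) {x y : ι → ℝ} {x₀ y₀ : ℝ} (hx : Tendsto x l (𝓝 x₀))
    (hy : Tendsto y l (𝓝 y₀)) (hxy : ∀ᶠ i in l, (y i : EReal) ≤ hs (φ i) (x i)) :
    (y₀ : EReal) ≤ h x₀ := by
  change ((x₀, y₀) : ℝ × ℝ) ∈ hypograph h
  rw [← (isClosed_hypograph hu).closure_eq, Metric.mem_closure_iff]
  intro ε hε
  have hp : Tendsto (fun i => (x i, y i)) l (𝓝 (x₀, y₀)) := hx.prodMk_nhds hy
  have hR : (0 : ℝ) < ‖((x₀, y₀) : ℝ × ℝ)‖ + 1 := by positivity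
  have e1 := hφ.eventually (hc _ hR (ε / 2) (by positivity))
  have e2 := hp.norm.eventually_le_const (lt_add_one ‖((x₀, y₀) : ℝ × ℝ)‖)
  have e3 := hp.eventually (Metric.ball_mem_nhds _ (half_pos hε))
  obtain ⟨i, h1, h2, h3, h4⟩ := (e1.and (e2.and (e3.and hxy))).exists
  obtain ⟨q, hq, hd⟩ := Metric.mem_thickening_iff.1
    (h1.1 (show (x i, y i) ∈ _ from ⟨h4, by simpa [Metric.mem_closedBall] using h2⟩))
  refine ⟨q, hq, ?_⟩
  have h3' : dist (x i, y i) (x₀, y₀) < ε / 2 := h3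
  rw [dist_comm] at h3'
  linarith [dist_triangle ((x₀, y₀) : ℝ × ℝ) (x i, y i) q]

/-- If the limit is never hit, then the approximations are eventually not hit. -/
lemma eventually_hitSetPos_empty {hs : ℕ → ℝ → EReal} {h : ℝ → EReal} (hc : TendstoUC hs h)
    (hu : UpperSemicontinuous h) {L : ℝ} (hsS : ∀ n, ucSupport (hs n) ⊆ Set.Icc (-L) L)
    {b : ℝ → ℝ} (hb : Continuous b) (hne : ¬ (hitSetPos h b).Nonempty) :
    ∀ᶠ n in atTop, ¬ (hitSetPos (hs n) b).Nonempty := by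
  by_contra hcon
  have hfr : ∃ᶠ n in atTop, (hitSetPos (hs n) b).Nonempty := by
    simpa [Filter.Frequently] using hcon
  obtain ⟨φ, hφ, hφ'⟩ := extraction_of_frequently_atTop hfr
  choose a ha using hφ'
  obtain ⟨a₀, ha₀, ψ, hψ, hlim⟩ := (isCompact_Icc (a := (0 : ℝ)) (b := L)).tendsto_subseq
    (fun n => ⟨(ha n).1, le_of_mem_hitSetPos (hsS _) (ha n)⟩)
  refine hne ⟨a₀, ha₀.1, ?_⟩
  exact hc.le_of_tendsto hu (l := atTop) (φ := fun n => φ (ψ n))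
    (hφ.tendsto_atTop.comp hψ.tendsto_atTop) hlim
    ((hb.tendsto a₀).comp hlim) (Eventually.of_forall fun n => (ha _).2)

/-- Lower semicontinuity of the hitting time. -/
lemma eventually_lt_sInf_hitSetPos {hs : ℕ → ℝ → EReal} {h : ℝ → EReal} (hc : TendstoUC hs h)
    (hu : UpperSemicontinuous h) {L : ℝ} (hsS : ∀ n, ucSupport (hs n) ⊆ Set.Icc (-L) L)
    {b : ℝ → ℝ} (hb : Continuous b) {c : ℝ} (hcT : c < sInf (hitSetPos h b)) :
    ∀ᶠ n in atTop, ∀ a ∈ hitSetPos (hs n) b, c < a := by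
  by_contra hcon
  have hfr : ∃ᶠ n in atTop, ∃ a ∈ hitSetPos (hs n) b, a ≤ c := by
    simpa [Filter.Frequently] using hcon
  obtain ⟨φ, hφ, hφ'⟩ := extraction_of_frequently_atTop hfr
  choose a ha hac using hφ'
  obtain ⟨a₀, ha₀, ψ, hψ, hlim⟩ := (isCompact_Icc (a := (0 : ℝ)) (b := L)).tendsto_subseq
    (fun n => ⟨(ha n).1, le_of_mem_hitSetPos (hsS _) (ha n)⟩)
  have hmem : a₀ ∈ hitSetPos h b := ⟨ha₀.1, hc.le_of_tendsto hu (l := atTop)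
    (φ := fun n => φ (ψ n)) (hφ.tendsto_atTop.comp hψ.tendsto_atTop) hlim
    ((hb.tendsto a₀).comp hlim) (Eventually.of_forall fun n => (ha _).2)⟩
  have h1 : a₀ ≤ c := le_of_tendsto hlim (Eventually.of_forall fun n => hac _)
  linarith [csInf_le (bddBelow_hitSetPos h b) hmem]

/-- The weight of the approximations converges along any filter along which they are hit not much
later than the limit. -/
lemma tendsto_hitPosWeight {hs : ℕ → ℝ → EReal} {h : ℝ → EReal} (hc : TendstoUC hs h)
    (hu : UpperSemicontinuous h) {L : ℝ}
    (hsS : ∀ n, ucSupport (hs n) ⊆ Set.Icc (-L) L)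
    {b : ℝ → ℝ} (hb : Continuous b) {l : Filter ℕ} (hl : l ≤ atTop)
    (hlate : (hitSetPos h b).Nonempty → ∀ ε > 0, ∀ᶠ n in l,
      ∃ a ∈ hitSetPos (hs n) b, a < sInf (hitSetPos h b) + ε) (ξ : ℂ) :
    Tendsto (fun n => hitPosWeight (hs n) ξ b) l (𝓝 (hitPosWeight h ξ b)) := by
  by_cases hne : (hitSetPos h b).Nonempty
  · set T := sInf (hitSetPos h b) with hT
    have hTn : Tendsto (fun n => sInf (hitSetPos (hs n) b)) l (𝓝 T) := by
      rw [Metric.tendsto_nhds]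
      intro ε hε
      have e1 := hl (eventually_lt_sInf_hitSetPos hc hu hsS hb (show T - ε / 2 < T by linarith))
      filter_upwards [e1, hlate hne ε hε] with n h1 h2
      obtain ⟨a, ha, ha'⟩ := h2
      have h3 : sInf (hitSetPos (hs n) b) ≤ a := csInf_le (bddBelow_hitSetPos _ _) ha
      have h4 : T - ε / 2 ≤ sInf (hitSetPos (hs n) b) :=
        le_csInf ⟨a, ha⟩ fun a' h' => (h1 a' h').le
      rw [Real.dist_eq, abs_lt]
      constructor <;> linarith
    have hlim : Tendsto (fun n => Complex.exp (-((sInf (hitSetPos (hs n) b) : ℝ) : ℂ) * ξ ^ 2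
        - (b (sInf (hitSetPos (hs n) b)) : ℂ) * ξ)) l
        (𝓝 (Complex.exp (-(T : ℂ) * ξ ^ 2 - (b T : ℂ) * ξ))) := by
      have hcont : Continuous fun a : ℝ => Complex.exp (-(a : ℂ) * ξ ^ 2 - (b a : ℂ) * ξ) := by
        fun_prop
      exact (hcont.tendsto T).comp hTn
    rw [hitPosWeight, if_pos hne]
    refine hlim.congr' ?_
    filter_upwards [hlate hne 1 one_pos] with n hn
    obtain ⟨a, ha, -⟩ := hn
    rw [hitPosWeight, if_pos ⟨a, ha⟩]
  · rw [hitPosWeight, if_neg hne]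
    refine tendsto_const_nhds.congr' ?_
    filter_upwards [hl (eventually_hitSetPos_empty hc hu hsS hb hne)] with n hn
    rw [hitPosWeight, if_neg hn]

/-- A point strictly below the hypograph at a positive time is followed by the approximations. -/
lemma eventually_hit_of_lt {hs : ℕ → ℝ → EReal} {h : ℝ → EReal} (hc : TendstoUC hs h)
    {b : ℝ → ℝ} (hb : Continuous b) {a : ℝ} (ha : 0 < a) (hlt : (b a : EReal) < h a)
    {ε : ℝ} (hε : 0 < ε) :
    ∀ᶠ n in atTop, ∃ a' ∈ hitSetPos (hs n) b, a' < a + ε := by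
  obtain ⟨y, hy1, hy2⟩ := EReal.lt_iff_exists_real_btwn.1 hlt
  have hy1' : b a < y := EReal.coe_lt_coe_iff.1 hy1
  set d := (y - b a) / 2 with hd
  have hd0 : 0 < d := by rw [hd]; linarith
  obtain ⟨δ, hδ, hδ'⟩ := Metric.continuousAt_iff.1 hb.continuousAt d hd0
  have hpos : 0 < min (min δ ε) (min a d) := by positivity
  filter_upwards [hc.eventually_near hy2.le hpos] with n hn
  obtain ⟨x', y', h1, h2, h3⟩ := hn
  simp only [lt_min_iff] at h1 h2
  have h4 := abs_lt.1 h1.2.1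
  have h5 := abs_lt.1 h1.1.2
  have h6 := abs_lt.1 h2.2.2
  have h7 : |b x' - b a| < d := hδ' (by rw [Real.dist_eq]; exact h1.1.1)
  have h8 := abs_lt.1 h7
  refine ⟨x', ⟨by linarith, le_trans (EReal.coe_le_coe_iff.2 ?_) h3⟩, by linarith⟩
  linarith

/-- The weight is bounded in terms of the maximum `M` of the path (started from `0`) on `[0, L]`. The
last exponential is a Chernoff bound for the event that the path comes down to the level `β`. -/
lemma norm_hitPosWeight_le {h : ℝ → EReal} (hu : UpperSemicontinuous h) {L β : ℝ}
    (hS : ucSupport h ⊆ Set.Icc (-L) L) (hB : ∀ x, h x ≤ (β : EReal)) {ξ : ℂ} (hξ : ξ.re < 0)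
    {b : ℝ → ℝ} (hb : Continuous b) {s M : ℝ} (hM : ∀ a ∈ Set.Icc 0 L, |b a| ≤ M) {r : ℝ}
    (hr : 0 ≤ r) :
    ‖hitPosWeight h ξ (fun a => s + b a)‖ ≤
      Real.exp (L * ‖ξ‖ ^ 2 - ξ.re * (s + M) + r * (β + M - s)) := by
  have hb' : Continuous fun a => s + b a := by fun_prop
  rw [hitPosWeight]
  split_ifs with hne
  · set T := sInf (hitSetPos h fun a => s + b a) with hT
    have hmem := sInf_mem_hitSetPos hu hb' hne
    rw [← hT] at hmem
    have hTL : T ≤ L := le_of_mem_hitSetPos hS hmem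
    have hT0 : 0 ≤ T := hmem.1
    have h1 := abs_le.1 (hM T ⟨hT0, hTL⟩)
    have h2 : s + b T ≤ β := EReal.coe_le_coe_iff.1 (hmem.2.trans (hB T))
    rw [Complex.norm_exp, Real.exp_le_exp]
    have h3 : (-(T : ℂ) * ξ ^ 2 - ((s + b T : ℝ) : ℂ) * ξ).re
        = T * (-(ξ ^ 2).re) - (s + b T) * ξ.re := by
      simp only [Complex.sub_re, neg_mul, Complex.neg_re, Complex.re_ofReal_mul]
      ring
    rw [h3]
    have h4 : -(ξ ^ 2).re ≤ ‖ξ‖ ^ 2 := by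
      rw [← norm_pow]
      exact (neg_le_abs _).trans (Complex.abs_re_le_norm _)
    have h5 : T * (-(ξ ^ 2).re) ≤ L * ‖ξ‖ ^ 2 :=
      (mul_le_mul_of_nonneg_left h4 hT0).trans
        (mul_le_mul_of_nonneg_right hTL (by positivity))
    have h6 : 0 ≤ r * (β + M - s) := mul_nonneg hr (by linarith)
    nlinarith
  · rw [norm_zero]; positivity

lemma hitPosWeight_congr {h : ℝ → EReal} {ξ : ℂ} {b b' : ℝ → ℝ} (hu : UpperSemicontinuous h)
    (hb : Continuous b) (hbb : ∀ a, 0 ≤ a → b a = b' a) :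
    hitPosWeight h ξ b = hitPosWeight h ξ b' := by
  have h1 : hitSetPos h b = hitSetPos h b' := by
    ext a
    constructor
    · rintro ⟨h0, h1⟩; exact ⟨h0, by rwa [← hbb a h0]⟩
    · rintro ⟨h0, h1⟩; exact ⟨h0, by rwa [hbb a h0]⟩
  by_cases hne : (hitSetPos h b).Nonempty
  · have hmem := sInf_mem_hitSetPos hu hb hne
    rw [hitPosWeight, hitPosWeight, ← h1, if_pos hne, if_pos hne, hbb _ hmem.1]
  · rw [hitPosWeight, hitPosWeight, ← h1, if_neg hne, if_neg hne]

/-- Time reversal turns hitting times to the left of `0` into hitting times to the right. -/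
lemma hitNegWeight_eq (h : ℝ → EReal) (η : ℂ) (b : ℝ → ℝ) :
    hitNegWeight h η b = hitPosWeight (fun x => h (-x)) (-η) (fun a => b (-a)) := by
  have h1 : hitSetPos (fun x => h (-x)) (fun a => b (-a)) = -hitSetNeg h b := by
    ext a
    simp [hitSetPos, hitSetNeg]
  have h2 : (hitSetPos (fun x => h (-x)) (fun a => b (-a))).Nonempty ↔
      (hitSetNeg h b).Nonempty := by rw [h1, Set.nonempty_neg]
  rw [hitNegWeight, hitPosWeight]
  by_cases hne : (hitSetNeg h b).Nonempty
  · rw [if_pos hne, if_pos (h2.2 hne), h1, Real.sInf_def, neg_neg]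
    simp only [neg_neg]
    congr 1
    push_cast
    ring
  · rw [if_neg hne, if_neg (mt h2.1 hne)]

/-! ### Hitting times as functions of the starting point and of the path -/

/-- The space of paths carries the Borel `σ`-algebra of the compact-open topology. -/
instance instMeasurableSpacePath : MeasurableSpace C(ℝ, ℝ) := borel _

instance instBorelSpacePath : BorelSpace C(ℝ, ℝ) := ⟨rfl⟩

/-- The hitting time `inf {a ≥ 0 | b(a) ≤ h(a)}`, equal to `⊤` if there is no such time. -/
noncomputable def hitTime (h : ℝ → EReal) (b : ℝ → ℝ) : EReal := ⨅ a ∈ hitSetPos h b, (a : EReal)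

lemma hitTime_of_nonempty {h : ℝ → EReal} (hu : UpperSemicontinuous h) {b : ℝ → ℝ}
    (hb : Continuous b) (hne : (hitSetPos h b).Nonempty) :
    hitTime h b = (sInf (hitSetPos h b) : ℝ) :=
  le_antisymm (iInf₂_le _ (sInf_mem_hitSetPos hu hb hne))
    (le_iInf₂ fun _ ha => EReal.coe_le_coe_iff.2 (csInf_le (bddBelow_hitSetPos h b) ha))

lemma hitTime_of_not_nonempty {h : ℝ → EReal} {b : ℝ → ℝ} (hne : ¬ (hitSetPos h b).Nonempty) :
    hitTime h b = ⊤ := by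
  rw [Set.not_nonempty_iff_eq_empty] at hne
  simp [hitTime, hne]

lemma hitTime_lt_top_iff {h : ℝ → EReal} {b : ℝ → ℝ} :
    hitTime h b < ⊤ ↔ (hitSetPos h b).Nonempty := by
  constructor
  · intro hlt
    by_contra hne
    rw [hitTime_of_not_nonempty hne] at hlt
    exact lt_irrefl _ hlt
  · rintro ⟨a, ha⟩
    exact (iInf₂_le a ha).trans_lt (EReal.coe_lt_top a)

lemma hitTime_le_coe_iff {h : ℝ → EReal} (hu : UpperSemicontinuous h) {b : ℝ → ℝ}
    (hb : Continuous b) (c : ℝ) :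
    hitTime h b ≤ c ↔ ∃ a ∈ Set.Icc 0 c, (b a : EReal) ≤ h a := by
  constructor
  · intro hle
    have hne := hitTime_lt_top_iff.1 (hle.trans_lt (EReal.coe_lt_top c))
    rw [hitTime_of_nonempty hu hb hne, EReal.coe_le_coe_iff] at hle
    have hm := sInf_mem_hitSetPos hu hb hne
    exact ⟨_, ⟨hm.1, hle⟩, hm.2⟩
  · rintro ⟨a, ha, hle⟩
    exact (iInf₂_le a ⟨ha.1, hle⟩).trans (EReal.coe_le_coe_iff.2 ha.2)

/-- The set where the hitting time is at most `c` is closed, as the projection of a closed set along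
the compact interval `[0, c]`. -/
lemma measurable_hitTime {h : ℝ → EReal} (hu : UpperSemicontinuous h) :
    Measurable fun p : ℝ × C(ℝ, ℝ) => hitTime h (fun a => p.1 + p.2 a) := by
  have hreal : ∀ c : ℝ, MeasurableSet {p : ℝ × C(ℝ, ℝ) | hitTime h (fun a => p.1 + p.2 a) ≤ c} := by
    intro c
    have hcl : IsClosed {q : (ℝ × C(ℝ, ℝ)) × Set.Icc (0 : ℝ) c |
        ((q.1.1 + q.1.2 q.2 : ℝ) : EReal) ≤ h q.2} :=
      (isClosed_hypograph hu).preimage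
        (f := fun q : (ℝ × C(ℝ, ℝ)) × Set.Icc (0 : ℝ) c => ((q.2 : ℝ), q.1.1 + q.1.2 q.2))
        (by fun_prop)
    have himg := isClosedMap_fst_of_compactSpace _ hcl
    convert himg.measurableSet using 1
    ext p
    simp only [Set.mem_ofPred_eq, Set.mem_image, Prod.exists, exists_and_right, exists_eq_right]
    rw [hitTime_le_coe_iff hu (by fun_prop)]
    constructor
    · rintro ⟨a, ha, hle⟩
      exact ⟨⟨a, ha⟩, hle⟩
    · rintro ⟨⟨a, ha⟩, hle⟩
      exact ⟨a, ha, hle⟩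
  refine measurable_of_Iic fun c => ?_
  induction c using EReal.rec with
  | bot =>
    convert MeasurableSet.empty using 1
    refine Set.eq_empty_of_forall_notMem fun p hp => ?_
    have h0 : (0 : EReal) ≤ hitTime h (fun a => p.1 + p.2 a) :=
      le_iInf₂ fun a ha => EReal.coe_nonneg.2 ha.1
    have : hitTime h (fun a => p.1 + p.2 a) ≤ ⊥ := hp
    exact absurd (h0.trans this) (by simp)
  | coe c => exact hreal c
  | top => simp

lemma measurable_hitPosWeight {h : ℝ → EReal} (hu : UpperSemicontinuous h) :
    Measurable fun p : (ℂ × ℝ) × C(ℝ, ℝ) =>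
      hitPosWeight h p.1.1 (fun a => p.1.2 + p.2 a) := by
  have hT : Measurable fun p : (ℂ × ℝ) × C(ℝ, ℝ) => hitTime h (fun a => p.1.2 + p.2 a) :=
    (measurable_hitTime hu).comp (f := fun p : (ℂ × ℝ) × C(ℝ, ℝ) => (p.1.2, p.2)) (by fun_prop)
  have hT' := hT.ereal_toReal
  have heval : Measurable fun p : C(ℝ, ℝ) × ℝ => p.1 p.2 :=
    (continuous_eval (F := C(ℝ, ℝ))).measurable
  have hb : Measurable fun p : (ℂ × ℝ) × C(ℝ, ℝ) =>
      p.2 ((hitTime h (fun a => p.1.2 + p.2 a)).toReal) :=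
    heval.comp (measurable_snd.prodMk hT')
  have hmain : Measurable fun p : (ℂ × ℝ) × C(ℝ, ℝ) =>
      if hitTime h (fun a => p.1.2 + p.2 a) < ⊤ then
        Complex.exp (-(((hitTime h (fun a => p.1.2 + p.2 a)).toReal : ℝ) : ℂ) * p.1.1 ^ 2
          - ((p.1.2 + p.2 ((hitTime h (fun a => p.1.2 + p.2 a)).toReal) : ℝ) : ℂ) * p.1.1)
      else 0 := by
    refine Measurable.ite (measurableSet_lt hT measurable_const) ?_ measurable_const
    fun_prop
  convert hmain using 2 with p
  have hc : Continuous fun a => p.1.2 + p.2 a := by fun_prop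
  rw [hitPosWeight]
  by_cases hne : (hitSetPos h fun a => p.1.2 + p.2 a).Nonempty
  · rw [if_pos hne, if_pos (hitTime_lt_top_iff.2 hne), hitTime_of_nonempty hu hc hne]
    simp
  · rw [if_neg hne, if_neg (mt hitTime_lt_top_iff.1 hne)]

lemma hitTime_mono_start (h : ℝ → EReal) (b : ℝ → ℝ) :
    Monotone fun s : ℝ => hitTime h (fun a => s + b a) := by
  intro s s' hss
  refine le_iInf₂ fun a ha => iInf₂_le a ⟨ha.1, le_trans ?_ ha.2⟩
  exact EReal.coe_le_coe_iff.2 (by linarith)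

/-- Since the hitting time is monotone in the starting point, it has only countably many jumps: for
almost every starting point, almost every path has a hitting time which is right continuous in the
starting point. -/
lemma ae_hitTime_eq_iInf {h : ℝ → EReal} (hu : UpperSemicontinuous h) (μ : Measure C(ℝ, ℝ))
    [SFinite μ] :
    ∀ᵐ s : ℝ, ∀ᵐ b ∂μ, hitTime h (fun a => s + b a) =
      ⨅ k : ℕ, hitTime h (fun a => (s + 1 / ((k : ℝ) + 1)) + b a) := by
  have hmeas : MeasurableSet {p : C(ℝ, ℝ) × ℝ | hitTime h (fun a => p.2 + p.1 a) =
      ⨅ k : ℕ, hitTime h (fun a => (p.2 + 1 / ((k : ℝ) + 1)) + p.1 a)} := by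
    refine measurableSet_eq_fun ?_ (Measurable.iInf fun k => ?_)
    · exact (measurable_hitTime hu).comp (f := fun p : C(ℝ, ℝ) × ℝ => (p.2, p.1)) (by fun_prop)
    · exact (measurable_hitTime hu).comp
        (f := fun p : C(ℝ, ℝ) × ℝ => (p.2 + 1 / ((k : ℝ) + 1), p.1)) (by fun_prop)
  rw [Measure.ae_ae_comm]
  · refine Eventually.of_forall fun b => ?_
    have hcount := (hitTime_mono_start h b).countable_not_continuousAt
    filter_upwards [hcount.ae_notMem volume] with s hs
    have hcont : ContinuousAt (fun s : ℝ => hitTime h (fun a => s + b a)) s := by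
      simpa using hs
    have hlim : Tendsto (fun k : ℕ => s + 1 / ((k : ℝ) + 1)) atTop (𝓝 s) := by
      simpa using tendsto_const_nhds.add (tendsto_one_div_add_atTop_nhds_zero_nat (𝕜 := ℝ))
    refine tendsto_nhds_unique (hcont.tendsto.comp hlim) ?_
    refine tendsto_atTop_iInf fun k k' hkk => hitTime_mono_start h b ?_
    have : (1 : ℝ) / ((k' : ℝ) + 1) ≤ 1 / ((k : ℝ) + 1) := by
      have : (k : ℝ) ≤ k' := by exact_mod_cast hkk
      gcongr
    linarith
  · exact measurable_swap hmeas

/-- If the hitting time is right continuous in the starting point, then right after the hitting time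
the path is strictly below the function. -/
lemma exists_lt_of_hitTime_eq_iInf {h : ℝ → EReal} (hu : UpperSemicontinuous h) {b : ℝ → ℝ}
    (hb : Continuous b) {s : ℝ}
    (heq : hitTime h (fun a => s + b a) =
      ⨅ k : ℕ, hitTime h (fun a => (s + 1 / ((k : ℝ) + 1)) + b a))
    (hne : (hitSetPos h fun a => s + b a).Nonempty) {ε : ℝ} (hε : 0 < ε) :
    ∃ a, 0 ≤ a ∧ ((s + b a : ℝ) : EReal) < h a ∧ a < sInf (hitSetPos h fun a => s + b a) + ε := by
  rw [hitTime_of_nonempty hu (by fun_prop) hne] at heq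
  have hlt : (⨅ k : ℕ, hitTime h (fun a => (s + 1 / ((k : ℝ) + 1)) + b a)) <
      ((sInf (hitSetPos h fun a => s + b a) + ε : ℝ) : EReal) := by
    rw [← heq, EReal.coe_lt_coe_iff]
    linarith
  obtain ⟨k, hk⟩ := iInf_lt_iff.1 hlt
  have hne' := hitTime_lt_top_iff.1 (hk.trans (EReal.coe_lt_top _))
  rw [hitTime_of_nonempty hu (by fun_prop) hne', EReal.coe_lt_coe_iff] at hk
  have hm := sInf_mem_hitSetPos hu (b := fun a => (s + 1 / ((k : ℝ) + 1)) + b a)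
    (by fun_prop) hne'
  refine ⟨_, hm.1, lt_of_lt_of_le (EReal.coe_lt_coe_iff.2 ?_) hm.2, hk⟩
  have : (0 : ℝ) < 1 / ((k : ℝ) + 1) := by positivity
  linarith

/-! ### Maximal inequality for Brownian motion -/

lemma one_le_two_mul_gaussianReal_Ici (v : ℝ≥0) : 1 ≤ 2 * gaussianReal 0 v (Set.Ici 0) := by
  have h1 : gaussianReal 0 v (Set.Iic 0) = gaussianReal 0 v (Set.Ici 0) := by
    have h2 : (gaussianReal 0 v).map (fun x => -x) = gaussianReal 0 v := by
      rw [gaussianReal_map_neg, neg_zero]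
    conv_lhs => rw [← h2]
    rw [Measure.map_apply measurable_neg measurableSet_Iic]
    congr 1
    ext x
    simp
  calc (1 : ENNReal) = gaussianReal 0 v (Set.Iic 0 ∪ Set.Ici 0) := by
        rw [Set.Iic_union_Ici, measure_univ]
    _ ≤ gaussianReal 0 v (Set.Iic 0) + gaussianReal 0 v (Set.Ici 0) := measure_union_le _ _
    _ = 2 * gaussianReal 0 v (Set.Ici 0) := by rw [h1, two_mul]

/-- Lévy's inequality: after the first passage above `x`, the motion is above `x` at the final time
with conditional probability at least one half. -/
lemma IsPreBrownianReal.measure_exists_lt_le {Ω : Type*} [MeasurableSpace Ω] {P : Measure Ω}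
    {X : ℝ≥0 → Ω → ℝ} (hX : IsPreBrownianReal X P) (hm : ∀ t, Measurable (X t)) {T : ℝ≥0}
    (I : Finset ℝ≥0) (hI : ∀ t ∈ I, t ≤ T) (x : ℝ) :
    P {ω | ∃ t ∈ I, x < X t ω} ≤ 2 * P {ω | x < X T ω} := by
  set A : ℝ≥0 → Set Ω := fun t => {ω | x < X t ω ∧ ∀ u ∈ I, u < t → X u ω ≤ x} with hA
  have hAm : ∀ t, MeasurableSet (A t) := by
    intro t
    have : A t = {ω | x < X t ω} ∩ ⋂ u ∈ I, ⋂ (_ : u < t), {ω | X u ω ≤ x} := by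
      ext ω; simp [hA]
    rw [this]
    refine (measurableSet_lt measurable_const (hm t)).inter ?_
    exact I.measurableSet_biInter fun u _ =>
      MeasurableSet.iInter fun _ => measurableSet_le (hm u) measurable_const
  have hcover : {ω | ∃ t ∈ I, x < X t ω} ⊆ ⋃ t ∈ I, A t := by
    rintro ω ⟨t, ht, hlt⟩
    have hne : (I.filter fun t => x < X t ω).Nonempty := ⟨t, by simp [ht, hlt]⟩
    obtain ⟨t₀, ht₀, hmin⟩ := Finset.exists_min_image _ id hne
    rw [Finset.mem_filter] at ht₀
    refine Set.mem_biUnion ht₀.1 ⟨ht₀.2, fun u hu hut => ?_⟩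
    by_contra hcon
    exact absurd (hmin u (Finset.mem_filter.2 ⟨hu, not_le.1 hcon⟩)) (not_le.2 hut)
  have hdisj : ∀ t ∈ I, ∀ t' ∈ I, t ≠ t' → Disjoint (A t) (A t') := by
    intro t ht t' ht' hne
    rw [Set.disjoint_left]
    rintro ω ⟨h1, h2⟩ ⟨h3, h4⟩
    rcases lt_or_gt_of_ne hne with hlt | hlt
    · exact absurd (h4 t ht hlt) (not_le.2 h1)
    · exact absurd (h2 t' ht' hlt) (not_le.2 h3)
  have hstep : ∀ t ∈ I, P (A t) ≤ 2 * P (A t ∩ {ω | x < X T ω}) := by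
    intro t ht
    have hind := hX.indepFun_shift t
    set S₁ : Set (ℝ≥0 → ℝ) := {g | 0 ≤ g (T - t)} with hS₁
    set S₂ : Set (Set.Iic t → ℝ) :=
      {f | x < f ⟨t, le_refl t⟩ ∧ ∀ u ∈ I, ∀ hu : u < t, f ⟨u, hu.le⟩ ≤ x} with hS₂
    have hS₁m : MeasurableSet S₁ := measurableSet_le measurable_const (measurable_pi_apply _)
    have hS₂m : MeasurableSet S₂ := by
      have : S₂ = {f | x < f ⟨t, le_refl t⟩} ∩
          ⋂ u ∈ I, ⋂ (hu : u < t), {f | f ⟨u, hu.le⟩ ≤ x} := by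
        ext f; simp [hS₂]
      rw [this]
      refine (measurableSet_lt measurable_const (measurable_pi_apply _)).inter ?_
      exact I.measurableSet_biInter fun u _ =>
        MeasurableSet.iInter fun _ => measurableSet_le (measurable_pi_apply _) measurable_const
    have hprod := hind.measure_inter_preimage_eq_mul S₁ S₂ hS₁m hS₂m
    have hA' : (fun ω (u : Set.Iic t) => X u ω) ⁻¹' S₂ = A t := by
      ext ω; simp [hS₂, hA]
    have hlaw : P ((fun ω v => X (t + v) ω - X t ω) ⁻¹' S₁) = gaussianReal 0 (T - t) (Set.Ici 0) := by
      have hl := (hX.shift t).hasLaw_eval (T - t)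
      rw [← hl.map_eq, Measure.map_apply_of_aemeasurable hl.aemeasurable measurableSet_Ici]
      rfl
    rw [hA', hlaw] at hprod
    calc P (A t) = 1 * P (A t) := (one_mul _).symm
      _ ≤ 2 * gaussianReal 0 (T - t) (Set.Ici 0) * P (A t) := by
        gcongr; exact one_le_two_mul_gaussianReal_Ici _
      _ = 2 * P ((fun ω v => X (t + v) ω - X t ω) ⁻¹' S₁ ∩ A t) := by rw [hprod, mul_assoc]
      _ ≤ 2 * P (A t ∩ {ω | x < X T ω}) := by
        refine mul_le_mul_right (measure_mono ?_) 2
        rintro ω ⟨h1, h2⟩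
        refine ⟨h2, ?_⟩
        have h3 : 0 ≤ X (t + (T - t)) ω - X t ω := h1
        rw [add_tsub_cancel_of_le (hI t ht)] at h3
        have h4 : x < X t ω := h2.1
        change x < X T ω
        linarith
  calc P {ω | ∃ t ∈ I, x < X t ω} ≤ P (⋃ t ∈ I, A t) := measure_mono hcover
    _ ≤ ∑ t ∈ I, P (A t) := measure_biUnion_finset_le _ _
    _ ≤ ∑ t ∈ I, 2 * P (A t ∩ {ω | x < X T ω}) := Finset.sum_le_sum hstep
    _ = 2 * P (⋃ t ∈ I, A t ∩ {ω | x < X T ω}) := by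
      rw [← Finset.mul_sum, measure_biUnion_finset]
      · intro t ht t' ht' hne
        exact (hdisj t ht t' ht' hne).mono Set.inter_subset_left Set.inter_subset_left
      · exact fun t _ => (hAm t).inter (measurableSet_lt measurable_const (hm T))
    _ ≤ 2 * P {ω | x < X T ω} := by
      gcongr
      exact Set.iUnion₂_subset fun t _ => Set.inter_subset_right

lemma IsPreBrownianReal.measure_exists_lt_abs_le {Ω : Type*} [MeasurableSpace Ω] {P : Measure Ω}
    {X : ℝ≥0 → Ω → ℝ} (hX : IsPreBrownianReal X P) (hm : ∀ t, Measurable (X t)) {T : ℝ≥0}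
    (I : Finset ℝ≥0) (hI : ∀ t ∈ I, t ≤ T) (x : ℝ) :
    P {ω | ∃ t ∈ I, x < |X t ω|} ≤ 4 * P {ω | x < |X T ω|} := by
  have h1 := IsPreBrownianReal.measure_exists_lt_le hX hm I hI x
  have h2 := IsPreBrownianReal.measure_exists_lt_le hX.neg (fun t => (hm t).neg) I hI x
  calc P {ω | ∃ t ∈ I, x < |X t ω|}
      ≤ P ({ω | ∃ t ∈ I, x < X t ω} ∪ {ω | ∃ t ∈ I, x < (-X) t ω}) := by
        refine measure_mono ?_
        rintro ω ⟨t, ht, hlt⟩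
        rcases lt_abs.1 hlt with h | h
        · exact Or.inl ⟨t, ht, h⟩
        · exact Or.inr ⟨t, ht, h⟩
    _ ≤ _ := measure_union_le _ _
    _ ≤ 2 * P {ω | x < X T ω} + 2 * P {ω | x < (-X) T ω} := add_le_add h1 h2
    _ ≤ 2 * P {ω | x < |X T ω|} + 2 * P {ω | x < |X T ω|} := by
      gcongr with ω ω
      · exact le_abs_self _
      · exact neg_le_abs _
    _ = 4 * P {ω | x < |X T ω|} := by rw [← add_mul]; norm_num

/-- The maximum of the absolute value of a path on `[0, L]`. -/
noncomputable def pathSup (L : ℝ) (b : C(ℝ, ℝ)) : ℝ := ‖b.restrict (Set.Icc 0 L)‖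

lemma abs_le_pathSup {L : ℝ} (b : C(ℝ, ℝ)) {a : ℝ} (ha : a ∈ Set.Icc 0 L) : |b a| ≤ pathSup L b :=
  (b.restrict (Set.Icc 0 L)).norm_coe_le_norm ⟨a, ha⟩

lemma measurable_pathSup (L : ℝ) : Measurable (pathSup L) :=
  ((ContinuousMap.continuous_restrict (Y := ℝ) (Set.Icc (0 : ℝ) L)).norm).measurable

/-- Lévy's inequality on a whole time interval, by approximation with finitely many times. -/
lemma measure_lt_pathSup_le {Ω : Type*} [MeasurableSpace Ω] {P : Measure Ω}
    {Φ : Ω → C(ℝ, ℝ)} (hΦ : Measurable Φ)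
    (hX : IsPreBrownianReal (fun (t : ℝ≥0) ω => (√2)⁻¹ * Φ ω t) P) (T : ℝ≥0) {x : ℝ}
    (hx : 0 ≤ x) :
    P {ω | x < pathSup T (Φ ω)} ≤ 4 * P {ω | x < |Φ ω T|} := by
  have hev : ∀ t : ℝ, Measurable fun ω => Φ ω t := fun t =>
    (continuous_eval_const (F := C(ℝ, ℝ)) t).measurable.comp hΦ
  have hc : (0 : ℝ) < (√2)⁻¹ := by positivity
  have habs : ∀ y : ℝ, (√2)⁻¹ * x < |(√2)⁻¹ * y| ↔ x < |y| := by
    intro y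
    rw [abs_mul, abs_of_pos hc, mul_lt_mul_iff_right₀ hc]
  set I : ℕ → Finset ℝ≥0 := fun N =>
    (Finset.range N).image fun n => min (TopologicalSpace.denseSeq ℝ≥0 n) T with hI
  have hmono : Monotone fun N => {ω | ∃ t ∈ I N, x < |Φ ω t|} := by
    rintro N N' hN ω ⟨t, ht, hlt⟩
    exact ⟨t, Finset.image_subset_image (Finset.range_mono hN) ht, hlt⟩
  have hcover : {ω | x < pathSup T (Φ ω)} ⊆ ⋃ N, {ω | ∃ t ∈ I N, x < |Φ ω t|} := by
    intro ω hω
    have h1 : ∃ a ∈ Set.Icc (0 : ℝ) T, x < |Φ ω a| := by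
      by_contra! hcon
      refine absurd ?_ (not_le.2 (show x < pathSup T (Φ ω) from hω))
      rw [pathSup, ContinuousMap.norm_le _ hx]
      exact fun a => hcon a a.2
    obtain ⟨a, ha, hxa⟩ := h1
    have hopen : IsOpen {t : ℝ≥0 | x < |Φ ω (min t T : ℝ≥0)|} :=
      isOpen_lt continuous_const (by fun_prop)
    have hne : {t : ℝ≥0 | x < |Φ ω (min t T : ℝ≥0)|}.Nonempty := by
      lift a to ℝ≥0 using ha.1
      refine ⟨a, ?_⟩
      change x < |Φ ω (min a T : ℝ≥0)|
      rwa [min_eq_left (NNReal.coe_le_coe.1 ha.2)]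
    obtain ⟨n, hn⟩ := (TopologicalSpace.denseRange_denseSeq ℝ≥0).exists_mem_open hopen hne
    exact Set.mem_iUnion.2
      ⟨n + 1, _, Finset.mem_image_of_mem _ (Finset.self_mem_range_succ n), hn⟩
  refine (measure_mono hcover).trans ?_
  rw [hmono.measure_iUnion]
  refine iSup_le fun N => ?_
  have := IsPreBrownianReal.measure_exists_lt_abs_le hX (fun t => (hev t).const_mul _) (T := T) (I N)
    (by
      intro t ht
      obtain ⟨n, -, rfl⟩ := Finset.mem_image.1 ht
      exact min_le_right _ _) ((√2)⁻¹ * x)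
  simpa only [habs] using this

/-- Gaussian exponential moments of the maximum: by the layer cake formula and Lévy's inequality they
are at most four times those of the absolute value at the final time. -/
lemma integrable_exp_mul_pathSup {Ω : Type*} [MeasurableSpace Ω] {P : Measure Ω}
    [IsProbabilityMeasure P] {Φ : Ω → C(ℝ, ℝ)} (hΦ : Measurable Φ)
    (hX : IsPreBrownianReal (fun (t : ℝ≥0) ω => (√2)⁻¹ * Φ ω t) P) {L : ℝ} (hL : 0 ≤ L) {r : ℝ}
    (hr : 0 ≤ r) :
    Integrable (fun ω => Real.exp (r * pathSup L (Φ ω))) P ∧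
      ∫ ω, Real.exp (r * pathSup L (Φ ω)) ∂P ≤ 8 * Real.exp (r ^ 2 * L) := by
  lift L to ℝ≥0 using hL with T
  have hev : Measurable fun ω => Φ ω T :=
    (continuous_eval_const (F := C(ℝ, ℝ)) (T : ℝ)).measurable.comp hΦ
  have hsup : Measurable fun ω => pathSup T (Φ ω) := (measurable_pathSup _).comp hΦ
  have h2 : (0 : ℝ) < √2 := by positivity
  have h22 : √2 * √2 = 2 := Real.mul_self_sqrt (by norm_num)
  have hexp : ∀ c : ℝ, Integrable (fun ω => Real.exp (c * Φ ω T)) P ∧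
      ∫ ω, Real.exp (c * Φ ω T) ∂P = Real.exp (c ^ 2 * T) := by
    intro c
    have hlaw := hX.hasLaw_eval T
    have hfun : (fun ω => Real.exp (c * Φ ω T)) =
        fun ω => Real.exp ((c * √2) * ((√2)⁻¹ * Φ ω T)) := by
      ext ω
      congr 1
      field_simp
    have hmgf := mgf_gaussianReal hlaw.map_eq (c * √2)
    rw [hfun]
    constructor
    · have := (integrable_exp_mul_gaussianReal (μ := 0) (v := T) (c * √2))
      rw [← hlaw.map_eq] at this
      exact this.comp_aemeasurable hlaw.aemeasurable
    · rw [mgf] at hmgf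
      rw [hmgf]
      congr 1
      rw [mul_pow, Real.sq_sqrt (by norm_num)]
      ring
  have hlin : ∫⁻ ω, ENNReal.ofReal (Real.exp (r * pathSup T (Φ ω))) ∂P ≤
      4 * ∫⁻ ω, ENNReal.ofReal (Real.exp (r * |Φ ω T|)) ∂P := by
    rw [lintegral_eq_lintegral_meas_lt P (Eventually.of_forall fun _ => (Real.exp_pos _).le)
        (hsup.const_mul r).exp.aemeasurable,
      lintegral_eq_lintegral_meas_lt P (Eventually.of_forall fun _ => (Real.exp_pos _).le)
        (by fun_prop), ← lintegral_const_mul' _ _ (by norm_num)]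
    refine setLIntegral_mono' measurableSet_Ioi fun t ht => ?_
    have ht0 : 0 < t := ht
    rcases lt_or_ge t 1 with h1 | h1
    · have : {ω | t < Real.exp (r * |Φ ω T|)} = Set.univ := by
        ext ω
        simp only [Set.mem_ofPred_eq, Set.mem_univ, iff_true]
        exact h1.trans_le (Real.one_le_exp (by positivity))
      rw [this, measure_univ, mul_one]
      exact prob_le_one.trans (by norm_num)
    · rcases hr.eq_or_lt with h0 | h0
      · subst h0
        simp [not_lt.2 h1]
      · have key : ∀ y : ℝ, t < Real.exp (r * y) ↔ Real.log t / r < y := by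
          intro y
          rw [← Real.log_lt_iff_lt_exp ht0, div_lt_iff₀' h0]
        simp only [key]
        exact measure_lt_pathSup_le hΦ hX T (div_nonneg (Real.log_nonneg h1) hr)
  have hbd : ∫⁻ ω, ENNReal.ofReal (Real.exp (r * |Φ ω T|)) ∂P ≤
      ENNReal.ofReal (2 * Real.exp (r ^ 2 * T)) := by
    calc ∫⁻ ω, ENNReal.ofReal (Real.exp (r * |Φ ω T|)) ∂P
        ≤ ∫⁻ ω, ENNReal.ofReal (Real.exp (r * Φ ω T) + Real.exp (-r * Φ ω T)) ∂P := by
          refine lintegral_mono fun ω => ENNReal.ofReal_le_ofReal ?_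
          rcases abs_cases (Φ ω T) with ⟨h, -⟩ | ⟨h, -⟩ <;> rw [h]
          · linarith [Real.exp_pos (-r * Φ ω T)]
          · rw [mul_neg, ← neg_mul]
            linarith [Real.exp_pos (r * Φ ω T)]
      _ = ENNReal.ofReal (∫ ω, (Real.exp (r * Φ ω T) + Real.exp (-r * Φ ω T)) ∂P) := by
          refine (ofReal_integral_eq_lintegral_ofReal
            ((hexp r).1.add (hexp (-r)).1) (Eventually.of_forall fun ω => ?_)).symm
          exact add_nonneg (Real.exp_pos _).le (Real.exp_pos _).le
      _ = _ := by
          rw [integral_add (hexp r).1 (hexp (-r)).1, (hexp r).2, (hexp (-r)).2, neg_sq, two_mul]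
  have htot : ∫⁻ ω, ENNReal.ofReal (Real.exp (r * pathSup T (Φ ω))) ∂P ≤
      ENNReal.ofReal (8 * Real.exp (r ^ 2 * T)) := by
    refine hlin.trans ((mul_le_mul_right hbd 4).trans_eq ?_)
    rw [show (4 : ENNReal) = ENNReal.ofReal 4 by norm_num, ← ENNReal.ofReal_mul (by norm_num)]
    congr 1
    ring
  have hint : Integrable (fun ω => Real.exp (r * pathSup T (Φ ω))) P := by
    refine ⟨(hsup.const_mul r).exp.aestronglyMeasurable, ?_⟩
    rw [hasFiniteIntegral_iff_ofReal (Eventually.of_forall fun _ => (Real.exp_pos _).le)]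
    exact htot.trans_lt ENNReal.ofReal_lt_top
  refine ⟨hint, ?_⟩
  rw [integral_eq_lintegral_of_nonneg_ae (Eventually.of_forall fun _ => (Real.exp_pos _).le)
    hint.1]
  exact ENNReal.toReal_le_of_le_ofReal (by positivity) htot

/-! ### The law of Brownian motion on the space of paths -/

/-- The Borel `σ`-algebra on the space of paths is generated by the evaluations at rational times. -/
lemma measurableEmbedding_eval_rat :
    MeasurableEmbedding fun (b : C(ℝ, ℝ)) (q : ℚ) => b q := by
  refine Measurable.measurableEmbedding ?_ ?_
  · exact measurable_pi_lambda _ fun q => (continuous_eval_const (F := C(ℝ, ℝ)) (q : ℝ)).measurable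
  · intro b b' hbb
    refine ContinuousMap.coe_injective ?_
    exact Rat.denseRange_cast.equalizer b.continuous b'.continuous hbb

open Classical in
/-- A process which is a Brownian motion with diffusivity constant `2` on the positive half line agrees
there almost surely with a measurable map into the space of paths. -/
lemma exists_measurable_path {Ω : Type*} [MeasurableSpace Ω] {P : Measure Ω} {Y : ℝ → Ω → ℝ}
    (hY : IsBrownianReal (fun (t : ℝ≥0) ω => (√2)⁻¹ * Y t ω) P) :
    ∃ Φ : Ω → C(ℝ, ℝ), Measurable Φ ∧ ∀ᵐ ω ∂P, ∀ a, 0 ≤ a → Φ ω a = Y a ω := by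
  have h2 : (0 : ℝ) < √2 := by positivity
  have hcont : ∀ᵐ ω ∂P, Continuous fun t : ℝ≥0 => Y t ω := by
    filter_upwards [hY.cont] with ω hω
    have : (fun t : ℝ≥0 => Y t ω) = fun t : ℝ≥0 => √2 * ((√2)⁻¹ * Y t ω) := by
      ext t; field_simp
    rw [this]
    exact hω.const_mul _
  set Φ : Ω → C(ℝ, ℝ) := fun ω =>
    if hω : Continuous fun t : ℝ≥0 => Y t ω then
      ⟨fun a => Y (a.toNNReal : ℝ≥0) ω, hω.comp continuous_real_toNNReal⟩ else 0 with hΦ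
  have hΦY : ∀ᵐ ω ∂P, ∀ a : ℝ, Φ ω a = Y (a.toNNReal : ℝ≥0) ω := by
    filter_upwards [hcont] with ω hω a
    simp [hΦ, hω]
  have hYm : ∀ t : ℝ≥0, AEMeasurable (fun ω => Y t ω) P := by
    intro t
    have : (fun ω => Y t ω) = fun ω => √2 * ((√2)⁻¹ * Y t ω) := by
      ext t; field_simp
    rw [this]
    exact (hY.aemeasurable t).const_mul _
  have hae : AEMeasurable Φ P := by
    have he := measurableEmbedding_eval_rat
    have h1 : AEMeasurable (fun ω (q : ℚ) => Φ ω q) P := by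
      refine aemeasurable_pi_lambda _ fun q => ?_
      refine (hYm (q : ℝ).toNNReal).congr ?_
      filter_upwards [hΦY] with ω hω using (hω q).symm
    have h3 := he.measurable_invFun.comp_aemeasurable h1
    convert h3 using 1
    ext ω : 1
    exact (he.leftInverse_invFun (Φ ω)).symm
  refine ⟨hae.mk Φ, hae.measurable_mk, ?_⟩
  filter_upwards [hΦY, hae.ae_eq_mk] with ω h1 h3 a ha
  rw [← h3, h1, Real.coe_toNNReal a ha]

/-- The law of a continuous path started from `0` whose maxima have Gaussian exponential moments. -/
structure IsGaussianPathLaw (μ : Measure C(ℝ, ℝ)) : Prop where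
  isProbabilityMeasure : IsProbabilityMeasure μ
  eval_zero : ∀ᵐ b ∂μ, b 0 = 0
  integrable_exp : ∀ L r : ℝ, 0 ≤ L → 0 ≤ r → Integrable (fun b => Real.exp (r * pathSup L b)) μ
  integral_exp_le : ∀ L r : ℝ, 0 ≤ L → 0 ≤ r →
    ∫ b, Real.exp (r * pathSup L b) ∂μ ≤ 8 * Real.exp (r ^ 2 * L)

/-- The expectation `E⁺` for a path with law `μ`. -/
noncomputable def pathExpect (μ : Measure C(ℝ, ℝ)) (h : ℝ → EReal) (ξ : ℂ) (s : ℝ) : ℂ :=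
  ∫ b, hitPosWeight h ξ (fun a => s + b a) ∂μ

/-- The expectations `E⁺` only depend on the law of the motion on the space of paths. -/
lemma exists_pathLaw {Ω : Type*} [MeasurableSpace Ω] {P : Measure Ω} [IsProbabilityMeasure P]
    {Y : ℝ → Ω → ℝ} (hY : IsBrownianReal (fun (t : ℝ≥0) ω => (√2)⁻¹ * Y t ω) P) :
    ∃ μ : Measure C(ℝ, ℝ), IsGaussianPathLaw μ ∧
      ∀ h : ℝ → EReal, UpperSemicontinuous h → ∀ ξ s,
        expectPos P Y h ξ s = pathExpect μ h ξ s := by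
  obtain ⟨Φ, hΦ, hΦY⟩ := exists_measurable_path hY
  have hX : IsPreBrownianReal (fun (t : ℝ≥0) ω => (√2)⁻¹ * Φ ω t) P := by
    refine hY.toIsPreBrownianReal.congr fun t => ?_
    filter_upwards [hΦY] with ω hω
    rw [hω t t.2]
  have hm : ∀ L r, Measurable fun b : C(ℝ, ℝ) => Real.exp (r * pathSup L b) :=
    fun L r => ((measurable_pathSup L).const_mul r).exp
  refine ⟨P.map Φ, ⟨Measure.isProbabilityMeasure_map hΦ.aemeasurable, ?_, ?_, ?_⟩, ?_⟩
  · have h0 : MeasurableSet {b : C(ℝ, ℝ) | b 0 = 0} :=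
      measurableSet_eq_fun (continuous_eval_const (F := C(ℝ, ℝ)) (0 : ℝ)).measurable
        measurable_const
    rw [ae_map_iff hΦ.aemeasurable h0]
    filter_upwards [hX.eval_zero_ae_eq_zero] with ω hω
    simpa using hω
  · intro L r hL hr
    exact (integrable_map_measure (hm L r).aestronglyMeasurable hΦ.aemeasurable).2
      (integrable_exp_mul_pathSup hΦ hX hL hr).1
  · intro L r hL hr
    rw [integral_map hΦ.aemeasurable (hm L r).aestronglyMeasurable]
    exact (integrable_exp_mul_pathSup hΦ hX hL hr).2
  · intro h hu ξ s
    have hw : Measurable fun b : C(ℝ, ℝ) => hitPosWeight h ξ (fun a => s + b a) :=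
      (measurable_hitPosWeight hu).comp (f := fun b : C(ℝ, ℝ) => ((ξ, s), b)) (by fun_prop)
    rw [pathExpect, integral_map hΦ.aemeasurable hw.aestronglyMeasurable, expectPos]
    refine integral_congr_ae ?_
    filter_upwards [hΦY] with ω hω
    refine (hitPosWeight_congr hu (by fun_prop) fun a ha => ?_).symm
    rw [hω a ha]

/-! ### The expectations at the hitting time -/

/-- The functions `h : ℝ → [-∞, β]` that are upper semicontinuous with support in `[-L, L]`. -/
structure IsCompactUSC (L β : ℝ) (h : ℝ → EReal) : Prop where
  usc : UpperSemicontinuous h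
  supp : ucSupport h ⊆ Set.Icc (-L) L
  le : ∀ x, h x ≤ (β : EReal)

lemma measurable_pathExpect {μ : Measure C(ℝ, ℝ)} [SFinite μ] {h : ℝ → EReal}
    (hu : UpperSemicontinuous h) : Measurable fun p : ℂ × ℝ => pathExpect μ h p.1 p.2 :=
  (StronglyMeasurable.integral_prod_right (ν := μ)
    (f := fun (p : ℂ × ℝ) (b : C(ℝ, ℝ)) => hitPosWeight h p.1 (fun a => p.2 + b a))
    (measurable_hitPosWeight hu).stronglyMeasurable).measurable

lemma measurable_hitPosWeight_path {h : ℝ → EReal} (hu : UpperSemicontinuous h) (ξ : ℂ) (s : ℝ) :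
    Measurable fun b : C(ℝ, ℝ) => hitPosWeight h ξ (fun a => s + b a) :=
  (measurable_hitPosWeight hu).comp (f := fun b : C(ℝ, ℝ) => ((ξ, s), b)) (by fun_prop)

lemma norm_hitPosWeight_path_le {L β : ℝ} {h : ℝ → EReal} (hh : IsCompactUSC L β h) {ξ : ℂ}
    (hξ : ξ.re < 0) (s : ℝ) {r : ℝ} (hr : 0 ≤ r) (b : C(ℝ, ℝ)) :
    ‖hitPosWeight h ξ (fun a => s + b a)‖ ≤
      Real.exp (L * ‖ξ‖ ^ 2 - ξ.re * s + r * (β - s)) *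
        Real.exp ((r - ξ.re) * pathSup L b) := by
  refine (norm_hitPosWeight_le hh.usc hh.supp hh.le hξ b.continuous
    (fun a ha => abs_le_pathSup b ha) hr).trans_eq ?_
  rw [← Real.exp_add]
  congr 1
  ring

lemma norm_pathExpect_le {μ : Measure C(ℝ, ℝ)} (hμ : IsGaussianPathLaw μ) {L β : ℝ} (hL : 0 ≤ L)
    {h : ℝ → EReal} (hh : IsCompactUSC L β h) {ξ : ℂ} (hξ : ξ.re < 0) (s : ℝ) {r : ℝ}
    (hr : 0 ≤ r) :
    ‖pathExpect μ h ξ s‖ ≤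
      8 * Real.exp (L * ‖ξ‖ ^ 2 - ξ.re * s + r * (β - s) + (r - ξ.re) ^ 2 * L) := by
  have hr' : 0 ≤ r - ξ.re := by linarith
  calc ‖pathExpect μ h ξ s‖
      ≤ ∫ b, Real.exp (L * ‖ξ‖ ^ 2 - ξ.re * s + r * (β - s)) *
          Real.exp ((r - ξ.re) * pathSup L b) ∂μ :=
        norm_integral_le_of_norm_le ((hμ.integrable_exp L _ hL hr').const_mul _)
          (Eventually.of_forall fun b => norm_hitPosWeight_path_le hh hξ s hr b)
    _ = Real.exp (L * ‖ξ‖ ^ 2 - ξ.re * s + r * (β - s)) *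
          ∫ b, Real.exp ((r - ξ.re) * pathSup L b) ∂μ := integral_const_mul _ _
    _ ≤ Real.exp (L * ‖ξ‖ ^ 2 - ξ.re * s + r * (β - s)) *
          (8 * Real.exp ((r - ξ.re) ^ 2 * L)) := by
        gcongr
        exact hμ.integral_exp_le L _ hL hr'
    _ = _ := by
        rw [mul_left_comm, ← Real.exp_add]

/-- The expectations converge along any filter along which almost every path hits the approximations
not much later than the limit. -/
lemma tendsto_pathExpect {μ : Measure C(ℝ, ℝ)} (hμ : IsGaussianPathLaw μ) {L β : ℝ} (hL : 0 ≤ L)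
    {hs : ℕ → ℝ → EReal} {h : ℝ → EReal} (hhs : ∀ n, IsCompactUSC L β (hs n))
    (hh : IsCompactUSC L β h) (hc : TendstoUC hs h) {ξ : ℂ} (hξ : ξ.re < 0) (s : ℝ)
    {l : Filter ℕ} [l.IsCountablyGenerated] (hl : l ≤ atTop)
    (hlate : ∀ᵐ b ∂μ, (hitSetPos h fun a => s + b a).Nonempty → ∀ ε > 0, ∀ᶠ n in l,
      ∃ a ∈ hitSetPos (hs n) fun a => s + b a, a < sInf (hitSetPos h fun a => s + b a) + ε) :
    Tendsto (fun n => pathExpect μ (hs n) ξ s) l (𝓝 (pathExpect μ h ξ s)) := by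
  refine tendsto_integral_filter_of_dominated_convergence
    (fun b => Real.exp (L * ‖ξ‖ ^ 2 - ξ.re * s + 0 * (β - s)) *
        Real.exp ((0 - ξ.re) * pathSup L b)) ?_ ?_ ?_ ?_
  · exact Eventually.of_forall fun n =>
      (measurable_hitPosWeight_path (hhs n).usc ξ s).aestronglyMeasurable
  · exact Eventually.of_forall fun n => Eventually.of_forall fun b =>
      norm_hitPosWeight_path_le (hhs n) hξ s le_rfl b
  · exact (hμ.integrable_exp L _ hL (by linarith)).const_mul _
  · filter_upwards [hlate] with b hb
    exact tendsto_hitPosWeight hc hh.usc (fun n => (hhs n).supp) (by fun_prop) hl hb ξ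

/-- If the motion starts above `h 0`, then for almost every starting point the expectations
converge. -/
lemma ae_tendsto_pathExpect {μ : Measure C(ℝ, ℝ)} (hμ : IsGaussianPathLaw μ) {L β : ℝ}
    (hL : 0 ≤ L) {hs : ℕ → ℝ → EReal} {h : ℝ → EReal} (hhs : ∀ n, IsCompactUSC L β (hs n))
    (hh : IsCompactUSC L β h) (hc : TendstoUC hs h) {ξ : ℂ} (hξ : ξ.re < 0) :
    ∀ᵐ s : ℝ, h 0 < (s : EReal) →
      Tendsto (fun n => pathExpect μ (hs n) ξ s) atTop (𝓝 (pathExpect μ h ξ s)) := by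
  have := hμ.isProbabilityMeasure
  filter_upwards [ae_hitTime_eq_iInf hh.usc μ] with s hs0 hlt
  refine tendsto_pathExpect hμ hL hhs hh hc hξ s le_rfl ?_
  filter_upwards [hs0, hμ.eval_zero] with b hb hb0 hne ε hε
  obtain ⟨a, ha0, ha1, ha2⟩ := exists_lt_of_hitTime_eq_iInf hh.usc b.continuous hb hne
    (half_pos hε)
  have hapos : 0 < a := by
    refine ha0.lt_of_ne fun h0 => ?_
    rw [← h0, hb0, add_zero] at ha1
    exact lt_asymm hlt ha1
  filter_upwards [eventually_hit_of_lt hc (b := fun a => s + b a) (by fun_prop) hapos ha1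
    (half_pos hε)] with n hn
  obtain ⟨a', ha', hlt'⟩ := hn
  exact ⟨a', ha', by linarith⟩

/-- If the motion starts below `h 0`, then the hitting time is `0`. -/
lemma pathExpect_of_lt {μ : Measure C(ℝ, ℝ)} (hμ : IsGaussianPathLaw μ) {h : ℝ → EReal}
    (hu : UpperSemicontinuous h) (ξ : ℂ) {s : ℝ} (hlt : (s : EReal) < h 0) :
    pathExpect μ h ξ s = Complex.exp (-s * ξ) := by
  have := hμ.isProbabilityMeasure
  have heq : ∀ᵐ b ∂μ, hitPosWeight h ξ (fun a => s + b a) = Complex.exp (-s * ξ) := by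
    filter_upwards [hμ.eval_zero] with b hb
    have hmem : (0 : ℝ) ∈ hitSetPos h (fun a => s + b a) := ⟨le_rfl, by simpa [hb] using hlt.le⟩
    have h0 : sInf (hitSetPos h fun a => s + b a) = 0 :=
      le_antisymm (csInf_le (bddBelow_hitSetPos _ _) hmem)
        (sInf_mem_hitSetPos hu (by fun_prop) ⟨0, hmem⟩).1
    rw [hitPosWeight, if_pos ⟨0, hmem⟩, h0, hb]
    simp
  rw [pathExpect, integral_congr_ae heq]
  simp

/-- If the motion starts below `h 0`, then the expectations converge along the approximations that
exceed some level `y > s` at a small nonnegative time: these are hit almost immediately. -/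
lemma tendsto_pathExpect_of_lt {μ : Measure C(ℝ, ℝ)} (hμ : IsGaussianPathLaw μ) {L β : ℝ}
    (hL : 0 ≤ L) {hs : ℕ → ℝ → EReal} {h : ℝ → EReal} (hhs : ∀ n, IsCompactUSC L β (hs n))
    (hh : IsCompactUSC L β h) (hc : TendstoUC hs h) {ξ : ℂ} (hξ : ξ.re < 0) {s y : ℝ}
    (hlt : (s : EReal) < h 0) (hsy : s < y) {l : Filter ℕ} [l.IsCountablyGenerated]
    (hl : l ≤ atTop) {x : ℕ → ℝ} (hx : Tendsto x l (𝓝 0))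
    (hxy : ∀ᶠ n in l, 0 ≤ x n ∧ (y : EReal) ≤ hs n (x n)) :
    Tendsto (fun n => pathExpect μ (hs n) ξ s) l (𝓝 (Complex.exp (-s * ξ))) := by
  rw [← pathExpect_of_lt hμ hh.usc ξ hlt]
  refine tendsto_pathExpect hμ hL hhs hh hc hξ s hl ?_
  filter_upwards [hμ.eval_zero] with b hb0 hne ε hε
  have hlim : Tendsto (fun n => s + b (x n)) l (𝓝 s) := by
    have : Tendsto (fun n => s + b (x n)) l (𝓝 (s + b 0)) :=
      tendsto_const_nhds.add ((b.continuous.tendsto 0).comp hx)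
    rwa [hb0, add_zero] at this
  have h0 : 0 ≤ sInf (hitSetPos h fun a => s + b a) :=
    (sInf_mem_hitSetPos hh.usc (by fun_prop) hne).1
  filter_upwards [hlim.eventually_lt_const hsy, hx.eventually_lt_const hε, hxy] with n h1 h2 h3
  refine ⟨x n, ⟨h3.1, le_trans (EReal.coe_le_coe_iff.2 h1.le) h3.2⟩, by linarith⟩

/-- Points of the hypographs of the approximations that are close to `(0, h 0)`; the sign of their first
coordinate decides from which side of `0` the approximations are hit. -/
lemma exists_seq_tendsto_zero {hs : ℕ → ℝ → EReal} {h : ℝ → EReal}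
    (hu : ∀ n, UpperSemicontinuous (hs n)) (hc : TendstoUC hs h) {y y' : ℝ} (hy : y < y')
    (hy' : (y' : EReal) ≤ h 0) :
    ∃ x : ℕ → ℝ, Tendsto x atTop (𝓝 0) ∧ ∀ᶠ n in atTop, (y : EReal) ≤ hs n (x n) := by
  have hnear : ∀ δ > 0, ∀ᶠ n in atTop, ∃ x, |x| < δ ∧ (y : EReal) ≤ hs n x := by
    intro δ hδ
    filter_upwards [hc.eventually_near hy' (lt_min hδ (sub_pos.2 hy))] with n hn
    obtain ⟨x, z, h1, h2, h3⟩ := hn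
    rw [sub_zero] at h1
    refine ⟨x, h1.trans_le (min_le_left _ _), le_trans (EReal.coe_le_coe_iff.2 ?_) h3⟩
    have h4 := abs_lt.1 (h2.trans_le (min_le_right _ _))
    linarith
  -- The nearest point to `0` at which `hs n` is at least `y`.
  have hex : ∀ n, ∃ x, (∃ x', (y : EReal) ≤ hs n x') →
      (y : EReal) ≤ hs n x ∧ ∀ x', (y : EReal) ≤ hs n x' → |x| ≤ |x'| := by
    intro n
    by_cases hne : ∃ x', (y : EReal) ≤ hs n x'
    · have hcl : IsClosed {x | (y : EReal) ≤ hs n x} :=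
        (isClosed_hypograph (hu n)).preimage (f := fun x : ℝ => (x, y)) (by fun_prop)
      obtain ⟨x, hx, hd⟩ := hcl.exists_infDist_eq_dist hne 0
      refine ⟨x, fun _ => ⟨hx, fun x' hx' => ?_⟩⟩
      have := Metric.infDist_le_dist_of_mem (x := (0 : ℝ))
        (show x' ∈ {x | (y : EReal) ≤ hs n x} from hx')
      rw [hd, Real.dist_eq, Real.dist_eq, zero_sub, zero_sub, abs_neg, abs_neg] at this
      exact this
    · exact ⟨0, fun h => absurd h hne⟩
  choose x hx using hex
  refine ⟨x, ?_, ?_⟩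
  · rw [Metric.tendsto_nhds]
    intro ε hε
    filter_upwards [hnear ε hε] with n hn
    obtain ⟨x', h1, h2⟩ := hn
    rw [Real.dist_eq, sub_zero]
    exact ((hx n ⟨x', h2⟩).2 x' h2).trans_lt h1
  · filter_upwards [hnear 1 one_pos] with n hn
    obtain ⟨x', -, h2⟩ := hn
    exact (hx n ⟨x', h2⟩).1

/-! ### Reflection of the initial condition -/

lemma IsCompactUSC.reflect {L β : ℝ} {h : ℝ → EReal} (hh : IsCompactUSC L β h) :
    IsCompactUSC L β fun x => h (-x) where
  usc := fun x => (hh.usc (-x)).comp continuous_neg.continuousAt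
  supp := by
    refine closure_minimal (fun x hx => ?_) isClosed_Icc
    have := mem_Icc_of_ucSupport_subset hh.supp hx
    exact ⟨by linarith [this.2], by linarith [this.1]⟩
  le x := hh.le _

lemma TendstoUC.reflect {hs : ℕ → ℝ → EReal} {h : ℝ → EReal} (hc : TendstoUC hs h) :
    TendstoUC (fun n x => hs n (-x)) fun x => h (-x) := by
  have key : ∀ (f g : ℝ → EReal) (R δ : ℝ),
      hypograph f ∩ Metric.closedBall 0 R ⊆ Metric.thickening δ (hypograph g) →
      hypograph (fun x => f (-x)) ∩ Metric.closedBall 0 R ⊆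
        Metric.thickening δ (hypograph fun x => g (-x)) := by
    rintro f g R δ hfg ⟨x, y⟩ ⟨hp, hR⟩
    have hR' : ((-x, y) : ℝ × ℝ) ∈ Metric.closedBall 0 R := by
      simpa [Metric.mem_closedBall, Prod.norm_def] using hR
    obtain ⟨⟨x', y'⟩, hq, hd⟩ := Metric.mem_thickening_iff.1 (hfg ⟨hp, hR'⟩)
    refine Metric.mem_thickening_iff.2 ⟨(-x', y'), ?_, ?_⟩
    · simpa [hypograph] using hq
    · rw [Prod.dist_eq] at hd ⊢
      have hx : dist x (-x') = dist (-x) x' := by rw [← dist_neg_neg, neg_neg]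
      exact hx.symm ▸ hd
  intro R hR δ hδ
  filter_upwards [hc R hR δ hδ] with n hn
  exact ⟨key _ _ R δ hn.1, key _ _ R δ hn.2⟩

/-! ### The characteristic function -/

lemma integrable_exp_neg_mul_abs {c : ℝ} (hc : 0 < c) :
    Integrable (fun s : ℝ => Real.exp (-(c * |s|))) ∧ ∫ s : ℝ, Real.exp (-(c * |s|)) = 2 / c := by
  have h2 : Integrable (fun s : ℝ => Real.exp (-(c * |s|))) := by
    rw [← integrableOn_univ, ← Set.Iic_union_Ioi (a := (0 : ℝ))]
    refine IntegrableOn.union ?_ ?_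
    · refine (integrableOn_exp_mul_Iic hc 0).congr_fun (fun s hs => ?_) measurableSet_Iic
      simp [abs_of_nonpos (Set.mem_Iic.1 hs)]
    · refine (integrableOn_exp_mul_Ioi (a := -c) (by linarith) 0).congr_fun (fun s hs => ?_)
        measurableSet_Ioi
      simp [abs_of_pos (Set.mem_Ioi.1 hs)]
  refine ⟨h2, ?_⟩
  rw [integral_comp_abs (f := fun s => Real.exp (-(c * s)))]
  have h3 := integral_exp_mul_Ioi (a := -c) (by linarith) 0
  simp only [neg_mul, mul_zero, Real.exp_zero] at h3
  rw [h3]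
  field_simp

/-- Exponential decay in the starting point `s`: for `s → -∞` it comes from the factor `e^{s(η-ξ)}`, and
for `s → ∞` from the Chernoff bound with the parameter `η.re - ξ.re + 1`. -/
lemma norm_exp_mul_pathExpect_le {μ : Measure C(ℝ, ℝ)} (hμ : IsGaussianPathLaw μ) {L β : ℝ}
    (hL : 0 ≤ L) {h : ℝ → EReal} (hh : IsCompactUSC L β h) {η ξ : ℂ} (hη : 0 < η.re)
    (hξ : ξ.re < 0) {c Q : ℝ} (hc : c ≤ 1) (hc' : c ≤ η.re - ξ.re)
    (hQ : η.re - 2 * ξ.re + 1 ≤ Q) (s : ℝ) :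
    ‖Complex.exp (s * η) * pathExpect μ h ξ s‖ ≤
      8 * Real.exp (L * ‖ξ‖ ^ 2 + |β| * Q + Q ^ 2 * L) * Real.exp (-(c * |s|)) := by
  have hre : ((s : ℂ) * η).re = s * η.re := Complex.re_ofReal_mul _ _
  have hQ0 : 0 ≤ Q := by linarith
  have hβ : 0 ≤ |β| * Q := by positivity
  rw [norm_mul, Complex.norm_exp, hre]
  rcases le_total 0 s with h0 | h0
  · have hb := norm_pathExpect_le hμ hL hh hξ s (r := η.re - ξ.re + 1) (by linarith)
    refine (mul_le_mul_of_nonneg_left hb (Real.exp_pos _).le).trans ?_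
    rw [mul_left_comm, mul_assoc, ← Real.exp_add, ← Real.exp_add]
    refine mul_le_mul_of_nonneg_left (Real.exp_le_exp.2 ?_) (by norm_num)
    rw [abs_of_nonneg h0]
    have h1 : (η.re - ξ.re + 1) * β ≤ |β| * Q := by
      calc (η.re - ξ.re + 1) * β ≤ (η.re - ξ.re + 1) * |β| :=
            mul_le_mul_of_nonneg_left (le_abs_self β) (by linarith)
        _ ≤ |β| * Q := by
            rw [mul_comm]
            exact mul_le_mul_of_nonneg_left (by linarith) (abs_nonneg β)
    have h2 : (η.re - ξ.re + 1 - ξ.re) ^ 2 * L ≤ Q ^ 2 * L :=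
      mul_le_mul_of_nonneg_right (pow_le_pow_left₀ (by linarith) (by linarith) 2) hL
    have h3 : c * s ≤ s := by nlinarith
    nlinarith
  · have hb := norm_pathExpect_le hμ hL hh hξ s (r := 0) le_rfl
    refine (mul_le_mul_of_nonneg_left hb (Real.exp_pos _).le).trans ?_
    rw [mul_left_comm, mul_assoc, ← Real.exp_add, ← Real.exp_add]
    refine mul_le_mul_of_nonneg_left (Real.exp_le_exp.2 ?_) (by norm_num)
    rw [abs_of_nonpos h0]
    have h2 : (0 - ξ.re) ^ 2 * L ≤ Q ^ 2 * L :=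
      mul_le_mul_of_nonneg_right (pow_le_pow_left₀ (by linarith) (by linarith) 2) hL
    have h3 : (η.re - ξ.re) * s ≤ c * s := mul_le_mul_of_nonpos_right hc' h0
    nlinarith

/-- The integrand of `χ_h(η, ξ)`, where `μ` and `ν` are the laws of the motion to the right and of the
reflected motion to the left of `0`. -/
noncomputable def chiIntegrand (μ ν : Measure C(ℝ, ℝ)) (h : ℝ → EReal) (η ξ : ℂ) (s : ℝ) : ℂ :=
  Complex.exp (s * η) * pathExpect μ h ξ s
    + Complex.exp (-s * ξ) * pathExpect ν (fun x => h (-x)) (-η) s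
    - pathExpect μ h ξ s * pathExpect ν (fun x => h (-x)) (-η) s

/-- A bound for `χ_h(η, ξ)` that is uniform in `h`, up to a factor depending on the distances of `η`
and `ξ` to the imaginary axis. -/
noncomputable def chiBound (L β : ℝ) (η ξ : ℂ) : ℝ :=
  64 * Real.exp (L * (‖ξ‖ ^ 2 + ‖η‖ ^ 2) + |β| * (2 * (η.re - ξ.re) + 1)
    + 2 * (2 * (η.re - ξ.re) + 1) ^ 2 * L)

lemma norm_chi_terms_le {μ ν : Measure C(ℝ, ℝ)} (hμ : IsGaussianPathLaw μ)
    (hν : IsGaussianPathLaw ν) {L β : ℝ} (hL : 0 ≤ L) {h : ℝ → EReal} (hh : IsCompactUSC L β h)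
    {η ξ : ℂ} (hη : 0 < η.re) (hξ : ξ.re < 0) (s : ℝ) :
    ‖Complex.exp (s * η) * pathExpect μ h ξ s‖ ≤
        chiBound L β η ξ * Real.exp (-(min 1 (η.re - ξ.re) * |s|)) ∧
    ‖Complex.exp (-s * ξ) * pathExpect ν (fun x => h (-x)) (-η) s‖ ≤
        chiBound L β η ξ * Real.exp (-(min 1 (η.re - ξ.re) * |s|)) ∧
    ‖pathExpect μ h ξ s * pathExpect ν (fun x => h (-x)) (-η) s‖ ≤
        chiBound L β η ξ * Real.exp (-(min 1 (η.re - ξ.re) * |s|)) := by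
  have hη' : (-η).re < 0 := by simpa using hη
  have hξ' : 0 < (-ξ).re := by simpa using hξ
  set Q : ℝ := 2 * (η.re - ξ.re) + 1 with hQ
  have hQ0 : 0 ≤ Q := by linarith
  have hβ : 0 ≤ |β| * Q := by positivity
  have hLη : 0 ≤ L * ‖η‖ ^ 2 := by positivity
  have hLξ : 0 ≤ L * ‖ξ‖ ^ 2 := by positivity
  have hQL : 0 ≤ Q ^ 2 * L := by positivity
  have e1 := norm_exp_mul_pathExpect_le hμ hL hh hη hξ (c := min 1 (η.re - ξ.re)) (Q := Q)
    (min_le_left _ _) (min_le_right _ _) (by linarith) s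
  have e2 := norm_exp_mul_pathExpect_le hν hL hh.reflect hξ' hη' (c := min 1 (η.re - ξ.re))
    (Q := Q) (min_le_left _ _)
    ((min_le_right _ _).trans_eq (by simp only [Complex.neg_re]; ring))
    (by simp only [Complex.neg_re]; linarith) s
  rw [norm_neg, mul_neg, ← neg_mul] at e2
  have e3 := norm_pathExpect_le hν hL hh.reflect hη' s (r := 0) le_rfl
  rw [norm_neg, Complex.neg_re] at e3
  refine ⟨e1.trans ?_, e2.trans ?_, ?_⟩
  · refine mul_le_mul_of_nonneg_right ?_ (Real.exp_pos _).le
    rw [chiBound, ← hQ]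
    refine mul_le_mul (by norm_num) (Real.exp_le_exp.2 (by nlinarith)) (Real.exp_pos _).le
      (by norm_num)
  · refine mul_le_mul_of_nonneg_right ?_ (Real.exp_pos _).le
    rw [chiBound, ← hQ]
    refine mul_le_mul (by norm_num) (Real.exp_le_exp.2 (by nlinarith)) (Real.exp_pos _).le
      (by norm_num)
  · have hnorm : ‖Complex.exp (s * η)‖ = Real.exp (s * η.re) := by
      rw [Complex.norm_exp, Complex.re_ofReal_mul]
    have h1 : ‖pathExpect ν (fun x => h (-x)) (-η) s‖ ≤
        8 * Real.exp (L * ‖η‖ ^ 2 + Q ^ 2 * L) * ‖Complex.exp (s * η)‖ := by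
      refine e3.trans ?_
      rw [hnorm, mul_assoc, ← Real.exp_add]
      refine mul_le_mul_of_nonneg_left (Real.exp_le_exp.2 ?_) (by norm_num)
      have : (0 - -η.re) ^ 2 * L ≤ Q ^ 2 * L :=
        mul_le_mul_of_nonneg_right (pow_le_pow_left₀ (by linarith) (by linarith) 2) hL
      nlinarith
    calc ‖pathExpect μ h ξ s * pathExpect ν (fun x => h (-x)) (-η) s‖
        ≤ ‖pathExpect μ h ξ s‖ *
            (8 * Real.exp (L * ‖η‖ ^ 2 + Q ^ 2 * L) * ‖Complex.exp (s * η)‖) := by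
          rw [norm_mul]
          exact mul_le_mul_of_nonneg_left h1 (norm_nonneg _)
      _ = 8 * Real.exp (L * ‖η‖ ^ 2 + Q ^ 2 * L) *
            ‖Complex.exp (s * η) * pathExpect μ h ξ s‖ := by
          rw [norm_mul]; ring
      _ ≤ 8 * Real.exp (L * ‖η‖ ^ 2 + Q ^ 2 * L) *
            (8 * Real.exp (L * ‖ξ‖ ^ 2 + |β| * Q + Q ^ 2 * L) *
              Real.exp (-(min 1 (η.re - ξ.re) * |s|))) :=
          mul_le_mul_of_nonneg_left e1 (by positivity)
      _ = chiBound L β η ξ * Real.exp (-(min 1 (η.re - ξ.re) * |s|)) := by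
          rw [chiBound, ← hQ, ← mul_assoc, mul_mul_mul_comm, ← Real.exp_add]
          norm_num
          ring

lemma measurable_chiIntegrand {μ ν : Measure C(ℝ, ℝ)} [SFinite μ] [SFinite ν] {h : ℝ → EReal}
    (hu : UpperSemicontinuous h) :
    Measurable fun p : (ℂ × ℂ) × ℝ => chiIntegrand μ ν h p.1.1 p.1.2 p.2 := by
  have hu' : UpperSemicontinuous fun x => h (-x) :=
    fun x => (hu (-x)).comp continuous_neg.continuousAt
  have h1 : Measurable fun p : (ℂ × ℂ) × ℝ => pathExpect μ h p.1.2 p.2 :=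
    (measurable_pathExpect hu).comp (f := fun p : (ℂ × ℂ) × ℝ => (p.1.2, p.2)) (by fun_prop)
  have h2 : Measurable fun p : (ℂ × ℂ) × ℝ => pathExpect ν (fun x => h (-x)) (-p.1.1) p.2 :=
    (measurable_pathExpect hu').comp (f := fun p : (ℂ × ℂ) × ℝ => (-p.1.1, p.2)) (by fun_prop)
  unfold chiIntegrand
  fun_prop

lemma norm_chiIntegrand_le {μ ν : Measure C(ℝ, ℝ)} (hμ : IsGaussianPathLaw μ)
    (hν : IsGaussianPathLaw ν) {L β : ℝ} (hL : 0 ≤ L) {h : ℝ → EReal} (hh : IsCompactUSC L β h)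
    {η ξ : ℂ} (hη : 0 < η.re) (hξ : ξ.re < 0) (s : ℝ) :
    ‖chiIntegrand μ ν h η ξ s‖ ≤
      3 * chiBound L β η ξ * Real.exp (-(min 1 (η.re - ξ.re) * |s|)) := by
  obtain ⟨h1, h2, h3⟩ := norm_chi_terms_le hμ hν hL hh hη hξ s
  refine (norm_sub_le _ _).trans ?_
  linarith [norm_add_le (Complex.exp (s * η) * pathExpect μ h ξ s)
    (Complex.exp (-s * ξ) * pathExpect ν (fun x => h (-x)) (-η) s)]

/-- The individual expectations need not converge if the motion starts below `h 0`, but one of them is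
close to its limit, which is enough for the integrand
`e^{s(η-ξ)} - (e^{-sξ} - E⁺) (e^{sη} - E⁻)`. -/
lemma tendsto_chiIntegrand_of_lt {μ ν : Measure C(ℝ, ℝ)} (hμ : IsGaussianPathLaw μ)
    (hν : IsGaussianPathLaw ν) {L β : ℝ} (hL : 0 ≤ L) {hs : ℕ → ℝ → EReal} {h : ℝ → EReal}
    (hhs : ∀ n, IsCompactUSC L β (hs n)) (hh : IsCompactUSC L β h) (hc : TendstoUC hs h)
    {η ξ : ℂ} (hη : 0 < η.re) (hξ : ξ.re < 0) {s : ℝ} (hlt : (s : EReal) < h 0) :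
    Tendsto (fun n => chiIntegrand μ ν (hs n) η ξ s) atTop (𝓝 (chiIntegrand μ ν h η ξ s)) := by
  have hη' : (-η).re < 0 := by simpa using hη
  obtain ⟨y', hy1, hy2⟩ := EReal.lt_iff_exists_real_btwn.1 hlt
  obtain ⟨y, hy3, hy4⟩ := exists_between (EReal.coe_lt_coe_iff.1 hy1)
  obtain ⟨x, hx, hxy⟩ := exists_seq_tendsto_zero (fun n => (hhs n).usc) hc hy4 hy2.le
  have hid : ∀ f : ℝ → EReal, chiIntegrand μ ν f η ξ s =
      Complex.exp (-s * ξ) * Complex.exp (s * η)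
        - (Complex.exp (-s * ξ) - pathExpect μ f ξ s) *
          (Complex.exp (s * η) - pathExpect ν (fun x => f (-x)) (-η) s) := by
    intro f
    rw [chiIntegrand]
    ring
  have hbd : ∀ (lam : Measure C(ℝ, ℝ)) (hl : IsGaussianPathLaw lam) (f : ℕ → ℝ → EReal)
      (_ : ∀ n, IsCompactUSC L β (f n)) (z w : ℂ) (_ : z.re < 0) (l : Filter ℕ),
      IsBoundedUnder (· ≤ ·) l (norm ∘ fun n => w - pathExpect lam (f n) z s) := by
    intro lam hl f hf z w hz l
    refine isBoundedUnder_of ⟨‖w‖ + _, fun n => (norm_sub_le _ _).trans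
      (add_le_add le_rfl (norm_pathExpect_le hl hL (hf n) hz s (r := 0) le_rfl))⟩
  have hu' : UpperSemicontinuous fun x => h (-x) := hh.reflect.usc
  have hlim : Tendsto (fun n => (Complex.exp (-s * ξ) - pathExpect μ (hs n) ξ s) *
      (Complex.exp (s * η) - pathExpect ν (fun x => hs n (-x)) (-η) s)) atTop (𝓝 0) := by
    have hsplit : (atTop : Filter ℕ) =
        (atTop ⊓ 𝓟 {n | 0 ≤ x n}) ⊔ (atTop ⊓ 𝓟 {n | 0 ≤ x n}ᶜ) := by
      rw [← inf_sup_left, sup_principal, Set.union_compl_self, principal_univ, inf_top_eq]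
    rw [hsplit]
    refine Tendsto.sup ?_ ?_
    · have h1 := tendsto_pathExpect_of_lt hμ hL hhs hh hc hξ hlt hy3
        (l := atTop ⊓ 𝓟 {n | 0 ≤ x n}) inf_le_left (hx.mono_left inf_le_left)
        (by
          filter_upwards [hxy.filter_mono inf_le_left,
            (eventually_principal.2 fun n hn => hn :
              ∀ᶠ n in 𝓟 {n | 0 ≤ x n}, 0 ≤ x n).filter_mono inf_le_right] with n hn1 hn2
          exact ⟨hn2, hn1⟩)
      have h2 : Tendsto (fun n => Complex.exp (-s * ξ) - pathExpect μ (hs n) ξ s)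
          (atTop ⊓ 𝓟 {n | 0 ≤ x n}) (𝓝 0) := by
        simpa using (tendsto_const_nhds (x := Complex.exp (-s * ξ))).sub h1
      exact h2.zero_mul_isBoundedUnder_le
        (hbd ν hν (fun n x => hs n (-x)) (fun n => (hhs n).reflect) _ _ hη' _)
    · have h1 := tendsto_pathExpect_of_lt hν hL (fun n => (hhs n).reflect) hh.reflect hc.reflect
        hη' (s := s) (by simpa using hlt) hy3
        (l := atTop ⊓ 𝓟 {n | 0 ≤ x n}ᶜ) inf_le_left (x := fun n => -x n)
        (by simpa using (hx.mono_left inf_le_left).neg)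
        (by
          filter_upwards [hxy.filter_mono inf_le_left,
            (eventually_principal.2 fun n hn => hn :
              ∀ᶠ n in 𝓟 {n | 0 ≤ x n}ᶜ, n ∈ {n | 0 ≤ x n}ᶜ).filter_mono inf_le_right]
            with n hn1 hn2
          have hn3 : ¬ 0 ≤ x n := hn2
          exact ⟨by linarith, by simpa using hn1⟩)
      rw [neg_mul_neg] at h1
      have h2 : Tendsto (fun n => Complex.exp (s * η) -
          pathExpect ν (fun x => hs n (-x)) (-η) s) (atTop ⊓ 𝓟 {n | 0 ≤ x n}ᶜ) (𝓝 0) := by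
        simpa using (tendsto_const_nhds (x := Complex.exp (s * η))).sub h1
      exact isBoundedUnder_le_mul_tendsto_zero (hbd μ hμ hs hhs _ _ hξ _) h2
  have h0 : (Complex.exp (-s * ξ) - pathExpect μ h ξ s) *
      (Complex.exp (s * η) - pathExpect ν (fun x => h (-x)) (-η) s) = 0 := by
    rw [pathExpect_of_lt hμ hh.usc ξ hlt, sub_self, zero_mul]
  simp only [hid]
  rw [h0]
  exact tendsto_const_nhds.sub hlim

lemma ae_tendsto_chiIntegrand {μ ν : Measure C(ℝ, ℝ)} (hμ : IsGaussianPathLaw μ)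
    (hν : IsGaussianPathLaw ν) {L β : ℝ} (hL : 0 ≤ L) {hs : ℕ → ℝ → EReal} {h : ℝ → EReal}
    (hhs : ∀ n, IsCompactUSC L β (hs n)) (hh : IsCompactUSC L β h) (hc : TendstoUC hs h)
    {η ξ : ℂ} (hη : 0 < η.re) (hξ : ξ.re < 0) :
    ∀ᵐ s : ℝ, Tendsto (fun n => chiIntegrand μ ν (hs n) η ξ s) atTop
      (𝓝 (chiIntegrand μ ν h η ξ s)) := by
  have hη' : (-η).re < 0 := by simpa using hη
  have hne : ∀ᵐ s : ℝ, (s : EReal) ≠ h 0 := by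
    refine Set.Countable.ae_notMem (s := {s : ℝ | (s : EReal) = h 0}) ?_ volume
    refine Set.Subsingleton.countable fun s hs s' hs' => ?_
    exact EReal.coe_injective ((show (s : EReal) = h 0 from hs).trans
      (show (s' : EReal) = h 0 from hs').symm)
  filter_upwards [hne, ae_tendsto_pathExpect hμ hL hhs hh hc hξ,
    ae_tendsto_pathExpect hν hL (fun n => (hhs n).reflect) hh.reflect hc.reflect hη']
    with s h0 h1 h2
  rcases lt_or_gt_of_ne h0 with hlt | hgt
  · exact tendsto_chiIntegrand_of_lt hμ hν hL hhs hh hc hη hξ hlt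
  · have h1' := h1 hgt
    have h2' := h2 (by simpa using hgt)
    exact ((h1'.const_mul _).add (h2'.const_mul _)).sub (h1'.mul h2')

lemma tendsto_integral_chiIntegrand {μ ν : Measure C(ℝ, ℝ)} (hμ : IsGaussianPathLaw μ)
    (hν : IsGaussianPathLaw ν) {L β : ℝ} (hL : 0 ≤ L) {hs : ℕ → ℝ → EReal} {h : ℝ → EReal}
    (hhs : ∀ n, IsCompactUSC L β (hs n)) (hh : IsCompactUSC L β h) (hc : TendstoUC hs h)
    {η ξ : ℂ} (hη : 0 < η.re) (hξ : ξ.re < 0) :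
    Tendsto (fun n => ∫ s, chiIntegrand μ ν (hs n) η ξ s) atTop
      (𝓝 (∫ s, chiIntegrand μ ν h η ξ s)) := by
  have := hμ.isProbabilityMeasure
  have := hν.isProbabilityMeasure
  refine tendsto_integral_of_dominated_convergence _ (fun n => ?_)
    ((integrable_exp_neg_mul_abs (lt_min one_pos (show 0 < η.re - ξ.re by linarith))).1.const_mul
      (3 * chiBound L β η ξ))
    (fun n => Eventually.of_forall fun s => norm_chiIntegrand_le hμ hν hL (hhs n) hη hξ s)
    (ae_tendsto_chiIntegrand hμ hν hL hhs hh hc hη hξ)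
  exact ((measurable_chiIntegrand (hhs n).usc).comp
    (f := fun s : ℝ => ((η, ξ), s)) (by fun_prop)).aestronglyMeasurable

lemma norm_integral_chiIntegrand_le {μ ν : Measure C(ℝ, ℝ)} (hμ : IsGaussianPathLaw μ)
    (hν : IsGaussianPathLaw ν) {L β : ℝ} (hL : 0 ≤ L) {h : ℝ → EReal} (hh : IsCompactUSC L β h)
    {η ξ : ℂ} (hη : 0 < η.re) (hξ : ξ.re < 0) :
    ‖∫ s, chiIntegrand μ ν h η ξ s‖ ≤
      6 * chiBound L β η ξ / min 1 (η.re - ξ.re) := by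
  have hc : 0 < min 1 (η.re - ξ.re) := lt_min one_pos (by linarith)
  refine (norm_integral_le_of_norm_le ((integrable_exp_neg_mul_abs hc).1.const_mul
      (3 * chiBound L β η ξ))
    (Eventually.of_forall fun s => norm_chiIntegrand_le hμ hν hL hh hη hξ s)).trans_eq ?_
  rw [integral_const_mul, (integrable_exp_neg_mul_abs hc).2]
  ring

lemma expectNeg_eq {Ω : Type*} [MeasurableSpace Ω] (P : Measure Ω) (B : ℝ → Ω → ℝ)
    (h : ℝ → EReal) (η : ℂ) (s : ℝ) :
    expectNeg P B h η s = expectPos P (fun a => B (-a)) (fun x => h (-x)) (-η) s := by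
  simp only [expectNeg, expectPos, hitNegWeight_eq]

lemma chi_eq_integral {Ω : Type*} [MeasurableSpace Ω] {P : Measure Ω} {B : ℝ → Ω → ℝ}
    {μ ν : Measure C(ℝ, ℝ)} (hμ : IsGaussianPathLaw μ) (hν : IsGaussianPathLaw ν)
    (hμP : ∀ h : ℝ → EReal, UpperSemicontinuous h → ∀ ξ s,
      expectPos P B h ξ s = pathExpect μ h ξ s)
    (hνP : ∀ h : ℝ → EReal, UpperSemicontinuous h → ∀ ξ s,
      expectPos P (fun a => B (-a)) h ξ s = pathExpect ν h ξ s)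
    {L β : ℝ} (hL : 0 ≤ L) {h : ℝ → EReal} (hh : IsCompactUSC L β h)
    {η ξ : ℂ} (hη : 0 < η.re) (hξ : ξ.re < 0) :
    chi P B h η ξ = ∫ s, chiIntegrand μ ν h η ξ s := by
  have := hμ.isProbabilityMeasure
  have := hν.isProbabilityMeasure
  have hdom := (integrable_exp_neg_mul_abs
    (lt_min one_pos (show 0 < η.re - ξ.re by linarith))).1.const_mul (chiBound L β η ξ)
  have hm1 : Measurable fun s : ℝ => pathExpect μ h ξ s :=
    (measurable_pathExpect hh.usc).comp (f := fun s : ℝ => (ξ, s)) (by fun_prop)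
  have hm2 : Measurable fun s : ℝ => pathExpect ν (fun x => h (-x)) (-η) s :=
    (measurable_pathExpect hh.reflect.usc).comp (f := fun s : ℝ => (-η, s)) (by fun_prop)
  have i1 : Integrable fun s : ℝ => Complex.exp (s * η) * pathExpect μ h ξ s :=
    hdom.mono' (by fun_prop)
      (Eventually.of_forall fun s => (norm_chi_terms_le hμ hν hL hh hη hξ s).1)
  have i2 : Integrable fun s : ℝ =>
      Complex.exp (-s * ξ) * pathExpect ν (fun x => h (-x)) (-η) s :=
    hdom.mono' (by fun_prop)
      (Eventually.of_forall fun s => (norm_chi_terms_le hμ hν hL hh hη hξ s).2.1)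
  have i3 : Integrable fun s : ℝ =>
      pathExpect μ h ξ s * pathExpect ν (fun x => h (-x)) (-η) s :=
    hdom.mono' (by fun_prop)
      (Eventually.of_forall fun s => (norm_chi_terms_le hμ hν hL hh hη hξ s).2.2)
  simp only [chi, expectNeg_eq, hμP h hh.usc, hνP _ hh.reflect.usc, chiIntegrand]
  rw [← integral_add i1 i2]
  exact (integral_sub (i1.add i2) i3).symm

/-! ### Fredholm determinants -/

open scoped ComplexOrder in
/-- Hadamard's inequality for matrices with entries in the unit disc, from the inequality between the
arithmetic and the geometric mean of the eigenvalues of `A Aᴴ`. -/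
lemma norm_det_le_sqrt_of_norm_le_one {n : ℕ} {A : Matrix (Fin n) (Fin n) ℂ}
    (hA : ∀ i j, ‖A i j‖ ≤ 1) : ‖A.det‖ ≤ √((n : ℝ) ^ n) := by
  rcases Nat.eq_zero_or_pos n with rfl | hn
  · simp
  have hn' : (0 : ℝ) < n := by exact_mod_cast hn
  have hps : (A * A.conjTranspose).PosSemidef := Matrix.posSemidef_self_mul_conjTranspose A
  set lam := hps.isHermitian.eigenvalues with hlam
  have hlam0 : ∀ i, 0 ≤ lam i := fun i => hps.eigenvalues_nonneg i
  have hdet : ‖A.det‖ ^ 2 = ∏ i, lam i := by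
    have h1 := hps.isHermitian.det_eq_prod_eigenvalues
    rw [Matrix.det_mul, Matrix.det_conjTranspose] at h1
    have h2 : A.det * star A.det = ((‖A.det‖ ^ 2 : ℝ) : ℂ) := by
      rw [Complex.ofReal_pow]
      exact Complex.mul_conj' _
    rw [h2] at h1
    have h3 : ((‖A.det‖ ^ 2 : ℝ) : ℂ) = ((∏ i, lam i : ℝ) : ℂ) := by
      rw [h1]; push_cast; rfl
    exact Complex.ofReal_injective h3
  have htr : ∑ i, lam i ≤ (n : ℝ) * n := by
    have h1 := hps.isHermitian.trace_eq_sum_eigenvalues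
    have h2 : (A * A.conjTranspose).trace = ((∑ i, ∑ j, ‖A i j‖ ^ 2 : ℝ) : ℂ) := by
      simp only [Matrix.trace, Matrix.diag_apply, Matrix.mul_apply, Matrix.conjTranspose_apply]
      push_cast
      refine Finset.sum_congr rfl fun i _ => Finset.sum_congr rfl fun j _ => ?_
      exact Complex.mul_conj' _
    have h3 : ∑ i, lam i = ∑ i, ∑ j, ‖A i j‖ ^ 2 := by
      apply Complex.ofReal_injective
      rw [← h2, h1]
      push_cast
      rfl
    rw [h3]
    calc ∑ i, ∑ j, ‖A i j‖ ^ 2 ≤ ∑ _i : Fin n, ∑ _j : Fin n, (1 : ℝ) := by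
          refine Finset.sum_le_sum fun i _ => Finset.sum_le_sum fun j _ => ?_
          exact pow_le_one₀ (norm_nonneg _) (hA i j)
      _ = (n : ℝ) * n := by simp
  have hag := Real.geom_mean_le_arith_mean Finset.univ (fun _ => (1 : ℝ)) lam
    (fun _ _ => zero_le_one) (by simpa using hn') (fun i _ => hlam0 i)
  simp only [Real.rpow_one, Finset.sum_const, Finset.card_univ, Fintype.card_fin, nsmul_eq_mul,
    mul_one, one_mul] at hag
  have hmean : (∑ i, lam i) / n ≤ n := by
    rw [div_le_iff₀ hn']
    exact htr
  have hprod : ∏ i, lam i ≤ (n : ℝ) ^ n := by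
    have h1 : (0 : ℝ) ≤ ∏ i, lam i := Finset.prod_nonneg fun i _ => hlam0 i
    have h2 := pow_le_pow_left₀ (Real.rpow_nonneg h1 _) (hag.trans hmean) n
    rwa [Real.rpow_inv_natCast_pow h1 hn.ne'] at h2
  rw [← hdet] at hprod
  exact Real.le_sqrt_of_sq_le hprod

lemma norm_det_le_of_norm_le_mul {n : ℕ} {A : Matrix (Fin n) (Fin n) ℂ} {a b : Fin n → ℝ}
    (ha : ∀ i, 0 < a i) (hb : ∀ i, 0 < b i) (hA : ∀ i j, ‖A i j‖ ≤ a i * b j) :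
    ‖A.det‖ ≤ √((n : ℝ) ^ n) * ∏ i, (a i * b i) := by
  set A' : Matrix (Fin n) (Fin n) ℂ := Matrix.of fun i j => A i j / (a i * b j : ℂ) with hA'
  have hfac : A = Matrix.of fun i j => (b j : ℂ) *
      (Matrix.of fun i j => (a i : ℂ) * A' i j : Matrix (Fin n) (Fin n) ℂ) i j := by
    ext i j
    have h1 : (a i : ℂ) ≠ 0 := by exact_mod_cast (ha i).ne'
    have h2 : (b j : ℂ) ≠ 0 := by exact_mod_cast (hb j).ne'
    simp only [hA', Matrix.of_apply]
    field_simp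
  have hle : ‖A'.det‖ ≤ √((n : ℝ) ^ n) := by
    refine norm_det_le_sqrt_of_norm_le_one fun i j => ?_
    simp only [hA', Matrix.of_apply, norm_div, norm_mul, Complex.norm_real, Real.norm_eq_abs,
      abs_of_pos (ha i), abs_of_pos (hb j)]
    exact div_le_one_of_le₀ (hA i j) (mul_pos (ha i) (hb j)).le
  rw [hfac, Matrix.det_mul_row, Matrix.det_mul_column, norm_mul, norm_mul, norm_prod, norm_prod]
  simp only [Complex.norm_real, Real.norm_eq_abs, abs_of_pos (ha _), abs_of_pos (hb _)]
  rw [Finset.prod_mul_distrib]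
  have h1 : 0 < ∏ i, a i := Finset.prod_pos fun i _ => ha i
  have h2 : 0 < ∏ i, b i := Finset.prod_pos fun i _ => hb i
  calc (∏ i, b i) * ((∏ i, a i) * ‖A'.det‖)
      ≤ (∏ i, b i) * ((∏ i, a i) * √((n : ℝ) ^ n)) := by gcongr
    _ = _ := by ring

/-- The bound for the `n`-th term of a Fredholm series that results from Hadamard's inequality. -/
noncomputable def fredholmMajorant (x : ℝ) (n : ℕ) : ℝ := x ^ n * √((n : ℝ) ^ n) / n.factorial

lemma summable_fredholmMajorant {x : ℝ} (hx : 0 ≤ x) : Summable (fredholmMajorant x) := by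
  set y : ℝ := x ^ 2 * Real.exp 1 with hy
  have hy0 : 0 ≤ y := by positivity
  have hsum : Summable fun n : ℕ => (4 * y) ^ n / (n.factorial : ℝ) + (1 / 4 : ℝ) ^ n :=
    (Real.summable_pow_div_factorial _).add
      (summable_geometric_of_lt_one (by norm_num) (by norm_num))
  refine Summable.of_nonneg_of_le (fun n => ?_) (fun n => ?_) hsum
  · unfold fredholmMajorant; positivity
  · -- `n ^ n ≤ e ^ n n!`, and `√(p q) ≤ p + q` with `q = 4 ^ (-n)`
    have hfac : (0 : ℝ) < n.factorial := by exact_mod_cast n.factorial_pos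
    have h1 : (n : ℝ) ^ n / n.factorial ≤ Real.exp 1 ^ n := by
      have := Real.pow_div_factorial_le_exp (n : ℝ) (by positivity) n
      rwa [← Real.exp_one_pow] at this
    set p : ℝ := (4 * y) ^ n / (n.factorial : ℝ) with hp
    have hp0 : 0 ≤ p := by positivity
    have hq0 : (0 : ℝ) ≤ (1 / 4 : ℝ) ^ n := by positivity
    refine abs_le_of_sq_le_sq' ?_ (by positivity) |>.2
    calc fredholmMajorant x n ^ 2
        = (x ^ 2) ^ n * ((n : ℝ) ^ n / n.factorial) / n.factorial := by
          rw [fredholmMajorant, div_pow, mul_pow, Real.sq_sqrt (by positivity)]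
          field_simp
          ring
      _ ≤ (x ^ 2) ^ n * Real.exp 1 ^ n / n.factorial := by gcongr
      _ = p * (1 / 4 : ℝ) ^ n := by
          rw [hp, hy, ← mul_pow, div_mul_eq_mul_div, ← mul_pow]
          congr 2
          ring
      _ ≤ (p + (1 / 4 : ℝ) ^ n) ^ 2 := by nlinarith

section Fredholm

variable {ι : Type*}

/-- The kernel `K` is dominated by `a x b y`, and the product `a b w` on the diagonal by the function
`g` of the parameter. -/
structure FredholmDominated (a b : ι × ℝ → ℝ) (g : ℝ → ℝ) (K : ι × ℝ → ι × ℝ → ℂ)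
    (w : ι × ℝ → ℂ) : Prop where
  pos_left : ∀ x, 0 < a x
  pos_right : ∀ x, 0 < b x
  kernel_le : ∀ x y, ‖K x y‖ ≤ a x * b y
  diag_le : ∀ c t, a (c, t) * b (c, t) * ‖w (c, t)‖ ≤ g t

lemma FredholmDominated.norm_integrand_le {a b : ι × ℝ → ℝ} {g : ℝ → ℝ}
    {K : ι × ℝ → ι × ℝ → ℂ} {w : ι × ℝ → ℂ} (hD : FredholmDominated a b g K w) {n : ℕ}
    (c : Fin n → ι) (t : Fin n → ℝ) :
    ‖(Matrix.of fun i j : Fin n => K (c i, t i) (c j, t j)).det * ∏ i, w (c i, t i)‖ ≤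
      √((n : ℝ) ^ n) * ∏ i, g (t i) := by
  have h1 := norm_det_le_of_norm_le_mul
    (A := Matrix.of fun i j : Fin n => K (c i, t i) (c j, t j))
    (fun i => hD.pos_left (c i, t i)) (fun i => hD.pos_right (c i, t i))
    (fun i j => hD.kernel_le _ _)
  rw [norm_mul, norm_prod]
  calc _ ≤ (√((n : ℝ) ^ n) * ∏ i, (a (c i, t i) * b (c i, t i))) * ∏ i, ‖w (c i, t i)‖ := by
        gcongr
    _ = √((n : ℝ) ^ n) * ∏ i, (a (c i, t i) * b (c i, t i) * ‖w (c i, t i)‖) := by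
        rw [mul_assoc, ← Finset.prod_mul_distrib]
    _ ≤ _ := by
        gcongr with i
        · intro i _
          have := hD.pos_left (c i, t i)
          have := hD.pos_right (c i, t i)
          positivity
        · exact hD.diag_le _ _

lemma integrable_prod_majorant {g : ℝ → ℝ} (hg : Integrable g) (n : ℕ) :
    Integrable fun t : Fin n → ℝ => √((n : ℝ) ^ n) * ∏ i, g (t i) :=
  (Integrable.fintype_prod (f := fun _ : Fin n => g) fun _ => hg).const_mul _

lemma FredholmDominated.norm_term_le [Fintype ι] {a b : ι × ℝ → ℝ} {g : ℝ → ℝ} (hg : Integrable g)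
    {K : ι × ℝ → ι × ℝ → ℂ} {w : ι × ℝ → ℂ} (hD : FredholmDominated a b g K w) (n : ℕ) :
    ‖(-1) ^ n / (n.factorial : ℂ) * ∑ c : Fin n → ι, ∫ t : Fin n → ℝ,
      (Matrix.of fun i j : Fin n => K (c i, t i) (c j, t j)).det * ∏ i, w (c i, t i)‖ ≤
    fredholmMajorant (Fintype.card ι * ∫ t, g t) n := by
  have h1 : ∀ c : Fin n → ι, ‖∫ t : Fin n → ℝ,
      (Matrix.of fun i j : Fin n => K (c i, t i) (c j, t j)).det * ∏ i, w (c i, t i)‖ ≤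
      √((n : ℝ) ^ n) * (∫ t, g t) ^ n := by
    intro c
    refine (norm_integral_le_of_norm_le (integrable_prod_majorant hg n)
      (Eventually.of_forall fun t => hD.norm_integrand_le c t)).trans_eq ?_
    rw [integral_const_mul]
    congr 1
    have := integral_fintype_prod_eq_prod (μ := fun _ : Fin n => (volume : Measure ℝ))
      (fun _ : Fin n => g)
    simpa using! this
  rw [norm_mul, norm_div, norm_pow, norm_neg, norm_one, one_pow, Complex.norm_natCast]
  calc _ ≤ 1 / (n.factorial : ℝ) * ∑ _c : Fin n → ι, √((n : ℝ) ^ n) * (∫ t, g t) ^ n := by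
        gcongr
        exact (norm_sum_le _ _).trans (Finset.sum_le_sum fun c _ => h1 c)
    _ = fredholmMajorant (Fintype.card ι * ∫ t, g t) n := by
        rw [fredholmMajorant, Finset.sum_const, Finset.card_univ, Fintype.card_fun,
          Fintype.card_fin, nsmul_eq_mul, mul_pow]
        push_cast
        ring

lemma FredholmDominated.integral_nonneg [Nonempty ι] {a b : ι × ℝ → ℝ} {g : ℝ → ℝ}
    {K : ι × ℝ → ι × ℝ → ℂ} {w : ι × ℝ → ℂ} (hD : FredholmDominated a b g K w) :
    0 ≤ ∫ t, g t := by
  refine MeasureTheory.integral_nonneg fun t => ?_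
  have c : ι := Classical.arbitrary ι
  have := hD.pos_left (c, t)
  have := hD.pos_right (c, t)
  exact le_trans (by positivity) (hD.diag_le c t)

lemma FredholmDominated.norm_fredholmDet_le [Fintype ι] [Nonempty ι] {a b : ι × ℝ → ℝ} {g : ℝ → ℝ}
    (hg : Integrable g) {K : ι × ℝ → ι × ℝ → ℂ} {w : ι × ℝ → ℂ}
    (hD : FredholmDominated a b g K w) :
    ‖fredholmDet K w‖ ≤ ∑' n, fredholmMajorant (Fintype.card ι * ∫ t, g t) n :=
  tsum_of_norm_bounded (summable_fredholmMajorant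
    (mul_nonneg (Nat.cast_nonneg _) hD.integral_nonneg)).hasSum (fun n => hD.norm_term_le hg n)

section Measurable

variable {Θ : Type*} [MeasurableSpace Θ]

lemma measurable_fredholm_integrand {K : Θ → ι × ℝ → ι × ℝ → ℂ} {w : Θ → ι × ℝ → ℂ}
    (hK : ∀ c d, Measurable fun p : Θ × ℝ × ℝ => K p.1 (c, p.2.1) (d, p.2.2))
    (hw : ∀ c, Measurable fun p : Θ × ℝ => w p.1 (c, p.2)) {n : ℕ} (c : Fin n → ι) :
    Measurable fun p : Θ × (Fin n → ℝ) =>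
      (Matrix.of fun i j : Fin n => K p.1 (c i, p.2 i) (c j, p.2 j)).det *
        ∏ i, w p.1 (c i, p.2 i) := by
  have h1 : ∀ i j, Measurable fun p : Θ × (Fin n → ℝ) => K p.1 (c i, p.2 i) (c j, p.2 j) :=
    fun i j => (hK (c i) (c j)).comp
      (f := fun p : Θ × (Fin n → ℝ) => (p.1, p.2 i, p.2 j)) (by fun_prop)
  have h2 : ∀ i, Measurable fun p : Θ × (Fin n → ℝ) => w p.1 (c i, p.2 i) :=
    fun i => (hw (c i)).comp (f := fun p : Θ × (Fin n → ℝ) => (p.1, p.2 i)) (by fun_prop)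
  refine Measurable.mul ?_ (Finset.measurable_prod _ fun i _ => h2 i)
  simp only [Matrix.det_apply, Matrix.of_apply]
  refine Finset.measurable_sum _ fun σ _ => Measurable.const_smul ?_ _
  exact Finset.measurable_prod _ fun i _ => h1 _ _

lemma measurable_fredholmDet [Fintype ι] [Nonempty ι] {a b : ι × ℝ → ℝ} {g : ℝ → ℝ} (hg : Integrable g)
    {K : Θ → ι × ℝ → ι × ℝ → ℂ} {w : Θ → ι × ℝ → ℂ}
    (hK : ∀ c d, Measurable fun p : Θ × ℝ × ℝ => K p.1 (c, p.2.1) (d, p.2.2))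
    (hw : ∀ c, Measurable fun p : Θ × ℝ => w p.1 (c, p.2))
    (hD : ∀ θ, FredholmDominated a b g (K θ) (w θ)) :
    Measurable fun θ => fredholmDet (K θ) (w θ) := by
  have hterm : ∀ n : ℕ, Measurable fun θ => (-1) ^ n / (n.factorial : ℂ) *
      ∑ c : Fin n → ι, ∫ t : Fin n → ℝ,
        (Matrix.of fun i j : Fin n => K θ (c i, t i) (c j, t j)).det * ∏ i, w θ (c i, t i) := by
    intro n
    refine Measurable.const_mul (Finset.measurable_sum _ fun c _ => ?_) _
    exact (StronglyMeasurable.integral_prod_right (ν := (volume : Measure (Fin n → ℝ)))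
      (f := fun θ (t : Fin n → ℝ) =>
        (Matrix.of fun i j : Fin n => K θ (c i, t i) (c j, t j)).det * ∏ i, w θ (c i, t i))
      (measurable_fredholm_integrand hK hw c).stronglyMeasurable).measurable
  refine measurable_of_tendsto_metrizable
    (f := fun N θ => ∑ n ∈ Finset.range N, (-1) ^ n / (n.factorial : ℂ) *
      ∑ c : Fin n → ι, ∫ t : Fin n → ℝ,
        (Matrix.of fun i j : Fin n => K θ (c i, t i) (c j, t j)).det * ∏ i, w θ (c i, t i))
    (fun N => Finset.measurable_sum _ fun n _ => hterm n) ?_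
  rw [tendsto_pi_nhds]
  intro θ
  exact (Summable.of_norm_bounded (summable_fredholmMajorant
    (mul_nonneg (Nat.cast_nonneg _) (hD θ).integral_nonneg))
    (fun n => (hD θ).norm_term_le hg n)).hasSum.tendsto_sum_nat

end Measurable

lemma tendsto_fredholmDet [Fintype ι] [Nonempty ι] {a b : ι × ℝ → ℝ} {g : ℝ → ℝ} (hg : Integrable g)
    {Ks : ℕ → ι × ℝ → ι × ℝ → ℂ} {K : ι × ℝ → ι × ℝ → ℂ} {w : ι × ℝ → ℂ}
    (hK : ∀ N c d, Measurable fun p : ℝ × ℝ => Ks N (c, p.1) (d, p.2))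
    (hw : ∀ c, Measurable fun t : ℝ => w (c, t))
    (hD : ∀ N, FredholmDominated a b g (Ks N) w)
    (hlim : ∀ x y, Tendsto (fun N => Ks N x y) atTop (𝓝 (K x y))) :
    Tendsto (fun N => fredholmDet (Ks N) w) atTop (𝓝 (fredholmDet K w)) := by
  refine tendsto_tsum_of_dominated_convergence (summable_fredholmMajorant
    (mul_nonneg (Nat.cast_nonneg (Fintype.card ι)) (hD 0).integral_nonneg)) (fun n => ?_)
    (Eventually.of_forall fun N n => (hD N).norm_term_le hg n)
  refine Tendsto.const_mul _ (tendsto_finsetSum _ fun c _ => ?_)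
  refine tendsto_integral_of_dominated_convergence _ (fun N => ?_) (integrable_prod_majorant hg n)
    (fun N => Eventually.of_forall fun t => (hD N).norm_integrand_le c t)
    (Eventually.of_forall fun t => ?_)
  · have h1 := measurable_fredholm_integrand (Θ := Unit) (K := fun _ => Ks N) (w := fun _ => w)
      (fun c d => (hK N c d).comp measurable_snd) (fun c => (hw c).comp measurable_snd) c
    exact (h1.comp (f := fun t : Fin n → ℝ => ((), t)) (by fun_prop)).aestronglyMeasurable
  · refine Tendsto.mul_const _ ?_
    simp only [Matrix.det_apply, Matrix.of_apply]
    refine tendsto_finsetSum _ fun σ _ => Tendsto.const_smul ?_ _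
    exact tendsto_finsetProd _ fun i _ => hlim _ _

end Fredholm

/-! ### Estimates on the contours -/

lemma IsAiryContour.continuous {θ : ℝ} {γ : ℝ → ℂ} (hγ : IsAiryContour θ γ) : Continuous γ :=
  let ⟨_, hC⟩ := hγ.lipschitz
  hC.continuous

lemma IsAiryContour.exists_norm_deriv_le {θ : ℝ} {γ : ℝ → ℂ} (hγ : IsAiryContour θ γ) :
    ∃ C : ℝ, ∀ t, ‖deriv γ t‖ ≤ C :=
  let ⟨C, hC⟩ := hγ.lipschitz
  ⟨C, fun _ => norm_deriv_le_of_lipschitz hC⟩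

lemma IsAiryContour.exists_norm_sq_le {θ : ℝ} {γ : ℝ → ℂ} (hγ : IsAiryContour θ γ) :
    ∃ C : ℝ, 0 ≤ C ∧ ∀ t, ‖γ t‖ ^ 2 ≤ C * (1 + t ^ 2) := by
  obtain ⟨C, hC⟩ := hγ.lipschitz
  refine ⟨2 * ‖γ 0‖ ^ 2 + 2 * (C : ℝ) ^ 2, by positivity, fun t => ?_⟩
  have h1 : ‖γ t‖ ≤ ‖γ 0‖ + C * |t| := by
    have h2 := hC.dist_le_mul t 0
    rw [dist_eq_norm, Real.dist_eq, sub_zero] at h2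
    calc ‖γ t‖ = ‖γ 0 + (γ t - γ 0)‖ := by rw [add_sub_cancel]
      _ ≤ _ := (norm_add_le _ _).trans (by gcongr)
  have h3 : ‖γ t‖ ^ 2 ≤ (‖γ 0‖ + C * |t|) ^ 2 := pow_le_pow_left₀ (norm_nonneg _) h1 2
  have h4 : |t| ^ 2 = t ^ 2 := sq_abs t
  nlinarith [sq_nonneg (‖γ 0‖ - C * |t|), sq_nonneg (‖γ 0‖ * t), sq_nonneg (C : ℝ)]

/-- The contour run in the opposite direction. -/
lemma IsAiryContour.tendsto_neg {θ : ℝ} {γ : ℝ → ℂ} (hγ : IsAiryContour θ γ) :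
    Tendsto (fun t : ℝ => γ (-t) / t) Filter.atTop (𝓝 (Complex.exp ((-θ : ℝ) * Complex.I))) := by
  have := hγ.atBot.comp tendsto_neg_atTop_atBot
  refine (this.congr fun t => ?_).trans_eq ?_
  · simp
  · simp

/-- A continuous function on the line that tends to `-∞` at both ends is bounded above. -/
lemma exists_forall_le_of_tendsto {f : ℝ → ℝ} (hf : Continuous f)
    (h1 : Tendsto f atTop atBot) (h2 : Tendsto (fun t => f (-t)) atTop atBot) :
    ∃ t₀, ∀ t, f t ≤ f t₀ := by
  refine hf.exists_forall_ge ?_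
  rw [cocompact_eq_atBot_atTop]
  refine Tendsto.sup ?_ h1
  simpa [Function.comp_def] using h2.comp tendsto_neg_atBot_atTop

lemma tendsto_re_div {γ : ℝ → ℂ} {φ : ℝ}
    (hγ : Tendsto (fun t : ℝ => γ t / t) atTop (𝓝 (Complex.exp (φ * Complex.I)))) :
    Tendsto (fun t : ℝ => (γ t).re / t) atTop (𝓝 (Real.cos φ)) := by
  have := (Complex.continuous_re.tendsto _).comp hγ
  rw [Complex.exp_ofReal_mul_I_re] at this
  refine this.congr fun t => ?_
  simp [Complex.div_ofReal_re]

lemma tendsto_atBot_of_div_tendsto {f g : ℝ → ℝ} {c : ℝ} (hc : c < 0)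
    (hg : Tendsto g atTop atTop) (hfg : Tendsto (fun t => f t / g t) atTop (𝓝 c)) :
    Tendsto f atTop atBot := by
  refine (hg.atTop_mul_neg hc hfg).congr' ?_
  filter_upwards [hg.eventually_gt_atTop 0] with t ht
  field_simp

lemma exists_pos_le_re_of_airy {θ : ℝ} {γ : ℝ → ℂ} (hγ : IsAiryContour θ γ)
    (hθ : 0 < Real.cos θ) (hpos : ∀ t, 0 < (γ t).re) : ∃ δ > 0, ∀ t, δ ≤ (γ t).re := by
  obtain ⟨t₀, ht₀⟩ := exists_forall_le_of_tendsto (f := fun t => -(γ t).re)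
    (Complex.continuous_re.comp hγ.continuous).neg
    (tendsto_atBot_of_div_tendsto (c := -Real.cos θ) (by linarith) tendsto_id
      (by simpa [neg_div] using! (tendsto_re_div hγ.atTop).neg))
    (tendsto_atBot_of_div_tendsto (c := -Real.cos θ) (by linarith) tendsto_id
      (by simpa [neg_div] using! (tendsto_re_div hγ.tendsto_neg).neg))
  exact ⟨(γ t₀).re, hpos t₀, fun t => by linarith [ht₀ t]⟩

lemma exists_re_le_neg_of_airy {θ : ℝ} {γ : ℝ → ℂ} (hγ : IsAiryContour θ γ)
    (hθ : Real.cos θ < 0) (hneg : ∀ t, (γ t).re < 0) : ∃ δ > 0, ∀ t, (γ t).re ≤ -δ := by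
  obtain ⟨t₀, ht₀⟩ := exists_forall_le_of_tendsto (f := fun t => (γ t).re)
    (Complex.continuous_re.comp hγ.continuous)
    (tendsto_atBot_of_div_tendsto hθ tendsto_id (tendsto_re_div hγ.atTop))
    (tendsto_atBot_of_div_tendsto hθ tendsto_id
      (by simpa using! (tendsto_re_div hγ.tendsto_neg)))
  exact ⟨-(γ t₀).re, by linarith [hneg t₀], fun t => by linarith [ht₀ t]⟩

/-- The real part of a cubic polynomial with real coefficients and without constant term. -/
def cubicRe (a₃ a₂ a₁ : ℝ) (ζ : ℂ) : ℝ := (a₃ * ζ ^ 3 + a₂ * ζ ^ 2 + a₁ * ζ : ℂ).re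

lemma continuous_cubicRe (a₃ a₂ a₁ : ℝ) : Continuous (cubicRe a₃ a₂ a₁) := by
  unfold cubicRe; fun_prop

lemma tendsto_one_div_ofReal : Tendsto (fun t : ℝ => (1 / t : ℂ)) atTop (𝓝 0) := by
  have := (Complex.continuous_ofReal.tendsto _).comp
    (tendsto_inv_atTop_zero (𝕜 := ℝ))
  simpa [Function.comp_def] using this

lemma tendsto_cubicRe_div_pow_three {γ : ℝ → ℂ} {φ : ℝ}
    (hγ : Tendsto (fun t : ℝ => γ t / t) atTop (𝓝 (Complex.exp (φ * Complex.I))))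
    (a₃ a₂ a₁ : ℝ) :
    Tendsto (fun t : ℝ => cubicRe a₃ a₂ a₁ (γ t) / t ^ 3) atTop
      (𝓝 (a₃ * Real.cos (3 * φ))) := by
  have h1 : Tendsto (fun t : ℝ => (a₃ : ℂ) * (γ t / t) ^ 3 + a₂ * (γ t / t) ^ 2 * (1 / t)
      + a₁ * (γ t / t) * ((1 / t) * (1 / t))) atTop
      (𝓝 (a₃ * Complex.exp (φ * Complex.I) ^ 3 + a₂ * Complex.exp (φ * Complex.I) ^ 2 * 0
        + a₁ * Complex.exp (φ * Complex.I) * (0 * 0))) :=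
    (((hγ.pow 3).const_mul _).add (((hγ.pow 2).const_mul _).mul tendsto_one_div_ofReal)).add
      ((hγ.const_mul _).mul (tendsto_one_div_ofReal.mul tendsto_one_div_ofReal))
  have h2 := (Complex.continuous_re.tendsto _).comp h1
  have h3 : (a₃ * Complex.exp (φ * Complex.I) ^ 3 + a₂ * Complex.exp (φ * Complex.I) ^ 2 * 0
        + a₁ * Complex.exp (φ * Complex.I) * (0 * 0) : ℂ).re = a₃ * Real.cos (3 * φ) := by
    rw [← Complex.exp_nat_mul]
    have : ((3 : ℕ) : ℂ) * (φ * Complex.I) = ((3 * φ : ℝ) : ℂ) * Complex.I := by push_cast; ring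
    rw [this, mul_zero, mul_zero, mul_zero, add_zero, add_zero, Complex.re_ofReal_mul,
      Complex.exp_ofReal_mul_I_re]
  rw [h3] at h2
  refine h2.congr' ?_
  filter_upwards [eventually_gt_atTop 0] with t ht
  have ht' : (t : ℂ) ≠ 0 := by exact_mod_cast ht.ne'
  rw [cubicRe, ← Complex.div_ofReal_re, Function.comp_apply]
  congr 1
  push_cast
  field_simp

lemma tendsto_quadraticRe_div_sq {γ : ℝ → ℂ} {φ : ℝ}
    (hγ : Tendsto (fun t : ℝ => γ t / t) atTop (𝓝 (Complex.exp (φ * Complex.I))))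
    (a₂ a₁ : ℝ) :
    Tendsto (fun t : ℝ => cubicRe 0 a₂ a₁ (γ t) / t ^ 2) atTop
      (𝓝 (a₂ * Real.cos (2 * φ))) := by
  have h1 : Tendsto (fun t : ℝ => (a₂ : ℂ) * (γ t / t) ^ 2 + a₁ * (γ t / t) * (1 / t)) atTop
      (𝓝 (a₂ * Complex.exp (φ * Complex.I) ^ 2 + a₁ * Complex.exp (φ * Complex.I) * 0)) :=
    ((hγ.pow 2).const_mul _).add ((hγ.const_mul _).mul tendsto_one_div_ofReal)
  have h2 := (Complex.continuous_re.tendsto _).comp h1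
  have h3 : (a₂ * Complex.exp (φ * Complex.I) ^ 2 + a₁ * Complex.exp (φ * Complex.I) * 0 : ℂ).re
      = a₂ * Real.cos (2 * φ) := by
    rw [← Complex.exp_nat_mul]
    have : ((2 : ℕ) : ℂ) * (φ * Complex.I) = ((2 * φ : ℝ) : ℂ) * Complex.I := by push_cast; ring
    rw [this, mul_zero, add_zero, Complex.re_ofReal_mul, Complex.exp_ofReal_mul_I_re]
  rw [h3] at h2
  refine h2.congr' ?_
  filter_upwards [eventually_gt_atTop 0] with t ht
  have ht' : (t : ℂ) ≠ 0 := by exact_mod_cast ht.ne'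
  rw [cubicRe, ← Complex.div_ofReal_re, Function.comp_apply]
  congr 1
  push_cast
  field_simp
  ring

/-- A cubic polynomial decays along the contour faster than any quadratic one. -/
lemma IsAiryContour.exists_cubicRe_le {θ : ℝ} {γ : ℝ → ℂ} (hγ : IsAiryContour θ γ)
    {a₃ : ℝ} (ha : a₃ * Real.cos (3 * θ) < 0) (a₂ a₁ A : ℝ) :
    ∃ C, ∀ t, cubicRe a₃ a₂ a₁ (γ t) ≤ C - A * t ^ 2 := by
  have key : ∀ (g : ℝ → ℂ) (φ : ℝ), a₃ * Real.cos (3 * φ) < 0 →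
      Tendsto (fun t : ℝ => g t / t) Filter.atTop (𝓝 (Complex.exp (φ * Complex.I))) →
      Tendsto (fun t => cubicRe a₃ a₂ a₁ (g t) + A * t ^ 2) Filter.atTop Filter.atBot := by
    intro g φ hφ hg
    refine tendsto_atBot_of_div_tendsto hφ (tendsto_pow_atTop (n := 3) (by norm_num)) ?_
    have h1 := (tendsto_cubicRe_div_pow_three hg a₃ a₂ a₁).add
      ((tendsto_inv_atTop_zero (𝕜 := ℝ)).const_mul A)
    rw [mul_zero, add_zero] at h1
    refine h1.congr' ?_
    filter_upwards [eventually_gt_atTop 0] with t ht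
    field_simp
  obtain ⟨t₀, ht₀⟩ := exists_forall_le_of_tendsto
    (f := fun t => cubicRe a₃ a₂ a₁ (γ t) + A * t ^ 2)
    (((continuous_cubicRe _ _ _).comp hγ.continuous).add (by fun_prop))
    (key γ θ ha hγ.atTop)
    (by simpa using key (fun t => γ (-t)) (-θ) (by simpa using ha) hγ.tendsto_neg)
  exact ⟨_, fun t => le_sub_iff_add_le.2 (ht₀ t)⟩

lemma IsAiryContour.exists_quadraticRe_le {θ : ℝ} {γ : ℝ → ℂ} (hγ : IsAiryContour θ γ)
    {a₂ : ℝ} (ha : a₂ * Real.cos (2 * θ) < 0) (a₁ : ℝ) :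
    ∃ c > 0, ∃ C, ∀ t, cubicRe 0 a₂ a₁ (γ t) ≤ C - c * t ^ 2 := by
  set c := -(a₂ * Real.cos (2 * θ)) / 2 with hc
  have hc0 : 0 < c := by rw [hc]; linarith
  have key : ∀ (g : ℝ → ℂ) (φ : ℝ), Real.cos (2 * φ) = Real.cos (2 * θ) →
      Tendsto (fun t : ℝ => g t / t) Filter.atTop (𝓝 (Complex.exp (φ * Complex.I))) →
      Tendsto (fun t => cubicRe 0 a₂ a₁ (g t) + c * t ^ 2) Filter.atTop Filter.atBot := by
    intro g φ hφ hg
    refine tendsto_atBot_of_div_tendsto (c := -c) (by linarith)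
      (tendsto_pow_atTop (n := 2) (by norm_num)) ?_
    have h1 := (tendsto_quadraticRe_div_sq hg a₂ a₁).add
      (tendsto_const_nhds (x := c))
    have h2 : a₂ * Real.cos (2 * φ) + c = -c := by rw [hφ, hc]; ring
    rw [h2] at h1
    refine h1.congr' ?_
    filter_upwards [eventually_gt_atTop 0] with t ht
    field_simp
  obtain ⟨t₀, ht₀⟩ := exists_forall_le_of_tendsto
    (f := fun t => cubicRe 0 a₂ a₁ (γ t) + c * t ^ 2)
    (((continuous_cubicRe _ _ _).comp hγ.continuous).add (by fun_prop))
    (key γ θ rfl hγ.atTop)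
    (by simpa using key (fun t => γ (-t)) (-θ) (by simp) hγ.tendsto_neg)
  exact ⟨c, hc0, _, fun t => le_sub_iff_add_le.2 (ht₀ t)⟩

/-- A contour of one of the two half planes. -/
def IsSideContour (γ : ℝ → ℂ) : Prop :=
  (IsAiryContour (2 * Real.pi / 3) γ ∧ ∀ t, (γ t).re < 0) ∨
    (IsAiryContour (Real.pi / 5) γ ∧ ∀ t, 0 < (γ t).re)

lemma IsSideContour.continuous {γ : ℝ → ℂ} (hγ : IsSideContour γ) : Continuous γ := by
  rcases hγ with h | h <;> exact h.1.continuous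

lemma IsSideContour.exists_norm_deriv_le {γ : ℝ → ℂ} (hγ : IsSideContour γ) :
    ∃ C : ℝ, ∀ t, ‖deriv γ t‖ ≤ C := by
  rcases hγ with h | h <;> exact h.1.exists_norm_deriv_le

lemma norm_fHat_of_re_neg (α τ β : ℕ → ℝ) (i : ℕ) {ζ : ℂ} (hζ : ζ.re < 0) :
    ‖fHat α τ β i ζ‖ =
      Real.exp (cubicRe (-(increment τ i / 3)) (increment α i) (increment β i) ζ) := by
  rw [fHat, if_pos hζ, fFun, Complex.norm_exp, cubicRe]
  congr 2
  push_cast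
  ring

lemma norm_fHat_of_re_pos (α τ β : ℕ → ℝ) (i : ℕ) {ζ : ℂ} (hζ : 0 < ζ.re) :
    ‖fHat α τ β i ζ‖ =
      Real.exp (cubicRe (increment τ i / 3) (-increment α i) (-increment β i) ζ) := by
  rw [fHat, if_neg (not_lt.2 hζ.le), fFun, one_div, ← Complex.exp_neg, Complex.norm_exp, cubicRe]
  congr 2
  push_cast
  ring

lemma cos_three_mul_pi_div_five_neg : Real.cos (3 * (Real.pi / 5)) < 0 :=
  Real.cos_neg_of_pi_div_two_lt_of_lt (by linarith [Real.pi_pos]) (by linarith [Real.pi_pos])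

lemma cos_two_mul_pi_div_five_pos : 0 < Real.cos (2 * (Real.pi / 5)) :=
  Real.cos_pos_of_mem_Ioo ⟨by linarith [Real.pi_pos], by linarith [Real.pi_pos]⟩

lemma cos_three_mul_two_pi_div_three : Real.cos (3 * (2 * Real.pi / 3)) = 1 := by
  rw [show 3 * (2 * Real.pi / 3) = 2 * Real.pi by ring, Real.cos_two_pi]

lemma cos_two_mul_two_pi_div_three_neg : Real.cos (2 * (2 * Real.pi / 3)) < 0 :=
  Real.cos_neg_of_pi_div_two_lt_of_lt (by linarith [Real.pi_pos]) (by linarith [Real.pi_pos])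

lemma cos_two_pi_div_three_neg : Real.cos (2 * Real.pi / 3) < 0 :=
  Real.cos_neg_of_pi_div_two_lt_of_lt (by linarith [Real.pi_pos]) (by linarith [Real.pi_pos])

lemma cos_pi_div_five_pos : 0 < Real.cos (Real.pi / 5) :=
  Real.cos_pos_of_mem_Ioo ⟨by linarith [Real.pi_pos], by linarith [Real.pi_pos]⟩

/-- If the increment of `τ` is positive, then `f̂_i` decays faster than any Gaussian. -/
lemma IsSideContour.exists_norm_fHat_le_of_pos {γ : ℝ → ℂ} (hγ : IsSideContour γ)
    {α τ β : ℕ → ℝ} {i : ℕ} (hi : 0 < increment τ i) (A : ℝ) :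
    ∃ C, ∀ t, ‖fHat α τ β i (γ t)‖ ≤ C * Real.exp (-(A * t ^ 2)) := by
  rcases hγ with ⟨h1, h2⟩ | ⟨h1, h2⟩
  · obtain ⟨C, hC⟩ := h1.exists_cubicRe_le (a₃ := -(increment τ i / 3))
      (by rw [cos_three_mul_two_pi_div_three]; linarith) (increment α i) (increment β i) A
    refine ⟨Real.exp C, fun t => ?_⟩
    rw [norm_fHat_of_re_neg _ _ _ _ (h2 t), ← Real.exp_add, ← sub_eq_add_neg]
    exact Real.exp_le_exp.2 (hC t)
  · obtain ⟨C, hC⟩ := h1.exists_cubicRe_le (a₃ := increment τ i / 3)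
      (mul_neg_of_pos_of_neg (by linarith) cos_three_mul_pi_div_five_neg)
      (-increment α i) (-increment β i) A
    refine ⟨Real.exp C, fun t => ?_⟩
    rw [norm_fHat_of_re_pos _ _ _ _ (h2 t), ← Real.exp_add, ← sub_eq_add_neg]
    exact Real.exp_le_exp.2 (hC t)

lemma IsSideContour.exists_norm_fHat_le {γ : ℝ → ℂ} (hγ : IsSideContour γ)
    {α τ β : ℕ → ℝ} {i : ℕ}
    (hi : 0 < increment τ i ∨ (increment τ i = 0 ∧ 0 < increment α i)) :
    ∃ c > 0, ∃ C, ∀ t, ‖fHat α τ β i (γ t)‖ ≤ C * Real.exp (-(c * t ^ 2)) := by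
  rcases hi with hi | ⟨hτ, hα⟩
  · exact ⟨1, one_pos, hγ.exists_norm_fHat_le_of_pos hi 1⟩
  rcases hγ with ⟨h1, h2⟩ | ⟨h1, h2⟩
  · obtain ⟨c, hc, C, hC⟩ := h1.exists_quadraticRe_le
      (mul_neg_of_pos_of_neg hα cos_two_mul_two_pi_div_three_neg) (increment β i)
    refine ⟨c, hc, Real.exp C, fun t => ?_⟩
    rw [norm_fHat_of_re_neg _ _ _ _ (h2 t), ← Real.exp_add, ← sub_eq_add_neg, hτ, zero_div,
      neg_zero]
    exact Real.exp_le_exp.2 (hC t)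
  · obtain ⟨c, hc, C, hC⟩ := h1.exists_quadraticRe_le (a₂ := -increment α i)
      (by nlinarith [cos_two_mul_pi_div_five_pos]) (-increment β i)
    refine ⟨c, hc, Real.exp C, fun t => ?_⟩
    rw [norm_fHat_of_re_pos _ _ _ _ (h2 t), ← Real.exp_add, ← sub_eq_add_neg, hτ, zero_div]
    exact Real.exp_le_exp.2 (hC t)

section Nested

variable {m : ℕ} {γL γR : ℤ → ℝ → ℂ}

lemma ContourIdx.abs_lt (k : ContourIdx m) : |(k : ℤ)| < m := by
  have := Finset.mem_Ioo.1 k.2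
  exact _root_.abs_lt.2 this

lemma IsNestedContours.isSideContour_left (hN : IsNestedContours m γL γR) (k : ContourIdx m) :
    IsSideContour (γL k) :=
  Or.inl ⟨hN.contour_left k k.abs_lt, hN.re_left k k.abs_lt⟩

lemma IsNestedContours.isSideContour_right (hN : IsNestedContours m γL γR) (k : ContourIdx m) :
    IsSideContour (γR k) :=
  Or.inr ⟨hN.contour_right k k.abs_lt, hN.re_right k k.abs_lt⟩

lemma IsNestedContours.isSideContour_S₁ (hN : IsNestedContours m γL γR) (k : ContourIdx m) :
    IsSideContour (contourS₁ γL γR k) := by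
  unfold contourS₁
  split_ifs
  exacts [hN.isSideContour_left k, hN.isSideContour_right k]

lemma IsNestedContours.isSideContour_S₂ (hN : IsNestedContours m γL γR) (k : ContourIdx m) :
    IsSideContour (contourS₂ γL γR k) := by
  unfold contourS₂
  split_ifs
  exacts [hN.isSideContour_right k, hN.isSideContour_left k]

lemma IsNestedContours.exists_pos_le_re (hN : IsNestedContours m γL γR) :
    ∃ δ > 0, ∀ (k : ContourIdx m) (t : ℝ), (γL k t).re ≤ -δ ∧ δ ≤ (γR k t).re := by
  have h : ∀ k : ContourIdx m, ∀ᶠ δ : ℝ in 𝓝[>] 0,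
      ∀ t : ℝ, (γL k t).re ≤ -δ ∧ δ ≤ (γR k t).re := by
    intro k
    obtain ⟨δ₁, h1, h1'⟩ := exists_re_le_neg_of_airy (hN.contour_left k k.abs_lt)
      cos_two_pi_div_three_neg (hN.re_left k k.abs_lt)
    obtain ⟨δ₂, h2, h2'⟩ := exists_pos_le_re_of_airy (hN.contour_right k k.abs_lt)
      cos_pi_div_five_pos (hN.re_right k k.abs_lt)
    filter_upwards [Ioo_mem_nhdsGT h1, Ioo_mem_nhdsGT h2] with δ e1 e2 t
    exact ⟨by linarith [h1' t, e1.2], by linarith [h2' t, e2.2]⟩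
  obtain ⟨δ, h1, h2⟩ := ((eventually_all.2 h).and self_mem_nhdsWithin).exists
  exact ⟨δ, h2, h1⟩

/-- Points of `S₁` and of `S₂` are at a positive distance: they lie in different half planes or on
contours of different levels. -/
lemma IsNestedContours.exists_pos_le_norm_sub (hN : IsNestedContours m γL γR) :
    ∃ δ > 0, ∀ (k k' : ContourIdx m) (s t : ℝ),
      δ ≤ ‖contourS₁ γL γR k s - contourS₂ γL γR k' t‖ := by
  obtain ⟨δ₁, h1, h1'⟩ := hN.exists_pos_le_re
  obtain ⟨δ₂, h2, h2'⟩ := hN.separated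
  have hopp : ∀ (k k' : ContourIdx m) (s t : ℝ), δ₁ ≤ ‖γL k s - γR k' t‖ := by
    intro k k' s t
    refine le_trans ?_ (Complex.abs_re_le_norm _)
    rw [Complex.sub_re]
    refine le_trans ?_ (neg_le_abs _)
    linarith [(h1' k s).1, (h1' k' t).2]
  refine ⟨min δ₁ δ₂, lt_min h1 h2, fun k k' s t => ?_⟩
  unfold contourS₁ contourS₂
  split_ifs with e1 e2 e2
  · exact (min_le_left _ _).trans (hopp k k' s t)
  · have hne : (k : ℤ) ≠ k' := fun h => e2 (h ▸ e1)
    rw [← dist_eq_norm]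
    exact (min_le_right _ _).trans (h2' k k' k.abs_lt k'.abs_lt hne s t).1
  · have hne : (k : ℤ) ≠ k' := fun h => e1 (h ▸ e2)
    rw [← dist_eq_norm]
    exact (min_le_right _ _).trans (h2' k k' k.abs_lt k'.abs_lt hne s t).2
  · rw [norm_sub_rev]
    exact (min_le_left _ _).trans (hopp k' k t s)

end Nested

/-! ### Estimates for the kernels -/

/-- The rate of Gaussian decay that is used on the contour with index `k`: the contours of level `1`
have to compensate for the growth of the characteristic function. -/
noncomputable def decayRate (C M : ℝ) (k : ℤ) : ℝ := if k = 0 then C + 1 else 1 / M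

lemma one_div_le_decayRate {C M : ℝ} (hC : 0 ≤ C) (hM : 1 ≤ M) (k : ℤ) :
    1 / M ≤ decayRate C M k := by
  have : 1 / M ≤ 1 := (div_le_one (by linarith)).2 hM
  rw [decayRate]
  split_ifs <;> linarith

/-- The numerical bounds for the contours that enter the estimate of the kernels. -/
structure ContourBounds (m : ℕ) (α τ β : ℕ → ℝ) (γL γR : ℤ → ℝ → ℂ) (C M : ℝ) : Prop where
  one_le : 1 ≤ M
  fHat_S₁ : ∀ (k : ContourIdx m) (t : ℝ), ‖fHat α τ β (level k) (contourS₁ γL γR k t)‖ ≤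
    M * Real.exp (-(decayRate C M k * t ^ 2))
  fHat_S₂ : ∀ (k : ContourIdx m) (t : ℝ), ‖fHat α τ β (level k) (contourS₂ γL γR k t)‖ ≤
    M * Real.exp (-(decayRate C M k * t ^ 2))
  sub_inv_le : ∀ (k k' : ContourIdx m) (s t : ℝ),
    ‖contourS₁ γL γR k s - contourS₂ γL γR k' t‖⁻¹ ≤ M
  deriv_S₁ : ∀ (k : ContourIdx m) (t : ℝ), ‖deriv (contourS₁ γL γR k) t‖ ≤ M
  deriv_S₂ : ∀ (k : ContourIdx m) (t : ℝ), ‖deriv (contourS₂ γL γR k) t‖ ≤ M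

lemma level_le {m : ℕ} (k : ContourIdx m) : level k ≤ m := by
  have := Finset.mem_Ioo.1 k.2
  rw [level]
  omega

lemma level_eq_one_iff {k : ℤ} : level k = 1 ↔ k = 0 := by
  rw [level]
  omega

lemma increment_pos_or {m : ℕ} {α τ : ℕ → ℝ} (hτ : ∀ i, 1 ≤ i → i ≤ m → 0 < τ i)
    (hατ : ∀ i j, 1 ≤ i → i < j → j ≤ m → τ i < τ j ∨ (τ i = τ j ∧ α i < α j)) {i : ℕ}
    (hi : 1 ≤ i) (him : i ≤ m) :
    0 < increment τ i ∨ (increment τ i = 0 ∧ 0 < increment α i) := by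
  unfold increment
  by_cases h1 : i = 1
  · subst h1
    simp only [if_true]
    exact Or.inl (hτ 1 le_rfl him)
  · simp only [if_neg h1]
    rcases hατ (i - 1) i (by omega) (by omega) him with h | ⟨h, h'⟩
    · exact Or.inl (by linarith)
    · exact Or.inr ⟨by linarith, by linarith⟩

lemma eventually_fHat_le {α τ β : ℕ → ℝ} {k : ℤ} {γ : ℝ → ℂ} (hγ : IsSideContour γ)
    (h1 : k = 0 → 0 < increment τ (level k))
    (hi : 0 < increment τ (level k) ∨
      (increment τ (level k) = 0 ∧ 0 < increment α (level k))) (C : ℝ) :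
    ∀ᶠ M : ℝ in atTop, ∀ t : ℝ, ‖fHat α τ β (level k) (γ t)‖ ≤
      M * Real.exp (-(decayRate C M k * t ^ 2)) := by
  by_cases hk : k = 0
  · obtain ⟨D, hD⟩ := hγ.exists_norm_fHat_le_of_pos (α := α) (β := β) (h1 hk) (C + 1)
    filter_upwards [eventually_ge_atTop D] with M hM t
    rw [decayRate, if_pos hk]
    exact (hD t).trans (by gcongr)
  · obtain ⟨c, hc, D, hD⟩ := hγ.exists_norm_fHat_le (β := β) hi
    filter_upwards [eventually_ge_atTop D, eventually_ge_atTop (1 / c), eventually_ge_atTop 0,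
      eventually_gt_atTop 0] with M hM hM' hM0 hM0' t
    rw [decayRate, if_neg hk]
    refine (hD t).trans ?_
    have : 1 / M ≤ c := by
      rw [div_le_iff₀ hM0']
      rwa [div_le_iff₀ hc, mul_comm] at hM'
    gcongr

lemma IsNestedContours.eventually_contourBounds {m : ℕ} {α τ β : ℕ → ℝ} {γL γR : ℤ → ℝ → ℂ}
    (hN : IsNestedContours m γL γR) (hτ : ∀ i, 1 ≤ i → i ≤ m → 0 < τ i)
    (hατ : ∀ i j, 1 ≤ i → i < j → j ≤ m → τ i < τ j ∨ (τ i = τ j ∧ α i < α j)) (C : ℝ) :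
    ∀ᶠ M : ℝ in Filter.atTop, ContourBounds m α τ β γL γR C M := by
  have hincr : ∀ k : ContourIdx m, 0 < increment τ (level k) ∨
      (increment τ (level k) = 0 ∧ 0 < increment α (level k)) := fun k =>
    increment_pos_or hτ hατ (by rw [level]; omega) (level_le k)
  have hincr1 : ∀ k : ContourIdx m, (k : ℤ) = 0 → 0 < increment τ (level k) := by
    intro k hk
    have h1 := level_eq_one_iff.2 hk
    have h2 := level_le k
    rw [h1] at h2 ⊢
    rw [increment, if_pos rfl]
    exact hτ 1 le_rfl h2
  obtain ⟨δ, hδ, hδ'⟩ := hN.exists_pos_le_norm_sub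
  have e1 := eventually_all.2 fun k : ContourIdx m =>
    eventually_fHat_le (β := β) (hN.isSideContour_S₁ k) (hincr1 k) (hincr k) C
  have e2 := eventually_all.2 fun k : ContourIdx m =>
    eventually_fHat_le (β := β) (hN.isSideContour_S₂ k) (hincr1 k) (hincr k) C
  have e3 : ∀ᶠ M : ℝ in Filter.atTop, ∀ (k : ContourIdx m) (t : ℝ),
      ‖deriv (contourS₁ γL γR k) t‖ ≤ M := eventually_all.2 fun k => by
    obtain ⟨D, hD⟩ := (hN.isSideContour_S₁ k).exists_norm_deriv_le
    filter_upwards [eventually_ge_atTop D] with M hM t using (hD t).trans hM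
  have e4 : ∀ᶠ M : ℝ in Filter.atTop, ∀ (k : ContourIdx m) (t : ℝ),
      ‖deriv (contourS₂ γL γR k) t‖ ≤ M := eventually_all.2 fun k => by
    obtain ⟨D, hD⟩ := (hN.isSideContour_S₂ k).exists_norm_deriv_le
    filter_upwards [eventually_ge_atTop D] with M hM t using (hD t).trans hM
  filter_upwards [e1, e2, e3, e4, eventually_ge_atTop 1, eventually_ge_atTop δ⁻¹]
    with M h1 h2 h3 h4 h5 h6
  exact ⟨h5, h1, h2, fun k k' s t => (inv_anti₀ hδ (hδ' k k' s t)).trans h6, h3, h4⟩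

/-- The bounds for the numbers `z_j` on the circles of integration. -/
structure ZBounds (M : ℝ) (z : ℕ → ℂ) : Prop where
  norm_le : ∀ j, ‖z j‖ ≤ 1
  inv_le : ∀ j, ‖1 / z j‖ ≤ M
  one_sub_inv_le : ∀ j, ‖1 / (1 - z j)‖ ≤ M

lemma ZBounds.norm_one_sub_le {M : ℝ} {z : ℕ → ℂ} (hz : ZBounds M z) (j : ℕ) :
    ‖1 - z j‖ ≤ 2 := by
  refine (norm_sub_le _ _).trans ?_
  rw [norm_one]
  linarith [hz.norm_le j]

lemma ZBounds.norm_one_sub_inv_le {M : ℝ} {z : ℕ → ℂ} (hz : ZBounds M z) (j : ℕ) :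
    ‖1 - 1 / z j‖ ≤ 1 + M := by
  refine (norm_sub_le _ _).trans ?_
  rw [norm_one]
  linarith [hz.inv_le j]

lemma ZBounds.norm_Q₁_le {M : ℝ} (hM : 1 ≤ M) {z : ℕ → ℂ} (hz : ZBounds M z) (m j : ℕ) :
    ‖Q₁ m z j‖ ≤ 2 * M := by
  unfold Q₁
  split_ifs
  · linarith [hz.norm_one_sub_le j]
  · rw [norm_one]; linarith
  · linarith [hz.norm_one_sub_inv_le (j - 1)]

lemma ZBounds.norm_Q₂_le {M : ℝ} (hM : 1 ≤ M) {z : ℕ → ℂ} (hz : ZBounds M z) (m j : ℕ) :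
    ‖Q₂ m z j‖ ≤ 2 * M := by
  unfold Q₂
  split_ifs
  · linarith [hz.norm_one_sub_le j]
  · rw [norm_one]; linarith
  · rw [norm_one]; linarith
  · linarith [hz.norm_one_sub_inv_le (j - 1)]

lemma ZBounds.norm_muCoeff_le {M : ℝ} (hM : 1 ≤ M) {z : ℕ → ℂ} (hz : ZBounds M z) (k : ℤ) :
    ‖muCoeff z k‖ ≤ M := by
  unfold muCoeff
  split_ifs
  · rwa [norm_one]
  · rw [div_eq_mul_one_div, norm_mul, norm_neg]
    calc _ ≤ 1 * M := mul_le_mul (hz.norm_le _) (hz.one_sub_inv_le _) (norm_nonneg _) zero_le_one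
      _ = M := one_mul M
  · exact hz.one_sub_inv_le _

lemma ZBounds.norm_muDensity_le {M : ℝ} (hM : 1 ≤ M) {z : ℕ → ℂ} (hz : ZBounds M z) (k : ℤ)
    {γ : ℝ → ℂ} {t : ℝ} (hγ : ‖deriv γ t‖ ≤ M) : ‖muDensity z k γ t‖ ≤ M * M := by
  have h2π : (1 : ℝ) ≤ 2 * Real.pi := by linarith [Real.pi_gt_three]
  rw [muDensity, norm_mul]
  refine mul_le_mul (hz.norm_muCoeff_le hM k) ?_ (norm_nonneg _) (by linarith)
  rw [norm_div, norm_mul, Complex.norm_I, mul_one]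
  have h1 : ‖(2 * Real.pi : ℂ)‖ = 2 * Real.pi := by
    rw [norm_mul, Complex.norm_real, Complex.norm_ofNat, Real.norm_eq_abs,
      abs_of_pos Real.pi_pos]
  rw [h1]
  exact (div_le_self (norm_nonneg _) h2π).trans hγ

lemma norm_indicator_add_le (p q : Prop) [Decidable p] [Decidable q] :
    ‖((if p then 1 else 0) + (if q then 1 else 0) : ℂ)‖ ≤ 2 := by
  split_ifs <;> norm_num

section KernelBounds

variable {m : ℕ} {α τ β : ℕ → ℝ} {γL γR : ℤ → ℝ → ℂ} {C M : ℝ} {z : ℕ → ℂ} {χ : ℂ → ℂ → ℂ}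

lemma ContourBounds.norm_kernel₁_le (hb : ContourBounds m α τ β γL γR C M) (hz : ZBounds M z)
    (k c : ContourIdx m) (s t : ℝ) :
    ‖kernel₁ m α τ β z (level k) (contourS₁ γL γR k s) (level c) (contourS₂ γL γR c t)‖ ≤
      4 * M ^ 3 * Real.exp (-(decayRate C M k * s ^ 2)) := by
  have hM := hb.one_le
  rw [kernel₁, norm_mul, norm_mul, norm_div, div_eq_mul_inv]
  calc _ ≤ 2 * (M * Real.exp (-(decayRate C M k * s ^ 2)) * M) * (2 * M) := by
        gcongr
        · exact norm_indicator_add_le _ _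
        · exact hb.fHat_S₁ k s
        · exact hb.sub_inv_le k c s t
        · exact hz.norm_Q₁_le hM m _
    _ = _ := by ring

lemma ContourBounds.norm_kernelInit_le (hb : ContourBounds m α τ β γL γR C M) (hC : 0 ≤ C)
    (hz : ZBounds M z)
    (hχ : ∀ s t : ℝ, ‖χ (γR 0 t) (γL 0 s)‖ ≤ C * Real.exp (C * (t ^ 2 + s ^ 2)))
    (k c : ContourIdx m) (s t : ℝ) :
    ‖kernelInit m α τ β z χ (level c) (contourS₂ γL γR c t) (level k) (contourS₁ γL γR k s)‖ ≤
      (4 * M ^ 3 + M * C) * Real.exp (-(1 / M * t ^ 2)) *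
        (if (k : ℤ) = 0 then Real.exp (C * s ^ 2) else 1) := by
  have hM := hb.one_le
  have hM0 : 0 < M := by linarith
  have hdecay : Real.exp (-(decayRate C M c * t ^ 2)) ≤ Real.exp (-(1 / M * t ^ 2)) := by
    have := one_div_le_decayRate hC hM (c : ℤ)
    gcongr
  by_cases hk : (k : ℤ) = 0
  · rw [if_pos hk, kernelInit, if_pos (level_eq_one_iff.2 hk)]
    by_cases hc : level c = 1
    · have hc0 := level_eq_one_iff.1 hc
      have h1 : (1 : ℝ) / M ≤ 1 := (div_le_one hM0).2 hM
      have hf := hb.fHat_S₂ c t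
      rw [hc, decayRate, if_pos hc0] at hf
      have hγL : contourS₁ γL γR k s = γL 0 s := by
        rw [hk, contourS₁, if_pos (by rw [level_eq_one_iff.2 rfl]; exact odd_one)]
      have hγR : contourS₂ γL γR c t = γR 0 t := by
        rw [hc0, contourS₂, if_pos (by rw [level_eq_one_iff.2 rfl]; exact odd_one)]
      rw [if_pos hc, norm_neg, norm_mul]
      rw [hγR] at hf
      rw [hγL, hγR]
      calc _ ≤ (M * Real.exp (-((C + 1) * t ^ 2))) * (C * Real.exp (C * (t ^ 2 + s ^ 2))) := by
            gcongr
            exact hχ s t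
        _ = (M * C) * Real.exp (-(1 * t ^ 2)) * Real.exp (C * s ^ 2) := by
            rw [mul_mul_mul_comm, mul_assoc (M * C), ← Real.exp_add, ← Real.exp_add]
            congr 2
            ring
        _ ≤ _ := by
            gcongr
            have : 0 ≤ 4 * M ^ 3 := by positivity
            linarith
    · rw [if_neg hc, norm_zero]
      positivity
  · rw [if_neg hk, kernelInit, if_neg (mt level_eq_one_iff.1 hk), norm_mul, norm_mul, norm_div,
      div_eq_mul_inv, mul_one]
    calc _ ≤ 2 * (M * Real.exp (-(1 / M * t ^ 2)) * M) * (2 * M) := by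
          gcongr
          · exact norm_indicator_add_le _ _
          · exact (hb.fHat_S₂ c t).trans (by gcongr)
          · exact hb.sub_inv_le k c s t
          · exact hz.norm_Q₂_le hM m _
      _ = 4 * M ^ 3 * Real.exp (-(1 / M * t ^ 2)) := by ring
      _ ≤ _ := by
          gcongr
          have : 0 ≤ M * C := by positivity
          linarith

/-- The integrand of the product kernel. -/
noncomputable def prodIntegrand (m : ℕ) (α τ β : ℕ → ℝ) (γL γR : ℤ → ℝ → ℂ) (χ : ℂ → ℂ → ℂ)
    (z : ℕ → ℂ) (x y : ContourIdx m × ℝ) (c : ContourIdx m) (t : ℝ) : ℂ :=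
  kernel₁ m α τ β z (level x.1) (contourS₁ γL γR x.1 x.2) (level c) (contourS₂ γL γR c t)
    * kernelInit m α τ β z χ (level c) (contourS₂ γL γR c t)
        (level y.1) (contourS₁ γL γR y.1 y.2)
    * muDensity z c (contourS₂ γL γR c) t

lemma ContourBounds.norm_prodIntegrand_le (hb : ContourBounds m α τ β γL γR C M) (hC : 0 ≤ C)
    (hz : ZBounds M z)
    (hχ : ∀ s t : ℝ, ‖χ (γR 0 t) (γL 0 s)‖ ≤ C * Real.exp (C * (t ^ 2 + s ^ 2)))
    (x y : ContourIdx m × ℝ) (c : ContourIdx m) (t : ℝ) :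
    ‖prodIntegrand m α τ β γL γR χ z x y c t‖ ≤
      (4 * M ^ 3 * (4 * M ^ 3 + M * C) * (M * M)) *
        (Real.exp (-(decayRate C M x.1 * x.2 ^ 2)) *
          (if (y.1 : ℤ) = 0 then Real.exp (C * y.2 ^ 2) else 1)) *
        Real.exp (-(1 / M * t ^ 2)) := by
  have hM := hb.one_le
  have hM0 : 0 < M := by linarith
  rw [prodIntegrand, norm_mul, norm_mul]
  calc _ ≤ (4 * M ^ 3 * Real.exp (-(decayRate C M x.1 * x.2 ^ 2))) *
        ((4 * M ^ 3 + M * C) * Real.exp (-(1 / M * t ^ 2)) *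
          (if (y.1 : ℤ) = 0 then Real.exp (C * y.2 ^ 2) else 1)) * (M * M) := by
        gcongr
        · exact hb.norm_kernel₁_le hz x.1 c x.2 t
        · exact hb.norm_kernelInit_le hC hz hχ y.1 c y.2 t
        · exact hz.norm_muDensity_le hM c (hb.deriv_S₂ c t)
    _ = _ := by ring

/-- The constant in the bound for the product kernel. -/
noncomputable def prodConst (m : ℕ) (C M : ℝ) : ℝ :=
  Fintype.card (ContourIdx m) * (4 * M ^ 3 * (4 * M ^ 3 + M * C) * (M * M)) *
    ∫ t : ℝ, Real.exp (-(1 / M * t ^ 2))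

lemma integrable_exp_neg_one_div_mul_sq (hM : 1 ≤ M) :
    Integrable fun t : ℝ => Real.exp (-(1 / M * t ^ 2)) := by
  have : 0 < 1 / M := by positivity
  simpa only [neg_mul] using integrable_exp_neg_mul_sq this

lemma prodConst_nonneg (hC : 0 ≤ C) (hM : 1 ≤ M) : 0 ≤ prodConst m C M := by
  have h1 : 0 ≤ ∫ t : ℝ, Real.exp (-(1 / M * t ^ 2)) :=
    integral_nonneg fun t => (Real.exp_pos _).le
  unfold prodConst
  positivity

lemma ContourBounds.norm_kernelProd_le (hb : ContourBounds m α τ β γL γR C M) (hC : 0 ≤ C)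
    (hz : ZBounds M z)
    (hχ : ∀ s t : ℝ, ‖χ (γR 0 t) (γL 0 s)‖ ≤ C * Real.exp (C * (t ^ 2 + s ^ 2)))
    (x y : ContourIdx m × ℝ) :
    ‖kernelProd m α τ β γL γR χ z x y‖ ≤ prodConst m C M *
        (Real.exp (-(decayRate C M x.1 * x.2 ^ 2)) *
          (if (y.1 : ℤ) = 0 then Real.exp (C * y.2 ^ 2) else 1)) := by
  have hint := integrable_exp_neg_one_div_mul_sq hb.one_le
  change ‖∑ c : ContourIdx m, ∫ t : ℝ, prodIntegrand m α τ β γL γR χ z x y c t‖ ≤ _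
  refine (norm_sum_le _ _).trans ((Finset.sum_le_sum fun c _ =>
    norm_integral_le_of_norm_le (hint.const_mul _)
      (Eventually.of_forall fun t => hb.norm_prodIntegrand_le hC hz hχ x y c t)).trans_eq ?_)
  rw [Finset.sum_const, Finset.card_univ, nsmul_eq_mul, integral_const_mul, prodConst]
  ring

lemma ContourBounds.fredholmDominated (hb : ContourBounds m α τ β γL γR C M) (hC : 0 ≤ C)
    (hz : ZBounds M z)
    (hχ : ∀ s t : ℝ, ‖χ (γR 0 t) (γL 0 s)‖ ≤ C * Real.exp (C * (t ^ 2 + s ^ 2))) :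
    FredholmDominated
      (fun x : ContourIdx m × ℝ =>
        (prodConst m C M + 1) * Real.exp (-(decayRate C M x.1 * x.2 ^ 2)))
      (fun y : ContourIdx m × ℝ => if (y.1 : ℤ) = 0 then Real.exp (C * y.2 ^ 2) else 1)
      (fun t => (prodConst m C M + 1) * (M * M) * Real.exp (-(1 / M * t ^ 2)))
      (kernelProd m α τ β γL γR χ z)
      (fun x => muDensity z x.1 (contourS₁ γL γR x.1) x.2) := by
  have hM := hb.one_le
  have hM0 : 0 < M := by linarith
  have hP := prodConst_nonneg (m := m) hC hM
  refine ⟨fun x => by positivity, fun y => by split_ifs <;> positivity, fun x y => ?_,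
    fun c t => ?_⟩
  · refine (hb.norm_kernelProd_le hC hz hχ x y).trans ?_
    rw [mul_assoc]
    refine mul_le_mul_of_nonneg_right (by linarith) ?_
    split_ifs <;> positivity
  · have h1 : Real.exp (-(decayRate C M c * t ^ 2)) *
        (if (c : ℤ) = 0 then Real.exp (C * t ^ 2) else 1) ≤ Real.exp (-(1 / M * t ^ 2)) := by
      rw [decayRate]
      split_ifs
      · rw [← Real.exp_add, Real.exp_le_exp]
        have h1 : (1 : ℝ) / M ≤ 1 := (div_le_one hM0).2 hM
        nlinarith [sq_nonneg t]
      · rw [mul_one]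
    calc _ = (prodConst m C M + 1) * (Real.exp (-(decayRate C M c * t ^ 2)) *
          (if (c : ℤ) = 0 then Real.exp (C * t ^ 2) else 1)) *
            ‖muDensity z c (contourS₁ γL γR c) t‖ := by ring
      _ ≤ (prodConst m C M + 1) * Real.exp (-(1 / M * t ^ 2)) * (M * M) := by
          gcongr
          exact hz.norm_muDensity_le hM c (hb.deriv_S₁ c t)
      _ = _ := by ring

end KernelBounds

/-! ### Measurability of the kernels -/

lemma measurable_fHat (α τ β : ℕ → ℝ) (i : ℕ) : Measurable (fHat α τ β i) := by
  have h1 : Measurable (fFun α τ β i) := by unfold fFun; fun_prop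
  unfold fHat
  exact Measurable.ite (measurableSet_lt Complex.measurable_re measurable_const) h1
    (measurable_const.div h1)

section Measurability

variable {Θ : Type*} [MeasurableSpace Θ] {Z : Θ → ℕ → ℂ}

lemma measurable_Q₁ (hZ : ∀ j, Measurable fun θ => Z θ j) (m j : ℕ) :
    Measurable fun θ => Q₁ m (Z θ) j := by
  unfold Q₁
  have h1 := hZ j
  have h2 := hZ (j - 1)
  split_ifs <;> fun_prop

lemma measurable_Q₂ (hZ : ∀ j, Measurable fun θ => Z θ j) (m j : ℕ) :
    Measurable fun θ => Q₂ m (Z θ) j := by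
  unfold Q₂
  have h1 := hZ j
  have h2 := hZ (j - 1)
  split_ifs <;> fun_prop

lemma measurable_muDensity (hZ : ∀ j, Measurable fun θ => Z θ j) (k : ℤ) (γ : ℝ → ℂ) :
    Measurable fun p : Θ × ℝ => muDensity (Z p.1) k γ p.2 := by
  have h1 : Measurable fun θ => muCoeff (Z θ) k := by
    unfold muCoeff
    have h2 := hZ (level k - 1)
    split_ifs <;> fun_prop
  exact (h1.comp measurable_fst).mul
    (((measurable_deriv γ).comp measurable_snd).div_const _)

lemma measurable_const_mul_div_sub_mul {X : Type*} [MeasurableSpace X] {f g₁ g₂ q : X → ℂ}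
    (hf : Measurable f) (h₁ : Measurable g₁) (h₂ : Measurable g₂) (hq : Measurable q) (c : ℂ) :
    Measurable fun x => c * (f x / (g₁ x - g₂ x)) * q x := by
  fun_prop

lemma measurable_prodIntegrand {m : ℕ} {α τ β : ℕ → ℝ} {γL γR : ℤ → ℝ → ℂ}
    (hN : IsNestedContours m γL γR) {χ : ℂ → ℂ → ℂ} (hχ : Measurable (Function.uncurry χ))
    (hZ : ∀ j, Measurable fun θ => Z θ j) (k k' c : ContourIdx m) :
    Measurable fun q : (Θ × ℝ × ℝ) × ℝ =>
      prodIntegrand m α τ β γL γR χ (Z q.1.1) (k, q.1.2.1) (k', q.1.2.2) c q.2 := by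
  have f1 := measurable_fHat α τ β (level k)
  have f2 := measurable_fHat α τ β (level c)
  have f3 := measurable_fHat α τ β 1
  have g1 := (hN.isSideContour_S₁ k).continuous.measurable
  have g2 := (hN.isSideContour_S₁ k').continuous.measurable
  have g3 := (hN.isSideContour_S₂ c).continuous.measurable
  have hμ : Measurable fun q : (Θ × ℝ × ℝ) × ℝ =>
      muDensity (Z q.1.1) c (contourS₂ γL γR c) q.2 :=
    (measurable_muDensity hZ c (contourS₂ γL γR c)).comp
      (f := fun q : (Θ × ℝ × ℝ) × ℝ => (q.1.1, q.2)) (by fun_prop)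
  have hχ' : Measurable fun q : (Θ × ℝ × ℝ) × ℝ =>
      χ (contourS₂ γL γR c q.2) (contourS₁ γL γR k' q.1.2.2) :=
    hχ.comp (f := fun q : (Θ × ℝ × ℝ) × ℝ =>
      (contourS₂ γL γR c q.2, contourS₁ γL γR k' q.1.2.2)) (by fun_prop)
  have x1 : Measurable fun q : (Θ × ℝ × ℝ) × ℝ => contourS₁ γL γR k q.1.2.1 :=
    g1.comp (by fun_prop)
  have x2 : Measurable fun q : (Θ × ℝ × ℝ) × ℝ => contourS₁ γL γR k' q.1.2.2 :=
    g2.comp (by fun_prop)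
  have x3 : Measurable fun q : (Θ × ℝ × ℝ) × ℝ => contourS₂ γL γR c q.2 :=
    g3.comp (by fun_prop)
  have q1 : Measurable fun q : (Θ × ℝ × ℝ) × ℝ => Q₁ m (Z q.1.1) (level c) :=
    (measurable_Q₁ hZ m (level c)).comp (measurable_fst.comp measurable_fst)
  have q2 : Measurable fun q : (Θ × ℝ × ℝ) × ℝ => Q₂ m (Z q.1.1) (level k') :=
    (measurable_Q₂ hZ m (level k')).comp (measurable_fst.comp measurable_fst)
  have y1 : Measurable fun q : (Θ × ℝ × ℝ) × ℝ =>
      fHat α τ β (level k) (contourS₁ γL γR k q.1.2.1) := f1.comp x1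
  have y2 : Measurable fun q : (Θ × ℝ × ℝ) × ℝ =>
      fHat α τ β (level c) (contourS₂ γL γR c q.2) := f2.comp x3
  have y3 : Measurable fun q : (Θ × ℝ × ℝ) × ℝ =>
      fHat α τ β 1 (contourS₂ γL γR c q.2) := f3.comp x3
  have h1 : Measurable fun q : (Θ × ℝ × ℝ) × ℝ =>
      kernel₁ m α τ β (Z q.1.1) (level k) (contourS₁ γL γR k q.1.2.1) (level c)
        (contourS₂ γL γR c q.2) := by
    unfold kernel₁
    exact measurable_const_mul_div_sub_mul y1 x1 x3 q1 _
  have h2 : Measurable fun q : (Θ × ℝ × ℝ) × ℝ =>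
      kernelInit m α τ β (Z q.1.1) χ (level c) (contourS₂ γL γR c q.2) (level k')
        (contourS₁ γL γR k' q.1.2.2) := by
    unfold kernelInit
    by_cases h1 : level (k' : ℤ) = 1
    · simp only [if_pos h1]
      by_cases h2 : level (c : ℤ) = 1
      · simp only [if_pos h2]
        exact (y3.fun_mul hχ').fun_neg
      · simp only [if_neg h2]
        exact measurable_const
    · simp only [if_neg h1]
      exact measurable_const_mul_div_sub_mul y2 x2 x3 q2 _
  exact (h1.fun_mul h2).fun_mul hμ

lemma measurable_kernelProd {m : ℕ} {α τ β : ℕ → ℝ} {γL γR : ℤ → ℝ → ℂ}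
    (hN : IsNestedContours m γL γR) {χ : ℂ → ℂ → ℂ} (hχ : Measurable (Function.uncurry χ))
    (hZ : ∀ j, Measurable fun θ => Z θ j) (k k' : ContourIdx m) :
    Measurable fun p : Θ × ℝ × ℝ =>
      kernelProd m α τ β γL γR χ (Z p.1) (k, p.2.1) (k', p.2.2) := by
  have : ∀ p : Θ × ℝ × ℝ, kernelProd m α τ β γL γR χ (Z p.1) (k, p.2.1) (k', p.2.2) =
      ∑ c : ContourIdx m, ∫ t : ℝ,
        prodIntegrand m α τ β γL γR χ (Z p.1) (k, p.2.1) (k', p.2.2) c t := fun p => rfl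
  simp only [this]
  refine Finset.measurable_sum _ fun c _ => ?_
  exact (StronglyMeasurable.integral_prod_right (ν := (volume : Measure ℝ))
    (f := fun (p : Θ × ℝ × ℝ) (t : ℝ) =>
      prodIntegrand m α τ β γL γR χ (Z p.1) (k, p.2.1) (k', p.2.2) c t)
    (measurable_prodIntegrand hN hχ hZ k k' c).stronglyMeasurable).measurable

end Measurability

/-! ### Continuity of the contour integral in the characteristic function -/

section MultipointFormula

variable {m : ℕ} {α τ β : ℕ → ℝ} {γL γR : ℤ → ℝ → ℂ} {C M : ℝ} {z : ℕ → ℂ}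

/-- Along the contours, `kernelInit` involves the characteristic function only at a point of
`Γ_{1,R}` and a point of `Γ_{1,L}`. -/
lemma kernelInit_contour (χ : ℂ → ℂ → ℂ) (k c : ContourIdx m) (s t : ℝ) :
    kernelInit m α τ β z χ (level c) (contourS₂ γL γR c t) (level k) (contourS₁ γL γR k s) =
      kernelInit m α τ β z (fun _ _ => χ (γR 0 t) (γL 0 s)) (level c) (contourS₂ γL γR c t)
        (level k) (contourS₁ γL γR k s) := by
  have h0 : Odd (level 0) := by rw [level_eq_one_iff.2 rfl]; exact odd_one
  by_cases hk : level k = 1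
  · by_cases hc : level c = 1
    · have hk0 := level_eq_one_iff.1 hk
      have hc0 := level_eq_one_iff.1 hc
      simp only [kernelInit, if_pos hk, if_pos hc]
      rw [hk0, hc0, contourS₁, contourS₂, if_pos h0, if_pos h0]
    · simp only [kernelInit, if_pos hk, if_neg hc]
  · simp only [kernelInit, if_neg hk]

lemma multipointFormula_congr {χ χ' : ℂ → ℂ → ℂ}
    (h : ∀ s t : ℝ, χ (γR 0 t) (γL 0 s) = χ' (γR 0 t) (γL 0 s)) (r : Fin (m - 1) → ℝ) :
    multipointFormula m α τ β γL γR r χ = multipointFormula m α τ β γL γR r χ' := by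
  have h1 : ∀ z, kernelProd m α τ β γL γR χ z = kernelProd m α τ β γL γR χ' z := by
    intro z
    funext x y
    unfold kernelProd
    refine Finset.sum_congr rfl fun c _ => integral_congr_ae (Eventually.of_forall fun t => ?_)
    dsimp only
    rw [kernelInit_contour χ, kernelInit_contour χ', h]
  simp only [multipointFormula, multipointD, h1]

lemma tendsto_kernelInit {χs : ℕ → ℂ → ℂ → ℂ} {χ : ℂ → ℂ → ℂ} {j i : ℕ} {ζ' ζ : ℂ}
    (h : Tendsto (fun n => χs n ζ' ζ) atTop (𝓝 (χ ζ' ζ))) :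
    Tendsto (fun n => kernelInit m α τ β z (χs n) j ζ' i ζ) atTop
      (𝓝 (kernelInit m α τ β z χ j ζ' i ζ)) := by
  unfold kernelInit
  split_ifs
  · exact (h.const_mul _).neg
  · exact tendsto_const_nhds
  all_goals exact tendsto_const_nhds

lemma tendsto_kernelProd (hN : IsNestedContours m γL γR)
    (hb : ContourBounds m α τ β γL γR C M) (hC : 0 ≤ C) (hz : ZBounds M z)
    {χs : ℕ → ℂ → ℂ → ℂ} {χ : ℂ → ℂ → ℂ} (hm : ∀ n, Measurable (Function.uncurry (χs n)))
    (hχ : ∀ n, ∀ s t : ℝ, ‖χs n (γR 0 t) (γL 0 s)‖ ≤ C * Real.exp (C * (t ^ 2 + s ^ 2)))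
    (hlim : ∀ s t : ℝ, Tendsto (fun n => χs n (γR 0 t) (γL 0 s)) atTop
      (𝓝 (χ (γR 0 t) (γL 0 s)))) (x y : ContourIdx m × ℝ) :
    Tendsto (fun n => kernelProd m α τ β γL γR (χs n) z x y) atTop
      (𝓝 (kernelProd m α τ β γL γR χ z x y)) := by
  change Tendsto (fun n => ∑ c : ContourIdx m, ∫ t : ℝ,
      prodIntegrand m α τ β γL γR (χs n) z x y c t) atTop
    (𝓝 (∑ c : ContourIdx m, ∫ t : ℝ, prodIntegrand m α τ β γL γR χ z x y c t))
  refine tendsto_finsetSum _ fun c _ => ?_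
  refine tendsto_integral_of_dominated_convergence _ (fun n => ?_)
    ((integrable_exp_neg_one_div_mul_sq hb.one_le).const_mul _)
    (fun n => Eventually.of_forall fun t => hb.norm_prodIntegrand_le hC hz (hχ n) x y c t)
    (Eventually.of_forall fun t => ?_)
  · have h1 := measurable_prodIntegrand (Θ := Unit) (Z := fun _ => z) (α := α) (τ := τ) (β := β)
      hN (hm n) (fun _ => measurable_const) x.1 y.1 c
    exact (h1.comp (f := fun t : ℝ => (((), x.2, y.2), t)) (by fun_prop)).aestronglyMeasurable
  · unfold prodIntegrand
    refine Tendsto.mul_const _ (Tendsto.const_mul _ ?_)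
    simp only [kernelInit_contour (χs _), kernelInit_contour χ]
    exact tendsto_kernelInit (hlim _ _)

lemma zSeq_eq_zero_or {w : Fin (m - 1) → ℂ} (j : ℕ) : zSeq w j = 0 ∨ ∃ l, zSeq w j = w l := by
  unfold zSeq
  split_ifs with h
  · exact Or.inr ⟨_, rfl⟩
  · exact Or.inl rfl

lemma norm_torusMap_zero {r : Fin (m - 1) → ℝ} (hr : ∀ l, 0 < r l ∧ r l < 1)
    (θ : Fin (m - 1) → ℝ) (l : Fin (m - 1)) : ‖torusMap 0 r θ l‖ = r l := by
  rw [torusMap, Pi.zero_apply, zero_add, norm_mul, Complex.norm_exp_ofReal_mul_I, mul_one,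
    Complex.norm_real, Real.norm_eq_abs, abs_of_pos (hr l).1]

lemma eventually_zBounds {r : Fin (m - 1) → ℝ} (hr : ∀ l, 0 < r l ∧ r l < 1) :
    ∀ᶠ M : ℝ in Filter.atTop, ∀ θ, ZBounds M (zSeq (torusMap 0 r θ)) := by
  have h1 : ∀ᶠ M : ℝ in Filter.atTop, ∀ l, 1 / r l ≤ M :=
    eventually_all.2 fun l => eventually_ge_atTop _
  have h2 : ∀ᶠ M : ℝ in Filter.atTop, ∀ l, 1 / (1 - r l) ≤ M :=
    eventually_all.2 fun l => eventually_ge_atTop _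
  filter_upwards [h1, h2, eventually_ge_atTop 1] with M h1 h2 h3 θ
  -- For an index out of range `z_j = 0`, so that `1 / z_j = 0` and `1 / (1 - z_j) = 1`.
  refine ⟨fun j => ?_, fun j => ?_, fun j => ?_⟩ <;>
    rcases zSeq_eq_zero_or (w := torusMap 0 r θ) j with h | ⟨l, h⟩ <;> rw [h]
  · simp
  · rw [norm_torusMap_zero hr]
    exact (hr l).2.le
  · simpa using zero_le_one.trans h3
  · rw [norm_div, norm_one, norm_torusMap_zero hr]
    exact h1 l
  · simpa using h3
  · rw [norm_div, norm_one]
    refine (one_div_le_one_div_of_le (sub_pos.2 (hr l).2) ?_).trans (h2 l)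
    have h4 := norm_sub_norm_le (1 : ℂ) (torusMap 0 r θ l)
    rwa [norm_one, norm_torusMap_zero hr] at h4

lemma measurable_zSeq_torusMap (r : Fin (m - 1) → ℝ) (j : ℕ) :
    Measurable fun θ : Fin (m - 1) → ℝ => zSeq (torusMap 0 r θ) j := by
  unfold zSeq
  split_ifs
  · unfold torusMap
    fun_prop
  · exact measurable_const

lemma norm_prod_cauchy_le {r : Fin (m - 1) → ℝ} (hr : ∀ l, 0 < r l ∧ r l < 1)
    (θ : Fin (m - 1) → ℝ) :
    ‖∏ l, 1 / (2 * Real.pi * Complex.I * torusMap 0 r θ l * (1 - torusMap 0 r θ l))‖ ≤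
      ∏ l, 1 / (r l * (1 - r l)) := by
  rw [norm_prod]
  refine Finset.prod_le_prod (fun l _ => norm_nonneg _) fun l _ => ?_
  have h1 := norm_sub_norm_le (1 : ℂ) (torusMap 0 r θ l)
  rw [norm_one, norm_torusMap_zero hr] at h1
  have h2 : 0 < 1 - r l := sub_pos.2 (hr l).2
  have h3 := (hr l).1
  rw [norm_div, norm_one, norm_mul, norm_mul, norm_mul, norm_mul, Complex.norm_I, mul_one,
    norm_torusMap_zero hr, Complex.norm_real, Complex.norm_ofNat, Real.norm_eq_abs,
    abs_of_pos Real.pi_pos]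
  refine one_div_le_one_div_of_le (by positivity) ?_
  have h2π : (1 : ℝ) ≤ 2 * Real.pi := by linarith [Real.pi_gt_three]
  calc r l * (1 - r l) ≤ r l * ‖1 - torusMap 0 r θ l‖ := by gcongr
    _ ≤ 2 * Real.pi * (r l * ‖1 - torusMap 0 r θ l‖) := le_mul_of_one_le_left (by positivity) h2π
    _ = _ := by ring

/-- The contour integral depends continuously on the characteristic function: pointwise convergence
along `Γ_{1,R} × Γ_{1,L}` together with a uniform Gaussian bound suffices, because the cubic
exponentials on these two contours decay faster than any Gaussian. -/
lemma tendsto_multipointFormula (hm1 : 1 ≤ m)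
    (hτ : ∀ i, 1 ≤ i → i ≤ m → 0 < τ i)
    (hατ : ∀ i j, 1 ≤ i → i < j → j ≤ m → τ i < τ j ∨ (τ i = τ j ∧ α i < α j))
    (hN : IsNestedContours m γL γR) {r : Fin (m - 1) → ℝ} (hr : ∀ l, 0 < r l ∧ r l < 1)
    (hC : 0 ≤ C) {χs : ℕ → ℂ → ℂ → ℂ} {χ : ℂ → ℂ → ℂ}
    (hm : ∀ n, Measurable (Function.uncurry (χs n)))
    (hχ : ∀ n, ∀ s t : ℝ, ‖χs n (γR 0 t) (γL 0 s)‖ ≤ C * Real.exp (C * (t ^ 2 + s ^ 2)))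
    (hlim : ∀ s t : ℝ, Tendsto (fun n => χs n (γR 0 t) (γL 0 s)) atTop
      (𝓝 (χ (γR 0 t) (γL 0 s)))) :
    Tendsto (fun n => multipointFormula m α τ β γL γR r (χs n)) atTop
      (𝓝 (multipointFormula m α τ β γL γR r χ)) := by
  have : Nonempty (ContourIdx m) := ⟨⟨0, Finset.mem_Ioo.2 ⟨by omega, by omega⟩⟩⟩
  obtain ⟨M, hb, hz⟩ :=
    ((hN.eventually_contourBounds (β := β) hτ hατ C).and (eventually_zBounds hr)).exists
  have hZ := measurable_zSeq_torusMap r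
  have hg := (integrable_exp_neg_one_div_mul_sq hb.one_le).const_mul
    ((prodConst m C M + 1) * (M * M))
  have hD := fun n θ => hb.fredholmDominated hC (hz θ) (hχ n)
  unfold multipointFormula torusIntegral
  refine tendsto_integral_of_dominated_convergence
    (fun _ => 1 * ((∏ l, 1 / (r l * (1 - r l))) * ∑' n, fredholmMajorant
      (Fintype.card (ContourIdx m) * ∫ t : ℝ,
        (prodConst m C M + 1) * (M * M) * Real.exp (-(1 / M * t ^ 2))) n))
    (fun n => ?_) ?_ (fun n => Eventually.of_forall fun θ => ?_)
    (Eventually.of_forall fun θ => ?_)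
  · have h1 : Measurable fun θ => multipointD m α τ β γL γR (χs n) (zSeq (torusMap 0 r θ)) :=
      measurable_fredholmDet hg (fun k k' => measurable_kernelProd hN (hm n) hZ k k')
        (fun k => measurable_muDensity hZ k (contourS₁ γL γR k)) (hD n)
    have h2 : Measurable fun θ : Fin (m - 1) → ℝ => torusMap 0 r θ := by
      unfold torusMap
      fun_prop
    simp only [smul_eq_mul]
    exact Measurable.aestronglyMeasurable (by fun_prop)
  · have : IsFiniteMeasure (volume.restrict
        (Set.Icc (0 : Fin (m - 1) → ℝ) fun _ => 2 * Real.pi)) :=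
      ⟨by rw [Measure.restrict_apply_univ]; exact isCompact_Icc.measure_lt_top⟩
    exact integrable_const _
  · rw [norm_smul, norm_mul]
    gcongr
    · rw [norm_prod]
      refine Finset.prod_le_one (fun _ _ => norm_nonneg _) fun l _ => ?_
      rw [norm_mul, Complex.norm_I, mul_one, norm_mul, Complex.norm_exp_ofReal_mul_I, mul_one,
        Complex.norm_real, Real.norm_eq_abs, abs_of_pos (hr l).1]
      exact (hr l).2.le
    · exact Finset.prod_nonneg fun l _ =>
        one_div_nonneg.2 (mul_nonneg (hr l).1.le (sub_nonneg.2 (hr l).2.le))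
    · exact norm_prod_cauchy_le hr θ
    · exact (hD n θ).norm_fredholmDet_le hg
  · refine Tendsto.const_smul (Tendsto.const_mul _ ?_) _
    refine tendsto_fredholmDet hg (fun n k k' => ?_) (fun k => ?_) (fun n => hD n θ)
      (tendsto_kernelProd hN hb hC (hz θ) hm hχ hlim)
    · exact (measurable_kernelProd (Θ := Unit) (Z := fun _ => zSeq (torusMap 0 r θ)) hN (hm n)
        (fun _ => measurable_const) k k').comp
        (f := fun p : ℝ × ℝ => ((), p)) (by fun_prop)
    · exact (measurable_muDensity (Θ := Unit) (Z := fun _ => zSeq (torusMap 0 r θ))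
        (fun _ => measurable_const) k (contourS₁ γL γR k)).comp
        (f := fun t : ℝ => ((), t)) (by fun_prop)

end MultipointFormula

/-! ### Convergence of the characteristic functions and of the contour integrals -/

lemma chiBound_le {L β : ℝ} (hL : 0 ≤ L) (η ξ : ℂ) :
    chiBound L β η ξ ≤
      64 * Real.exp ((25 * L + 5 * |β|) * (1 + ‖η‖ ^ 2 + ‖ξ‖ ^ 2)) := by
  have h1 := (abs_le.1 (Complex.abs_re_le_norm η))
  have h2 := (abs_le.1 (Complex.abs_re_le_norm ξ))
  unfold chiBound
  gcongr
  set u := η.re - ξ.re with hu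
  have hu2 : u ^ 2 ≤ 2 * (‖η‖ ^ 2 + ‖ξ‖ ^ 2) := by
    have h3 : η.re ^ 2 ≤ ‖η‖ ^ 2 := sq_le_sq' h1.1 h1.2
    have h4 : ξ.re ^ 2 ≤ ‖ξ‖ ^ 2 := sq_le_sq' h2.1 h2.2
    nlinarith [sq_nonneg (η.re + ξ.re)]
  have e1 : |β| * (2 * u + 1) ≤ 5 * |β| * (1 + ‖η‖ ^ 2 + ‖ξ‖ ^ 2) := by
    rw [mul_comm 5, mul_assoc]
    refine mul_le_mul_of_nonneg_left ?_ (abs_nonneg β)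
    nlinarith [sq_nonneg (u - 1)]
  have e2 : 2 * (2 * u + 1) ^ 2 * L + L * (‖ξ‖ ^ 2 + ‖η‖ ^ 2) ≤
      25 * L * (1 + ‖η‖ ^ 2 + ‖ξ‖ ^ 2) := by
    have : 2 * (2 * u + 1) ^ 2 + (‖ξ‖ ^ 2 + ‖η‖ ^ 2) ≤ 25 * (1 + ‖η‖ ^ 2 + ‖ξ‖ ^ 2) := by
      nlinarith [sq_nonneg (u - 2)]
    nlinarith
  linarith

/-- On the contours of level `1` the characteristic functions of all initial conditions supported in
`[-L, L]` and bounded by `β` have a common Gaussian bound. -/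
lemma IsNestedContours.exists_norm_integral_chiIntegrand_le {m : ℕ} (hm1 : 1 ≤ m)
    {γL γR : ℤ → ℝ → ℂ} (hN : IsNestedContours m γL γR) {μ ν : Measure C(ℝ, ℝ)}
    (hμ : IsGaussianPathLaw μ) (hν : IsGaussianPathLaw ν) {L : ℝ} (hL : 0 ≤ L) (β : ℝ) :
    ∃ C : ℝ, 0 ≤ C ∧ ∀ h : ℝ → EReal, IsCompactUSC L β h → ∀ s t : ℝ,
      ‖∫ x, chiIntegrand μ ν h (γR 0 t) (γL 0 s) x‖ ≤ C * Real.exp (C * (t ^ 2 + s ^ 2)) := by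
  obtain ⟨δ, hδ, hre⟩ := hN.exists_pos_le_re
  have h0 : |(0 : ℤ)| < m := by rw [abs_zero]; omega
  obtain ⟨A₁, hA₁, h1⟩ := (hN.contour_left 0 h0).exists_norm_sq_le
  obtain ⟨A₂, hA₂, h2⟩ := (hN.contour_right 0 h0).exists_norm_sq_le
  set D := 25 * L + 5 * |β| with hDdef
  have hD : 0 ≤ D := by positivity
  set c := min 1 δ with hcdef
  have hc : 0 < c := lt_min one_pos hδ
  set E := 384 * Real.exp (D * (1 + A₁ + A₂)) / c with hE
  have hE0 : 0 ≤ E := by positivity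
  refine ⟨E + D * (A₁ + A₂), by positivity, fun h hh s t => ?_⟩
  have hk := fun t => hre ⟨0, Finset.mem_Ioo.2 ⟨by omega, by omega⟩⟩ t
  have r1 : (γL 0 s).re ≤ -δ := (hk s).1
  have r2 : δ ≤ (γR 0 t).re := (hk t).2
  have hcu : c ≤ min 1 ((γR 0 t).re - (γL 0 s).re) := min_le_min_left _ (by linarith)
  have hB := chiBound_le (β := β) hL (γR 0 t) (γL 0 s)
  have hexp : D * (1 + ‖γR 0 t‖ ^ 2 + ‖γL 0 s‖ ^ 2) ≤
      D * (1 + A₁ + A₂) + (E + D * (A₁ + A₂)) * (t ^ 2 + s ^ 2) := by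
    have e1 : 1 + ‖γR 0 t‖ ^ 2 + ‖γL 0 s‖ ^ 2 ≤
        (1 + A₁ + A₂) + (A₁ + A₂) * (t ^ 2 + s ^ 2) := by
      nlinarith [h1 s, h2 t, mul_nonneg hA₁ (sq_nonneg t), mul_nonneg hA₂ (sq_nonneg s)]
    have e2 := mul_le_mul_of_nonneg_left e1 hD
    nlinarith [mul_nonneg hE0 (add_nonneg (sq_nonneg t) (sq_nonneg s))]
  calc _ ≤ 6 * chiBound L β (γR 0 t) (γL 0 s) / min 1 ((γR 0 t).re - (γL 0 s).re) :=
        norm_integral_chiIntegrand_le hμ hν hL hh (by linarith) (by linarith)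
    _ ≤ 6 * (64 * (Real.exp (D * (1 + A₁ + A₂)) *
          Real.exp ((E + D * (A₁ + A₂)) * (t ^ 2 + s ^ 2)))) / c := by
        rw [← Real.exp_add]
        refine div_le_div₀ (by positivity) ?_ hc hcu
        have := Real.exp_le_exp.2 hexp
        linarith
    _ = E * Real.exp ((E + D * (A₁ + A₂)) * (t ^ 2 + s ^ 2)) := by
        rw [hE]
        ring
    _ ≤ _ := by
        gcongr
        have : 0 ≤ D * (A₁ + A₂) := by positivity
        linarith

lemma measurable_uncurry_integral_chiIntegrand {μ ν : Measure C(ℝ, ℝ)} [SFinite μ] [SFinite ν]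
    {h : ℝ → EReal} (hu : UpperSemicontinuous h) :
    Measurable (Function.uncurry fun η ξ => ∫ s, chiIntegrand μ ν h η ξ s) :=
  (StronglyMeasurable.integral_prod_right (ν := (volume : Measure ℝ))
    (f := fun (p : ℂ × ℂ) (s : ℝ) => chiIntegrand μ ν h p.1 p.2 s)
    (measurable_chiIntegrand hu).stronglyMeasurable).measurable

lemma nonneg_of_ucSupport_subset {h : ℝ → EReal} (hh : IsUC h) {L : ℝ}
    (hL : ucSupport h ⊆ Set.Icc (-L) L) : 0 ≤ L := by
  obtain ⟨x, hx⟩ := hh.exists_ne_bot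
  have h1 := hL (subset_closure hx)
  linarith [h1.1, h1.2]

theorem proposition5p1 {Ω : Type*} [MeasurableSpace Ω] (P : Measure Ω) [IsProbabilityMeasure P]
    (B : ℝ → Ω → ℝ) (hB : IsTwoSidedBrownian P B)
    (L b : ℝ) (hs : ℕ → ℝ → EReal) (h : ℝ → EReal)
    (hsUC : ∀ n, IsUC (hs n)) (hUC : IsUC h)
    (hsSupp : ∀ n, ucSupport (hs n) ⊆ Set.Icc (-L) L) (hSupp : ucSupport h ⊆ Set.Icc (-L) L)
    (hsBound : ∀ n x, hs n x ≤ (b : EReal)) (hBound : ∀ x, h x ≤ (b : EReal))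
    (hconv : TendstoUC hs h) :
    (∀ η ξ : ℂ, 0 < η.re → ξ.re < 0 →
      Tendsto (fun n => chi P B (hs n) η ξ) atTop (𝓝 (chi P B h η ξ))) ∧
    (∀ (m : ℕ), 1 ≤ m → ∀ α τ β : ℕ → ℝ,
      (∀ i, 1 ≤ i → i ≤ m → 0 < τ i) →
      (∀ i j, 1 ≤ i → i < j → j ≤ m → τ i < τ j ∨ (τ i = τ j ∧ α i < α j)) →
      ∀ γL γR : ℤ → ℝ → ℂ, IsNestedContours m γL γR →
      ∀ r : Fin (m - 1) → ℝ, (∀ l, 0 < r l ∧ r l < 1) →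
      Tendsto (fun n => multipointFormula m α τ β γL γR r (chi P B (hs n))) atTop
        (𝓝 (multipointFormula m α τ β γL γR r (chi P B h)))) := by
  have hL := nonneg_of_ucSupport_subset hUC hSupp
  have hsC : ∀ n, IsCompactUSC L b (hs n) := fun n => ⟨(hsUC n).usc, hsSupp n, hsBound n⟩
  have hC : IsCompactUSC L b h := ⟨hUC.usc, hSupp, hBound⟩
  obtain ⟨μ, hμ, hμP⟩ := exists_pathLaw hB.right
  obtain ⟨ν, hν, hνP⟩ := exists_pathLaw (Y := fun a => B (-a)) hB.left
  have := hμ.isProbabilityMeasure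
  have := hν.isProbabilityMeasure
  refine ⟨fun η ξ hη hξ => ?_, fun m hm1 α τ β hτ hατ γL γR hN r hr => ?_⟩
  · rw [chi_eq_integral hμ hν hμP hνP hL hC hη hξ]
    simp only [fun n => chi_eq_integral hμ hν hμP hνP hL (hsC n) hη hξ]
    exact tendsto_integral_chiIntegrand hμ hν hL hsC hC hconv hη hξ
  · have h0 : |(0 : ℤ)| < m := by rw [abs_zero]; omega
    have hηt := hN.re_right 0 h0
    have hξs := hN.re_left 0 h0
    rw [multipointFormula_congr (χ := chi P B h)
      (χ' := fun η ξ => ∫ x, chiIntegrand μ ν h η ξ x)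
      fun s t => chi_eq_integral hμ hν hμP hνP hL hC (hηt t) (hξs s)]
    simp only [fun n => multipointFormula_congr (m := m) (α := α) (τ := τ) (β := β)
      (γL := γL) (γR := γR) (χ := chi P B (hs n))
      (χ' := fun η ξ => ∫ x, chiIntegrand μ ν (hs n) η ξ x)
      (fun s t => chi_eq_integral hμ hν hμP hνP hL (hsC n) (hηt t) (hξs s)) r]
    obtain ⟨C, hC0, hbound⟩ := hN.exists_norm_integral_chiIntegrand_le hm1 hμ hν hL b
    exact tendsto_multipointFormula hm1 hτ hατ hN hr hC0
      (fun n => measurable_uncurry_integral_chiIntegrand (hsC n).usc)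
      (fun n s t => hbound (hs n) (hsC n) s t)
      (fun s t => tendsto_integral_chiIntegrand hμ hν hL hsC hC hconv (hηt t) (hξs s))
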